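/- Let $z_0,\dots,z_{n-1}$ be a (multi-)set $Z$ of $n\ge 1$ positive integers, let $t\ge 1$ be an integer, and let $S(Z;t)$ be the set of all sums of sub-(multi-)sets of $Z$ that are at most $t$. The machine model is the randomized word RAM: memory cells hold words of $w$ bits, arithmetic operations and comparisons of words, indirect memory access, tests, and drawing a uniformly random word take constant time, $w$ is at least a sufficiently large constant multiple of $\log(n+t)$, and $n$, $t$ and the numbers $z_i$ each fit into one word. All logarithms are base 2; programs do not depend on the input or on $w$, and constants are absolute. (1) SubsetSum (is $t\in S(Z;t)$?) can be solved in worst-case time $\tilde O(n+t)=O\big((n+t)\,\mathrm{polylog}(n+t)\big)$ by a randomized algorithm with one-sided error: if $t\notin S(Z;t)$ it always answers no, and if $t\in S(Z;t)$ it answers yes with probability at least $1-(n+t)^{-\Omega(1)}$. (2) More precisely, there is a randomized algorithm that, given $Z$, $t$ and an error bound $\delta\in(0,1)$ (passed as the number $\lceil\log(1/\delta)\rceil$, which fits into one word), computes in worst-case time $O\big(n+t\,\log t\,\log^3(n/\delta)\,\log n\big)$ the characteristic vector of a set $S$ that always satisfies $S\subseteq S(Z;t)$ and that contains each fixed $s\in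 S(Z;t)$ with probability at least $1-\delta$. -/

import Mathlib

/-! A randomized word RAM with cell size `w`, its step-counting semantics, and subset sums.

Programs are finite and do not depend on `w` or on the input. All values that a program computes
are words, that is, natural numbers below `2 ^ w`. -/

namespace WordRAM

/-- The binary operations on words that take constant time. -/
inductive Op
  | add
  | sub
  | mul
  | div
  | mod
  | lt
  | eq

/-- Operations on words of `w` bits. Addition and multiplication are modulo `2 ^ w`, subtraction is
truncated at `0`, division is integer division, and comparisons return `1` (true) or `0` (false). -/
def Op.eval (w : ℕ) : Op → ℕ → ℕ → ℕ
  | .add, a, b => (a + b) % 2 ^ w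
  | .sub, a, b => a - b
  | .mul, a, b => (a * b) % 2 ^ w
  | .div, a, b => a / b
  | .mod, a, b => a % b
  | .lt, a, b => (if a < b then 1 else 0) % 2 ^ w
  | .eq, a, b => (if a = b then 1 else 0) % 2 ^ w

/-- Expressions: constants, registers, memory cells addressed indirectly, and operations. -/
inductive Expr
  | const (k : ℕ)
  | reg (x : ℕ)
  | load (addr : Expr)
  | op (o : Op) (e₁ e₂ : Expr)

/-- The value of an expression, for the given contents of the registers and of the memory. -/
def Expr.eval (w : ℕ) (reg mem : ℕ → ℕ) : Expr → ℕ
  | .const k => k % 2 ^ w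
  | .reg x => reg x
  | .load a => mem (a.eval w reg mem)
  | .op o e₁ e₂ => o.eval w (e₁.eval w reg mem) (e₂.eval w reg mem)

/-- Programs. `rand x` puts a fresh uniformly random word into register `x`. -/
inductive Prog
  | skip
  | assign (x : ℕ) (e : Expr)
  | store (addr e : Expr)
  | rand (x : ℕ)
  | seq (p q : Prog)
  | cond (e : Expr) (p q : Prog)
  | loop (e : Expr) (p : Prog)

/-- A configuration: what remains to be executed (in this order), the registers, the memory. -/
structure Config where
  todo : List Prog
  reg : ℕ → ℕ
  mem : ℕ → ℕ

/-- The machine has halted when nothing remains to be executed. -/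
def Config.Halted (σ : Config) : Prop := σ.todo = []

/-- One step of the machine with word size `w`, as a distribution on the next configuration.
A step executes one command or one test. It evaluates at most two expressions of the program; as
the program is fixed, these have constant size. A halted machine stays as it is. -/
noncomputable def step (w : ℕ) (σ : Config) : PMF Config :=
  match σ.todo with
  | [] => PMF.pure σ
  | .skip :: k => PMF.pure { σ with todo := k }
  | .assign x e :: k =>
      PMF.pure { σ with todo := k, reg := Function.update σ.reg x (e.eval w σ.reg σ.mem) }
  | .store a e :: k =>
      PMF.pure { σ with
        todo := k
        mem := Function.update σ.mem (a.eval w σ.reg σ.mem) (e.eval w σ.reg σ.mem) }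
  | .rand x :: k =>
      (PMF.uniformOfFintype (Fin (2 ^ w))).map fun r =>
        { σ with todo := k, reg := Function.update σ.reg x r }
  | .seq p q :: k => PMF.pure { σ with todo := p :: q :: k }
  | .cond e p q :: k =>
      PMF.pure { σ with todo := (if e.eval w σ.reg σ.mem ≠ 0 then p else q) :: k }
  | .loop e p :: k =>
      PMF.pure { σ with todo := if e.eval w σ.reg σ.mem ≠ 0 then p :: .loop e p :: k else k }

/-- The distribution of the configuration after `T` steps. -/
noncomputable def run (w : ℕ) : ℕ → Config → PMF Config
  | 0, σ => PMF.pure σ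
  | T + 1, σ => (step w σ).bind (run w T)

/-- The initial configuration of program `P`: the registers `0, 1, …` hold the entries of `params`,
the memory cells `0, …, n - 1` hold the numbers `z`, and all others hold `0`. -/
def initial (P : Prog) (params : List ℕ) {n : ℕ} (z : Fin n → ℕ) : Config where
  todo := [P]
  reg := fun x => params.getD x 0
  mem := fun a => if h : a < n then z ⟨a, h⟩ else 0

/-- The machine answers yes when register `0` is nonzero. -/
def Config.Accepts (σ : Config) : Prop := σ.reg 0 ≠ 0

/-- The subset of `{0, …, t}` that is output by its characteristic vector: register `0` holds the
address of the vector, which has length `t + 1`, and nonzero entries mean true. -/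
def Config.outputSet (σ : Config) (t : ℕ) : Set ℕ := {s | s ≤ t ∧ σ.mem (σ.reg 0 + s) ≠ 0}

end WordRAM

/-- All sums, bounded by `t`, of subsets of the multiset of numbers `z 0, …, z (n - 1)`. -/
def subsetSums {n : ℕ} (z : Fin n → ℕ) (t : ℕ) : Set ℕ :=
  {s | s ≤ t ∧ ∃ Y : Finset (Fin n), ∑ i ∈ Y, z i = s}

/-! Give every value v ≤ t a random weight r_v in a prime field F_p and let μ_v be the multiplicity
of v in Z, capped at t. By the binomial theorem the coefficient of X^s in ∏_v (1 + r_v X^v)^{μ_v} is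
the sum of ∏_v binom(μ_v, c_v) r_v^{c_v} over all choices 0 ≤ c_v ≤ μ_v with ∑ v c_v = s. If s is
not a subset sum, there is no such choice and the coefficient vanishes for all weights, so the error
is one-sided. Otherwise the coefficient is a nonzero polynomial in the weights: different choices
give different monomials, and μ_v < p keeps the binomials nonzero modulo p. Its degree is at most s
≤ t, so by Schwartz–Zippel it vanishes with probability at most 1/2 when the weights come from a set
of at least 2t residues, and with probability at most 2^{-L} in all of L independent repetitions
(`exists_choice_iff`, `coeffPoly_ne_zero`, `two_pow_mul_card_le`).

The coefficients up to t come from the logarithmic derivative. With respect to X d/dX it is a sum of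
geometric progressions; the value v contributes about t/v terms, which makes a harmonic sum of order
t log t (`runs_logDeriv`). A series with constant term 1 is recovered from its logarithmic
derivative by Newton's iteration (`newton_exp`), at the price of boundedly many multiplications of
full length, because the precision doubles in each round; p > t permits the division by indices. For
the multiplication, F_p need not contain suitable roots of unity. Elements of F_p[z]/(z^{mr} + 1)
are therefore rewritten as polynomials in x over F_p[y]/(y^r + 1) with y = z^m, where powers of y
serve as roots of unity, and the construction recurses on products modulo y^r + 1. This takes O(N
log N log log N) operations (`Conv.works`).

If n is at most about log t, or at most L, a dynamic program with time O(nt) is good enough and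
makes no error. Otherwise log log t is at most about log n; this is where the factor log n comes
from. For n = 1 the time bound does not depend on t, so this case has its own program.

On the side of the machine, programs are analysed with exact arithmetic on stored numbers below B =
(n + t)^13. The value of an expression is below a power of B with constant exponent, so words of a
constant multiple of log(n + t) bits never overflow (`Reach.real_of_ideal`). Input numbers and the
number of repetitions can be larger; they are capped in advance, using comparisons only. Randomness
is drawn in a single loop with deterministic computations around it. Hence the final configuration
is the image of a uniformly random vector (`Spreads`), and probabilities reduce to counting. -/

namespace WordRAM

/-! ### Exact arithmetic versus words: semantics without overflow and rules for running times -/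

/-- Registers and memory. -/
@[ext]
structure St where
  reg : ℕ → ℕ
  mem : ℕ → ℕ

/-- Operations on natural numbers without overflow. -/
def Op.ideal : Op → ℕ → ℕ → ℕ
  | .add, a, b => a + b
  | .sub, a, b => a - b
  | .mul, a, b => a * b
  | .div, a, b => a / b
  | .mod, a, b => a % b
  | .lt, a, b => if a < b then 1 else 0
  | .eq, a, b => if a = b then 1 else 0

/-- The value of an expression without overflow. -/
def Expr.val (s : St) : Expr → ℕ
  | .const k => k
  | .reg x => s.reg x
  | .load a => s.mem (a.val s)
  | .op o e₁ e₂ => o.ideal (e₁.val s) (e₂.val s)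

/-- An exponent that bounds the values of an expression. -/
def Expr.wt : Expr → ℕ
  | .const k => k + 1
  | .reg _ => 1
  | .load a => a.wt
  | .op _ e₁ e₂ => e₁.wt + e₂.wt

/-- The sum of the weights of the expressions of a program. -/
def Prog.wt : Prog → ℕ
  | .skip => 1
  | .assign _ e => e.wt
  | .store a e => a.wt + e.wt
  | .rand _ => 1
  | .seq p q => p.wt + q.wt
  | .cond e p q => e.wt + p.wt + q.wt
  | .loop e p => e.wt + p.wt

namespace Expr

instance : Add Expr := ⟨.op .add⟩
instance : Sub Expr := ⟨.op .sub⟩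
instance : Mul Expr := ⟨.op .mul⟩
instance : Div Expr := ⟨.op .div⟩
instance : Mod Expr := ⟨.op .mod⟩
instance (n : ℕ) : OfNat Expr n := ⟨.const n⟩

/-- The comparison `a < b`. -/
def less (a b : Expr) : Expr := .op .lt a b

/-- The comparison `a = b`. -/
def same (a b : Expr) : Expr := .op .eq a b

variable (s : St) (a b : Expr)

@[simp] theorem val_const (k : ℕ) : (Expr.const k).val s = k := rfl
@[simp] theorem val_reg (x : ℕ) : (Expr.reg x).val s = s.reg x := rfl
@[simp] theorem val_load : (Expr.load a).val s = s.mem (a.val s) := rfl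
@[simp] theorem val_add : (a + b).val s = a.val s + b.val s := rfl
@[simp] theorem val_sub : (a - b).val s = a.val s - b.val s := rfl
@[simp] theorem val_mul : (a * b).val s = a.val s * b.val s := rfl
@[simp] theorem val_div : (a / b).val s = a.val s / b.val s := rfl
@[simp] theorem val_mod : (a % b).val s = a.val s % b.val s := rfl
@[simp] theorem val_zero : (0 : Expr).val s = 0 := rfl
@[simp] theorem val_one : (1 : Expr).val s = 1 := rfl
@[simp] theorem val_ofNat (n : ℕ) : (ofNat(n) : Expr).val s = (OfNat.ofNat n : ℕ) := rfl
@[simp] theorem val_less : (less a b).val s = if a.val s < b.val s then 1 else 0 := rfl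
@[simp] theorem val_same : (same a b).val s = if a.val s = b.val s then 1 else 0 := rfl

theorem one_le_wt : ∀ e : Expr, 1 ≤ e.wt
  | .const k => by simp [wt]
  | .reg _ => le_rfl
  | .load a => one_le_wt a
  | .op _ a b => by have := one_le_wt a; simp only [wt]; omega

/-- All registers and memory cells hold numbers below `B`. -/
def _root_.WordRAM.St.Bdd (B : ℕ) (s : St) : Prop := (∀ x, s.reg x < B) ∧ ∀ a, s.mem a < B

/-- Numbers below `B ^ a` and `B ^ b` with `a, b ≥ 1` have sum and product below `B ^ (a + b)`; the
other operations yield at most their first argument or a bit. So the exponent depends on the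
expression only. -/
theorem val_lt_pow {B : ℕ} (hB : 2 ≤ B) {s : St} (hs : s.Bdd B) : ∀ e : Expr, e.val s < B ^ e.wt
  | .const k => (Nat.lt_pow_self (n := k) (by omega : 1 < B)).trans_le
      (Nat.pow_le_pow_right (by omega) (by simp [wt]))
  | .reg x => by simpa [wt] using hs.1 x
  | .load a => by
      have h := hs.2 (a.val s)
      exact h.trans_le (Nat.le_self_pow (by have := a.one_le_wt; simp [wt]; omega) B)
  | .op o a b => by
      have ha := val_lt_pow hB hs a
      have hb := val_lt_pow hB hs b
      have h1 : B ≤ B ^ a.wt := Nat.le_self_pow (by have := a.one_le_wt; omega) B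
      have h2 : B ≤ B ^ b.wt := Nat.le_self_pow (by have := b.one_le_wt; omega) B
      have hle : B ^ a.wt ≤ B ^ a.wt * B ^ b.wt := Nat.le_mul_of_pos_right _ (by omega)
      have h4 : 1 < B ^ a.wt * B ^ b.wt := by nlinarith
      simp only [wt, pow_add, val]
      cases o <;> simp only [Op.ideal]
      · nlinarith
      · exact ((Nat.sub_le _ _).trans_lt ha).trans_le hle
      · exact Nat.mul_lt_mul'' ha hb
      · exact ((Nat.div_le_self _ _).trans_lt ha).trans_le hle
      · exact ((Nat.mod_le _ _).trans_lt ha).trans_le hle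
      · split_ifs <;> omega
      · split_ifs <;> omega

theorem eval_eq_val {B w : ℕ} (hB : 2 ≤ B) {s : St} (hs : s.Bdd B) :
    ∀ e : Expr, B ^ e.wt ≤ 2 ^ w → e.eval w s.reg s.mem = e.val s
  | .const k, h => by
      have := val_lt_pow hB hs (.const k)
      exact Nat.mod_eq_of_lt (this.trans_le h)
  | .reg x, _ => rfl
  | .load a, h => by
      simp only [eval, val, eval_eq_val hB hs a h]
  | .op o a b, h => by
      have h1 : B ^ a.wt ≤ 2 ^ w :=
        (Nat.pow_le_pow_right (by omega) (by simp [wt])).trans h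
      have h2 : B ^ b.wt ≤ 2 ^ w :=
        (Nat.pow_le_pow_right (by omega) (by simp [wt])).trans h
      have := (val_lt_pow hB hs (.op o a b)).trans_le h
      simp only [eval, val, eval_eq_val hB hs a h1, eval_eq_val hB hs b h2] at this ⊢
      cases o <;> simp only [Op.ideal, Op.eval] at this ⊢ <;> exact Nat.mod_eq_of_lt this

end Expr

/-- A deterministic semantics: how expressions are evaluated, and which values may be stored. -/
structure Sem where
  ev : Expr → St → ℕ
  ok : ℕ → Prop

/-- The semantics of the machine with word size `w`. -/
def Sem.real (w : ℕ) : Sem := ⟨fun e s => e.eval w s.reg s.mem, fun _ => True⟩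

/-- Evaluation without overflow, where all stored values have to stay below `B`. -/
def Sem.ideal (B : ℕ) : Sem := ⟨fun e s => e.val s, fun v => v < B⟩

namespace St

/-- Assignment to a register. -/
def setReg (s : St) (x v : ℕ) : St := ⟨Function.update s.reg x v, s.mem⟩

/-- Assignment to a memory cell. -/
def setMem (s : St) (a v : ℕ) : St := ⟨s.reg, Function.update s.mem a v⟩

@[simp] theorem setReg_mem (s : St) (x v : ℕ) : (s.setReg x v).mem = s.mem := rfl
@[simp] theorem setMem_reg (s : St) (x v : ℕ) : (s.setMem x v).reg = s.reg := rfl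
@[simp] theorem setReg_reg (s : St) (x v y : ℕ) :
    (s.setReg x v).reg y = if y = x then v else s.reg y := Function.update_apply ..
@[simp] theorem setMem_mem (s : St) (a v b : ℕ) :
    (s.setMem a v).mem b = if b = a then v else s.mem b := Function.update_apply ..

end St

/-- `Reach M T k s k' s'`: the machine without randomness comes in `T` steps from `(k, s)` to
`(k', s')`. -/
inductive Reach (M : Sem) : ℕ → List Prog → St → List Prog → St → Prop
  | refl (k s) : Reach M 0 k s k s
  | skip {T k s k' s'} : Reach M T k s k' s' → Reach M (T + 1) (.skip :: k) s k' s'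
  | assign {T k s k' s'} (x e) : M.ok (M.ev e s) → Reach M T k (s.setReg x (M.ev e s)) k' s' →
      Reach M (T + 1) (.assign x e :: k) s k' s'
  | store {T k s k' s'} (a e) : M.ok (M.ev e s) →
      Reach M T k (s.setMem (M.ev a s) (M.ev e s)) k' s' →
      Reach M (T + 1) (.store a e :: k) s k' s'
  | seq {T k s k' s'} (p q) : Reach M T (p :: q :: k) s k' s' →
      Reach M (T + 1) (.seq p q :: k) s k' s'
  | condT {T k s k' s'} (e p q) : M.ev e s ≠ 0 → Reach M T (p :: k) s k' s' →
      Reach M (T + 1) (.cond e p q :: k) s k' s'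
  | condF {T k s k' s'} (e p q) : M.ev e s = 0 → Reach M T (q :: k) s k' s' →
      Reach M (T + 1) (.cond e p q :: k) s k' s'
  | loopT {T k s k' s'} (e p) : M.ev e s ≠ 0 → Reach M T (p :: .loop e p :: k) s k' s' →
      Reach M (T + 1) (.loop e p :: k) s k' s'
  | loopF {T k s k' s₁} (e p) : M.ev e s = 0 → Reach M T k s k' s₁ →
      Reach M (T + 1) (.loop e p :: k) s k' s₁

/-- The configuration with remaining programs `k` and state `s`. -/
def conf (k : List Prog) (s : St) : Config := ⟨k, s.reg, s.mem⟩

theorem Reach.run_real {w T k s k' s'} (h : Reach (Sem.real w) T k s k' s') :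
    run w T (conf k s) = PMF.pure (conf k' s') := by
  induction h with
  | refl => rfl
  | condT e p q he _ ih =>
      rw [run, step, conf]; dsimp only [Sem.real] at he
      rw [PMF.pure_bind]; simpa [he, conf] using ih
  | condF e p q he _ ih =>
      rw [run, step, conf]; dsimp only [Sem.real] at he
      rw [PMF.pure_bind]; simpa [he, conf] using ih
  | loopT e p he _ ih =>
      rw [run, step, conf]; dsimp only [Sem.real] at he
      rw [PMF.pure_bind]; simpa [he, conf] using ih
  | loopF e p he _ ih =>
      rw [run, step, conf]; dsimp only [Sem.real] at he
      rw [PMF.pure_bind]; simpa [he, conf] using ih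
  | _ => rw [run, step, conf]; simp only [PMF.pure_bind]; assumption

/-- Two invariants hold along the run: all stored values stay below `B`, which `ok` enforces at each
assignment, and every pending program has small weight, since the parts of a program weigh no more
than the whole. Together they exclude overflow in every evaluation. -/
theorem Reach.real_of_ideal {B w T k s k' s'} (hB : 2 ≤ B) (h : Reach (Sem.ideal B) T k s k' s')
    (hs : s.Bdd B) (hk : ∀ p ∈ k, B ^ p.wt ≤ 2 ^ w) :
    Reach (Sem.real w) T k s k' s' ∧ s'.Bdd B := by
  have key : ∀ {s : St} {e : Expr} {n : ℕ}, s.Bdd B → B ^ n ≤ 2 ^ w → e.wt ≤ n →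
      (Sem.real w).ev e s = (Sem.ideal B).ev e s := fun hs hn he =>
    Expr.eval_eq_val hB hs _ ((Nat.pow_le_pow_right (by omega) he).trans hn)
  have mono : ∀ {m n : ℕ}, B ^ n ≤ 2 ^ w → m ≤ n → B ^ m ≤ 2 ^ w := fun hn he =>
    (Nat.pow_le_pow_right (by omega) he).trans hn
  induction h with
  | refl => exact ⟨.refl _ _, hs⟩
  | skip _ ih => exact (ih hs fun p hp => hk p (by simp [hp])).imp_left .skip
  | @assign _ _ s _ _ x e he _ ih =>
      have h0 : (Sem.real w).ev e s = _ := key hs (hk _ List.mem_cons_self) le_rfl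
      have h1 := ih ⟨fun y => by
        rw [St.setReg_reg]; split_ifs; exacts [he, hs.1 y], hs.2⟩ fun p hp => hk p (by simp [hp])
      exact ⟨.assign x e trivial (by rw [h0]; exact h1.1), h1.2⟩
  | @store _ _ s _ _ a e he _ ih =>
      have h0 : (Sem.real w).ev e s = _ := key hs (hk _ List.mem_cons_self) (by simp [Prog.wt])
      have h2 : (Sem.real w).ev a s = _ := key hs (hk _ List.mem_cons_self) (by simp [Prog.wt])
      have h1 := ih ⟨hs.1, fun y => by
        rw [St.setMem_mem]; split_ifs; exacts [he, hs.2 y]⟩ fun p hp => hk p (by simp [hp])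
      exact ⟨.store a e trivial (by rw [h0, h2]; exact h1.1), h1.2⟩
  | seq p q _ ih =>
      have hw := hk _ List.mem_cons_self
      refine (ih hs fun r hr => ?_).imp_left (.seq p q)
      simp only [List.mem_cons] at hr
      rcases hr with rfl | rfl | hr
      · exact mono hw (by simp [Prog.wt])
      · exact mono hw (by simp [Prog.wt])
      · exact hk _ (by simp [hr])
  | condT e p q he _ ih =>
      have hw := hk _ List.mem_cons_self
      refine (ih hs fun r hr => ?_).imp_left (.condT e p q ?_)
      · simp only [List.mem_cons] at hr
        rcases hr with rfl | hr
        · exact mono hw (by simp only [Prog.wt]; omega)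
        · exact hk _ (by simp [hr])
      · rw [key hs hw (by simp only [Prog.wt]; omega)]; exact he
  | condF e p q he _ ih =>
      have hw := hk _ List.mem_cons_self
      refine (ih hs fun r hr => ?_).imp_left (.condF e p q ?_)
      · simp only [List.mem_cons] at hr
        rcases hr with rfl | hr
        · exact mono hw (by simp only [Prog.wt]; omega)
        · exact hk _ (by simp [hr])
      · rw [key hs hw (by simp only [Prog.wt]; omega)]; exact he
  | loopT e p he _ ih =>
      have hw := hk _ List.mem_cons_self
      refine (ih hs fun r hr => ?_).imp_left (.loopT e p ?_)
      · simp only [List.mem_cons] at hr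
        rcases hr with rfl | rfl | hr
        · exact mono hw (by simp only [Prog.wt]; omega)
        · exact hw
        · exact hk _ (by simp [hr])
      · rw [key hs hw (by simp only [Prog.wt]; omega)]; exact he
  | loopF e p he _ ih =>
      have hw := hk _ List.mem_cons_self
      refine (ih hs fun r hr => hk _ (by simp [hr])).imp_left (.loopF e p ?_)
      rw [key hs hw (by simp only [Prog.wt]; omega)]; exact he

theorem Reach.trans {M T₁ T₂ k₁ s₁ k₂ s₂ k₃ s₃} (h₁ : Reach M T₁ k₁ s₁ k₂ s₂)
    (h₂ : Reach M T₂ k₂ s₂ k₃ s₃) : Reach M (T₁ + T₂) k₁ s₁ k₃ s₃ := by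
  induction h₁ with
  | refl => simpa using h₂
  | skip _ ih => rw [Nat.add_right_comm]; exact .skip (ih h₂)
  | assign _ _ h _ ih => rw [Nat.add_right_comm]; exact .assign _ _ h (ih h₂)
  | store _ _ h _ ih => rw [Nat.add_right_comm]; exact .store _ _ h (ih h₂)
  | seq _ _ _ ih => rw [Nat.add_right_comm]; exact .seq _ _ (ih h₂)
  | condT _ _ _ h _ ih => rw [Nat.add_right_comm]; exact .condT _ _ _ h (ih h₂)
  | condF _ _ _ h _ ih => rw [Nat.add_right_comm]; exact .condF _ _ _ h (ih h₂)
  | loopT _ _ h _ ih => rw [Nat.add_right_comm]; exact .loopT _ _ h (ih h₂)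
  | loopF _ _ h _ ih => rw [Nat.add_right_comm]; exact .loopF _ _ h (ih h₂)

/-- Within `T` steps the machine comes from `(k, s)` to some `(k', s')` with `Q s'`. -/
def To (M : Sem) (T : ℕ) (k : List Prog) (s : St) (k' : List Prog) (Q : St → Prop) : Prop :=
  ∃ T' ≤ T, ∃ s₁, Reach M T' k s k' s₁ ∧ Q s₁

/-- Program `p`, started in state `s`, terminates within `T` steps in a state with `Q`. -/
def Runs (M : Sem) (p : Prog) (s : St) (T : ℕ) (Q : St → Prop) : Prop :=
  ∀ k, To M T (p :: k) s k Q

section Rules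

variable {M : Sem} {T T₁ T₂ : ℕ} {k k₁ k₂ : List Prog} {s : St} {Q R : St → Prop} {p q : Prog}
  {e a : Expr}

theorem To.refl (h : Q s) : To M T k s k Q := ⟨0, Nat.zero_le _, s, .refl _ _, h⟩

theorem To.trans (h₁ : To M T₁ k s k₁ R) (h₂ : ∀ s', R s' → To M T₂ k₁ s' k₂ Q) :
    To M (T₁ + T₂) k s k₂ Q := by
  obtain ⟨t₁, ht₁, s₁, hr₁, hq₁⟩ := h₁
  obtain ⟨t₂, ht₂, s₂, hr₂, hq₂⟩ := h₂ s₁ hq₁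
  exact ⟨t₁ + t₂, by omega, s₂, hr₁.trans hr₂, hq₂⟩

theorem To.mono (h : To M T₁ k s k₁ R) (hT : T₁ ≤ T) (hQ : ∀ s', R s' → Q s') :
    To M T k s k₁ Q := by
  obtain ⟨t₁, ht₁, s₁, hr₁, hq₁⟩ := h
  exact ⟨t₁, ht₁.trans hT, s₁, hr₁, hQ _ hq₁⟩

theorem To.seq (h : To M T (p :: q :: k) s k₁ Q) : To M (T + 1) (.seq p q :: k) s k₁ Q := by
  obtain ⟨t, ht, s', hr, hq⟩ := h
  exact ⟨t + 1, by omega, s', .seq _ _ hr, hq⟩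

theorem To.loopT (he : M.ev e s ≠ 0) (h : To M T (p :: .loop e p :: k) s k₁ Q) :
    To M (T + 1) (.loop e p :: k) s k₁ Q := by
  obtain ⟨t, ht, s', hr, hq⟩ := h
  exact ⟨t + 1, by omega, s', .loopT _ _ he hr, hq⟩

theorem To.loopF (he : M.ev e s = 0) (h : To M T k s k₁ Q) :
    To M (T + 1) (.loop e p :: k) s k₁ Q := by
  obtain ⟨t, ht, s', hr, hq⟩ := h
  exact ⟨t + 1, by omega, s', .loopF _ _ he hr, hq⟩

theorem Runs.mono (h : Runs M p s T₁ R) (hT : T₁ ≤ T) (hQ : ∀ s', R s' → Q s') :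
    Runs M p s T Q := fun k => (h k).mono hT hQ

theorem Runs.mono_time (h : Runs M p s T₁ Q) (hT : T₁ ≤ T) : Runs M p s T Q :=
  h.mono hT fun _ h => h

theorem Runs.skip (h : Q s) : Runs M .skip s 1 Q := fun _ => ⟨1, le_rfl, s, .skip (.refl _ _), h⟩

theorem Runs.assign {x : ℕ} (hv : M.ok (M.ev e s)) (h : Q (s.setReg x (M.ev e s))) :
    Runs M (.assign x e) s 1 Q := fun _ => ⟨1, le_rfl, _, .assign _ _ hv (.refl _ _), h⟩

theorem Runs.store (hv : M.ok (M.ev e s)) (h : Q (s.setMem (M.ev a s) (M.ev e s))) :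
    Runs M (.store a e) s 1 Q := fun _ => ⟨1, le_rfl, _, .store _ _ hv (.refl _ _), h⟩

theorem Runs.seq (h : Runs M p s T₁ fun s' => Runs M q s' T₂ Q) :
    Runs M (.seq p q) s (T₁ + T₂ + 1) Q := fun k =>
  To.seq ((h (q :: k)).trans fun _ h' => h' k)

theorem Runs.condT (he : M.ev e s ≠ 0) (h : Runs M p s T Q) :
    Runs M (.cond e p q) s (T + 1) Q := fun k => by
  obtain ⟨t, ht, s', hr, hq⟩ := h k
  exact ⟨t + 1, by omega, s', .condT _ _ _ he hr, hq⟩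

theorem Runs.condF (he : M.ev e s = 0) (h : Runs M q s T Q) :
    Runs M (.cond e p q) s (T + 1) Q := fun k => by
  obtain ⟨t, ht, s', hr, hq⟩ := h k
  exact ⟨t + 1, by omega, s', .condF _ _ _ he hr, hq⟩

theorem Runs.loop (I : ℕ → St → Prop) (N : ℕ) (c : ℕ → ℕ) (h0 : I 0 s)
    (hstep : ∀ i < N, ∀ s', I i s' → M.ev e s' ≠ 0 ∧ Runs M p s' (c i) (I (i + 1)))
    (hend : ∀ s', I N s' → M.ev e s' = 0 ∧ Q s') :
    Runs M (.loop e p) s (∑ i ∈ Finset.range N, (c i + 1) + 1) Q := by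
  intro k
  have key : ∀ n ≤ N, To M (∑ i ∈ Finset.range n, (c i + 1)) (.loop e p :: k) s
      (.loop e p :: k) (I n) := by
    intro n
    induction n with
    | zero => exact fun _ => To.refl h0
    | succ n ih =>
        intro hn
        rw [Finset.sum_range_succ]
        refine (ih (by omega)).trans fun s' hs' => ?_
        obtain ⟨h1, h2⟩ := hstep n (by omega) s' hs'
        exact To.loopT h1 (h2 _)
  exact (key N le_rfl).trans fun s' hs' => To.loopF (T := 0) (hend s' hs').1 (.refl (hend s' hs').2)

theorem Runs.loop_const (I : ℕ → St → Prop) (N c : ℕ) (h0 : I 0 s)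
    (hstep : ∀ i < N, ∀ s', I i s' → M.ev e s' ≠ 0 ∧ Runs M p s' c (I (i + 1)))
    (hend : ∀ s', I N s' → M.ev e s' = 0 ∧ Q s') :
    Runs M (.loop e p) s (N * (c + 1) + 1) Q := by
  simpa using Runs.loop I N (fun _ => c) h0 hstep hend

end Rules

/-! ### Counting loops and tables in memory -/

/-- `for x = 0, …, K - 1`, where `K` is re-evaluated each time. -/
def Prog.upto (x : ℕ) (K : Expr) (p : Prog) : Prog :=
  .seq (.assign x 0) (.loop (Expr.less (.reg x) K) (.seq p (.assign x (.reg x + 1))))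

theorem Runs.upto {B x : ℕ} {K : Expr} {p : Prog} {s : St} {Q : St → Prop} (I : ℕ → St → Prop)
    (N : ℕ) (c : ℕ → ℕ) (hN : N < B) (h0 : I 0 (s.setReg x 0))
    (hreg : ∀ i s', I i s' → s'.reg x = i ∧ K.val s' = N)
    (hstep : ∀ i < N, ∀ s', I i s' →
      Runs (Sem.ideal B) p s' (c i) fun s'' => s''.reg x = i ∧ I (i + 1) (s''.setReg x (i + 1)))
    (hend : ∀ s', I N s' → Q s') :
    Runs (Sem.ideal B) (.upto x K p) s (∑ i ∈ Finset.range N, (c i + 3) + 3) Q := by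
  refine (Runs.seq (T₁ := 1) (T₂ := ∑ i ∈ Finset.range N, (c i + 1 + 1 + 1) + 1)
    (Runs.assign (by simp [Sem.ideal]; omega) ?_)).mono_time ?_
  · refine Runs.loop I N (fun i => c i + 1 + 1) (by simpa [Sem.ideal] using h0) ?_ ?_
    · intro i hi s' hs'
      obtain ⟨h1, h2⟩ := hreg i s' hs'
      refine ⟨by simp [Sem.ideal, h1, h2, hi], Runs.seq ((hstep i hi s' hs').mono le_rfl ?_)⟩
      intro s'' hs''
      refine Runs.assign (by simp [Sem.ideal, hs''.1]; omega) ?_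
      simpa [Sem.ideal, hs''.1] using hs''.2
    · intro s' hs'
      obtain ⟨h1, h2⟩ := hreg N s' hs'
      exact ⟨by simp [Sem.ideal, h1, h2], hend s' hs'⟩
  · have : ∀ i, c i + 1 + 1 + 1 = c i + 3 := fun i => by omega
    simp only [this]; omega

/-- The memory in which `f 0, …, f (K - 1)` is written to the cells starting at `d`. -/
def fill (mem : ℕ → ℕ) (d K : ℕ) (f : ℕ → ℕ) : ℕ → ℕ :=
  fun a => if d ≤ a ∧ a < d + K then f (a - d) else mem a

theorem fill_zero (mem : ℕ → ℕ) (d : ℕ) (f : ℕ → ℕ) : fill mem d 0 f = mem := by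
  funext a; simp only [fill]; rw [if_neg (by omega)]

theorem update_fill (mem : ℕ → ℕ) (d i : ℕ) (f : ℕ → ℕ) :
    Function.update (fill mem d i f) (d + i) (f i) = fill mem d (i + 1) f := by
  funext a
  simp only [fill, Function.update_apply]
  by_cases h : a = d + i
  · subst h; simp
  · rw [if_neg h]; congr 1; simp only [eq_iff_iff]; omega

/-- Regions of length `U` are disjoint, so a table of at most `U` entries that starts at `U * j`
affects no other region. -/
theorem fill_cell (mem : ℕ → ℕ) {U K i : ℕ} (j j' : ℕ) (f : ℕ → ℕ) (hK : K ≤ U) (hi : i < U) :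
    fill mem (U * j) K f (U * j' + i) = if j' = j ∧ i < K then f i else mem (U * j' + i) := by
  simp only [fill]
  by_cases h : j' = j
  · subst h; simp
  · rw [if_neg, if_neg (by tauto)]
    rintro ⟨h1, h2⟩
    rcases Nat.lt_or_gt_of_ne h with h' | h'
    · have := Nat.mul_le_mul_left U (show j' + 1 ≤ j from h')
      rw [mul_add] at this; omega
    · have := Nat.mul_le_mul_left U (show j + 1 ≤ j' from h')
      rw [mul_add] at this; omega

/-- Writes the values of `e` for `x = 0, …, K - 1` to consecutive cells, starting at `d`. -/
def Prog.tabulate (x : ℕ) (K d e : Expr) : Prog := .upto x K (.store (d + .reg x) e)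

/-- The expressions are evaluated in the state in which the first `i` entries are already present.
Thus an entry may refer to earlier ones, as in the tables of reciprocals and of powers of two. -/
theorem Runs.tabulate {B x : ℕ} {K d e : Expr} {s : St} (N D : ℕ) (f : ℕ → ℕ) (hN : N < B)
    (h : ∀ i ≤ N, K.val ⟨Function.update s.reg x i, fill s.mem D i f⟩ = N ∧
      (i < N → d.val ⟨Function.update s.reg x i, fill s.mem D i f⟩ = D ∧
        e.val ⟨Function.update s.reg x i, fill s.mem D i f⟩ = f i ∧ f i < B)) :
    Runs (Sem.ideal B) (.tabulate x K d e) s (4 * N + 3)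
      fun s' => s' = ⟨Function.update s.reg x N, fill s.mem D N f⟩ := by
  refine (Runs.upto (fun i s' => i ≤ N ∧ s' = ⟨Function.update s.reg x i, fill s.mem D i f⟩) N
    (fun _ => 1) hN ⟨by omega, by simp [St.setReg, fill_zero]⟩ ?_ ?_ ?_).mono_time ?_
  · rintro i s' ⟨hi, rfl⟩
    exact ⟨by simp, (h i hi).1⟩
  · rintro i hi s' ⟨-, rfl⟩
    obtain ⟨-, h2⟩ := h i hi.le
    obtain ⟨h2, h3, h4⟩ := h2 hi
    refine Runs.store (by simp only [Sem.ideal]; omega) ?_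
    simp only [Sem.ideal, Expr.val_add, h2, h3, Expr.val_reg]
    simp only [St.setMem, St.setReg, Function.update_self, Function.update_idem, update_fill,
      true_and, and_true]
    omega
  · rintro s' ⟨-, rfl⟩; rfl
  · simp; omega

end WordRAM

/-! ### Algebra of fast negacyclic convolution -/

open Finset in
theorem Finset.sum_range_mul_eq {M : Type*} [AddCommMonoid M] (f : ℕ → M) (m r : ℕ) :
    ∑ e ∈ range (m * r), f e = ∑ i ∈ range m, ∑ j ∈ range r, f (i + m * j) := by
  induction r with
  | zero => simp
  | succ r ih =>
      rw [mul_add, mul_one, sum_range_add, ih, ← sum_add_distrib]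
      refine sum_congr rfl fun i _ => ?_
      rw [sum_range_succ, add_comm (m * r)]

namespace Negacyclic

open Finset Polynomial

/-- Changes of sign modulo `p`. -/
def sgn (p s : ℕ) : ℕ := 1 + s * (p - 2)

/-- One step of a fast Fourier transform on blocks that stand for elements of
`F[x, z] / (x ^ (2 * h) - 1, z ^ r + 1)`, with powers of `z` as roots of unity. -/
def split (p r h : ℕ) (X : ℕ → ℕ) (e : ℕ) : ℕ :=
  (X (e - e % (2 * h * r) + e / r % h * r +
      (e % r + r - e / (h * r) % 2 * (e / r % h * (r / h))) % r) +
    sgn p (e / (h * r) % 2) * X (e - e % (2 * h * r) + (e / r % h + h) * r +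
      (e % r + r - e / (h * r) % 2 * (e / r % h * (r / h))) % r)) *
    sgn p (if e % r < e / (h * r) % 2 * (e / r % h * (r / h)) then 1 else 0) % p

/-- The inverse of `split`, where `half` is the inverse of `2`. -/
def unsplit (p half r h : ℕ) (W : ℕ → ℕ) (e : ℕ) : ℕ :=
  half * (W (e - e % (2 * h * r) + e / r % h * r + e % r) +
    sgn p (e / (h * r) % 2) * (sgn p (if e % r + e / r % h * (r / h) < r then 0 else 1) *
      W (e - e % (2 * h * r) + h * r + e / r % h * r + (e % r + e / r % h * (r / h)) % r))) % p

/-- Elements of `F[z] / (z ^ (m * r) + 1)`, written as polynomials in `x = z` of degree less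
than `m` over `F[z ^ m] / (z ^ (m * r) + 1)`, in blocks of twice the size. -/
def reshape (p m r : ℕ) (X : ℕ → ℕ) (e : ℕ) : ℕ :=
  (1 - e / r % (2 * m) / m) * X (e / (2 * m * r) * (m * r) + (e / r % (2 * m) + m * (e % r))) % p

/-- Substitution of `x = z` after multiplication. -/
def unreshape (p m r : ℕ) (W : ℕ → ℕ) (e : ℕ) : ℕ :=
  (W (e / (m * r) * (2 * m * r) + e % m * r + e / m % r) +
    sgn p (if e / m % r = 0 then 1 else 0) *
      W (e / (m * r) * (2 * m * r) + (e % m + m) * r + (e / m % r + r - 1) % r)) % p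

/-- Products in `F[z] / (z ^ 2 + 1)`. -/
def base (p : ℕ) (X Y : ℕ → ℕ) (e : ℕ) : ℕ :=
  (X (e - e % 2) * Y (e - e % 2 + e % 2) +
    sgn p (1 - e % 2) * (X (e - e % 2 + 1) * Y (e - e % 2 + 1 - e % 2))) % p

variable {K : Type*} [Field K]

/-- The value of block number `c` at a point. -/
def ev (n r : ℕ) (X : ℕ → ℕ) (c : ℕ) (ξ ζ : K) : K :=
  ∑ i ∈ range n, ∑ j ∈ range r, (X (c * (n * r) + i * r + j) : K) * ξ ^ i * ζ ^ j

variable (K) in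
/-- Block number `c` of `W` is the product of the blocks of `X` and `Y`. -/
def IsProd (n r : ℕ) (X Y W : ℕ → ℕ) (c : ℕ) : Prop :=
  ∀ ξ ζ : K, ξ ^ n = 1 → ζ ^ r = -1 → ev n r W c ξ ζ = ev n r X c ξ ζ * ev n r Y c ξ ζ

/-- In F[z]/(z^r + 1), multiplication by a power of z shifts the coefficients cyclically, with a
change of sign for those that pass the end. So multiplication by the roots of unity of the Fourier
transform needs no multiplication in F. -/
theorem rotate_sum (sh u : ℕ) (D : ℕ → K) (ζ : K) (hζ : ζ ^ (sh + u) = -1) :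
    ∑ j ∈ range (sh + u), (if j < sh then -D (j + u) else D (j - sh)) * ζ ^ j =
      ζ ^ sh * ∑ j ∈ range (sh + u), D j * ζ ^ j := by
  rw [sum_range_add, add_comm sh u, sum_range_add, mul_add, add_comm, mul_sum, mul_sum]
  congr 1
  · refine sum_congr rfl fun j _ => ?_
    rw [if_neg (by omega), Nat.add_sub_cancel_left, pow_add]; ring
  · refine sum_congr rfl fun j hj => ?_
    rw [if_pos (by simpa using hj), add_comm u j]
    have : ζ ^ sh * (D (j + u) * ζ ^ (j + u)) = D (j + u) * ζ ^ j * ζ ^ (sh + u) := by ring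
    rw [this, hζ]; ring


theorem unrotate_sum (sh u : ℕ) (D : ℕ → K) (ζ : K) (hζ : ζ ^ (sh + u) = -1) :
    ζ ^ sh * ∑ j ∈ range (sh + u), (if j < u then D (j + sh) else -D (j - u)) * ζ ^ j =
      ∑ j ∈ range (sh + u), D j * ζ ^ j := by
  rw [sum_range_add (fun j => D j * ζ ^ j), add_comm sh u, sum_range_add, mul_add, add_comm,
    mul_sum, mul_sum]
  congr 1
  · refine sum_congr rfl fun j hj => ?_
    rw [if_neg (by omega), Nat.add_sub_cancel_left]
    have : ζ ^ sh * (-D j * ζ ^ (u + j)) = -D j * ζ ^ j * ζ ^ (sh + u) := by ring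
    rw [this, hζ]; ring
  · refine sum_congr rfl fun j hj => ?_
    rw [if_pos (by simpa using hj), add_comm sh j, pow_add]; ring

/-- A polynomial of small degree that vanishes at all roots of `X ^ n - a` is zero. -/
theorem eq_zero_of_forall_root [IsAlgClosed K] {n : ℕ} {a : K} (hn : (n : K) ≠ 0) (ha : a ≠ 0)
    (P : K[X]) (hP : P.degree < n) (h : ∀ x : K, x ^ n = a → P.eval x = 0) : P = 0 := by
  classical
  have hn0 : n ≠ 0 := by rintro rfl; simp at hn
  set Q : K[X] := X ^ n - C a
  have hQ : Q.natDegree = n := natDegree_X_pow_sub_C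
  have hQ0 : Q ≠ 0 := by intro h0; rw [h0] at hQ; simp at hQ; omega
  have hc : Q.roots.toFinset.card = n := by
    rw [Multiset.toFinset_card_of_nodup (nodup_roots (separable_X_pow_sub_C a hn ha)),
      ← (IsAlgClosed.splits Q).natDegree_eq_card_roots, hQ]
  refine eq_zero_of_natDegree_lt_card_of_eval_eq_zero' P Q.roots.toFinset (fun x hx => ?_) ?_
  · refine h x ?_
    have := (mem_roots hQ0).1 (Multiset.mem_toFinset.1 hx)
    simpa [Q, IsRoot, sub_eq_zero] using this
  · rw [hc]
    by_cases h0 : P = 0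
    · subst h0; simpa using Nat.pos_of_ne_zero hn0
    · exact (natDegree_lt_iff_degree_lt h0).2 hP

theorem degree_mul_lt {P Q : K[X]} {m n : ℕ} (hP : P.degree < m) (hQ : Q.degree < n) :
    (P * Q).degree < (m + n : ℕ) := by
  by_cases h : P = 0 ∨ Q = 0
  · rcases h with rfl | rfl <;> simp
  · push Not at h
    have h1 := (natDegree_lt_iff_degree_lt h.1).2 hP
    have h2 := (natDegree_lt_iff_degree_lt h.2).2 hQ
    rw [← natDegree_lt_iff_degree_lt (mul_ne_zero h.1 h.2), natDegree_mul h.1 h.2]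
    omega

/-- The polynomial with given coefficients. -/
noncomputable def poly (f : ℕ → K) (n : ℕ) : K[X] := ∑ i ∈ range n, C (f i) * Polynomial.X ^ i

theorem eval_poly (f : ℕ → K) (n : ℕ) (x : K) :
    (poly f n).eval x = ∑ i ∈ range n, f i * x ^ i := by
  simp [poly, eval_finsetSum]

theorem degree_poly_lt (f : ℕ → K) (n : ℕ) : (poly f n).degree < n := by
  rw [poly, Finset.sum_range]; exact degree_sum_fin_lt _

theorem coeff_poly (f : ℕ → K) (n e : ℕ) : (poly f n).coeff e = if e < n then f e else 0 := by
  simp [poly, finsetSum_coeff, coeff_X_pow]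

/-- The digits of an index: `c` is the block, `s` its half, `i` the exponent of x within the half
and `j` the exponent of z. -/
theorem decode {h r c s i j e : ℕ} (hi : i < h) (hj : j < r) (hs : s < 2)
    (he : e = c * (2 * h * r) + s * (h * r) + i * r + j) :
    e % r = j ∧ e / r % h = i ∧ e / (h * r) % 2 = s ∧ e - e % (2 * h * r) = c * (2 * h * r) := by
  have e1 : e = j + r * (i + h * (s + 2 * c)) := by rw [he]; ring
  have e2 : e / r = i + h * (s + 2 * c) := by
    rw [e1, Nat.add_mul_div_left _ _ (by omega), Nat.div_eq_of_lt hj, zero_add]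
  refine ⟨by rw [e1, Nat.add_mul_mod_self_left, Nat.mod_eq_of_lt hj],
    by rw [e2, Nat.add_mul_mod_self_left, Nat.mod_eq_of_lt hi], ?_, ?_⟩
  · rw [mul_comm h r, ← Nat.div_div_eq_div_mul, e2, Nat.add_mul_div_left _ _ (by omega),
      Nat.div_eq_of_lt hi, zero_add, Nat.add_mul_mod_self_left, Nat.mod_eq_of_lt hs]
  · have h1 : i * r + j < h * r := by
      calc i * r + j < i * r + r := by omega
        _ = (i + 1) * r := by ring
        _ ≤ h * r := Nat.mul_le_mul_right r hi
    have h2 : s * (h * r) ≤ 1 * (h * r) := Nat.mul_le_mul_right _ (by omega)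
    have e3 : e = (s * (h * r) + i * r + j) + (2 * h * r) * c := by rw [he]; ring
    have h3 : 2 * h * r = 2 * (h * r) := by ring
    rw [e3, Nat.add_mul_mod_self_left, Nat.mod_eq_of_lt (by omega), Nat.add_sub_cancel_left,
      mul_comm]

section CharP

variable (p : ℕ) [CharP K p]

theorem cast_mod (a : ℕ) : ((a % p : ℕ) : K) = a := (CharP.cast_eq_mod K p a).symm

/-- `sgn p s` is `1` for `s = 0` and `p - 1` for `s = 1`, so signs are obtained from bits without
branching and without negative numbers. -/
theorem cast_sgn (hp : 2 ≤ p) (s : ℕ) : (sgn p s : K) = 1 - 2 * s := by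
  rw [sgn, Nat.cast_add, Nat.cast_mul, Nat.cast_sub hp, CharP.cast_eq_zero K p]
  push_cast; ring

theorem split_apply_zero {h r c i j : ℕ} (X : ℕ → ℕ) (hi : i < h) (hj : j < r) :
    (split p r h X (2 * c * (h * r) + i * r + j) : K) =
      X (c * (2 * h * r) + i * r + j) + X (c * (2 * h * r) + (i + h) * r + j) := by
  obtain ⟨h1, h2, h3, h4⟩ := decode (s := 0) (c := c) hi hj (by omega)
    (e := 2 * c * (h * r) + i * r + j) (by ring)
  rw [split, h1, h2, h3, h4, cast_mod]
  simp [sgn, Nat.mod_eq_of_lt hj]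

theorem split_apply_one (hp : 2 ≤ p) {h q c i j : ℕ} (X : ℕ → ℕ) (hi : i < h) (hj : j < h * q) :
    (split p (h * q) h X ((2 * c + 1) * (h * (h * q)) + i * (h * q) + j) : K) =
      if j < i * q then
        -((X (c * (2 * h * (h * q)) + i * (h * q) + (j + (h - i) * q)) : K) -
          X (c * (2 * h * (h * q)) + (i + h) * (h * q) + (j + (h - i) * q)))
      else X (c * (2 * h * (h * q)) + i * (h * q) + (j - i * q)) -
          X (c * (2 * h * (h * q)) + (i + h) * (h * q) + (j - i * q)) := by
  obtain ⟨h1, h2, h3, h4⟩ := decode (s := 1) (c := c) hi hj (by omega)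
    (e := (2 * c + 1) * (h * (h * q)) + i * (h * q) + j) (by ring)
  have hr : h * q = i * q + (h - i) * q := by rw [← add_mul]; congr 1; omega
  rw [split, h1, h2, h3, h4, cast_mod, Nat.mul_div_cancel_left _ (by omega : 0 < h), one_mul]
  push_cast
  simp only [cast_sgn p hp]
  split_ifs with hlt
  · have : (j + h * q - i * q) % (h * q) = j + (h - i) * q := by
      rw [Nat.mod_eq_of_lt (by omega)]; omega
    rw [this]; push_cast; ring
  · have : (j + h * q - i * q) % (h * q) = j - i * q := by
      rw [show j + h * q - i * q = (j - i * q) + h * q by omega, Nat.add_mod_right,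
        Nat.mod_eq_of_lt (by omega)]
    rw [this]; push_cast; ring

/-- The factor x^h - 1 of x^{2h} - 1: modulo it, x^{i+h} equals x^i, and the even block collects the
sums of the two halves. -/
theorem ev_split_zero {h r : ℕ} (X : ℕ → ℕ) (c : ℕ) (ξ ζ : K) (hξ : ξ ^ h = 1) :
    ev h r (split p r h X) (2 * c) ξ ζ = ev (2 * h) r X c ξ ζ := by
  rw [ev, ev, two_mul h, sum_range_add, ← sum_add_distrib]
  refine sum_congr rfl fun i hi => ?_
  rw [← sum_add_distrib]
  refine sum_congr rfl fun j hj => ?_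
  rw [split_apply_zero p X (by simpa using hi) (by simpa using hj), pow_add, hξ, two_mul h,
    add_comm h i]
  ring

/-- The factor x^h + 1 of x^{2h} - 1: the odd block is the residue modulo it after the substitution
of x z^q for x. Since (z^q)^h = -1, this substitution turns x^h + 1 into x^h - 1 up to sign, and
both halves have the same form again. -/
theorem ev_split_one (hp : 2 ≤ p) {h q : ℕ} (X : ℕ → ℕ) (c : ℕ) (ξ ζ : K) (hξ : ξ ^ h = 1)
    (hζ : ζ ^ (h * q) = -1) :
    ev h (h * q) (split p (h * q) h X) (2 * c + 1) ξ ζ = ev (2 * h) (h * q) X c (ξ * ζ ^ q) ζ := by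
  rw [ev, ev, two_mul h, sum_range_add, ← sum_add_distrib]
  refine sum_congr rfl fun i hi => ?_
  have hi : i < h := by simpa using hi
  have hr : h * q = i * q + (h - i) * q := by rw [← add_mul]; congr 1; omega
  have key := rotate_sum (i * q) ((h - i) * q) (fun j =>
    (X (c * (2 * h * (h * q)) + i * (h * q) + j) : K) -
          X (c * (2 * h * (h * q)) + (i + h) * (h * q) + j)) ζ (by rw [← hr, hζ])
  rw [← hr] at key
  calc _ = ξ ^ i * ∑ j ∈ range (h * q), (split p (h * q) h X
          ((2 * c + 1) * (h * (h * q)) + i * (h * q) + j) : K) * ζ ^ j := by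
        rw [mul_sum]; refine sum_congr rfl fun j _ => by ring
    _ = ξ ^ i * (ζ ^ (i * q) * ∑ j ∈ range (h * q),
          ((X (c * (2 * h * (h * q)) + i * (h * q) + j) : K) -
          X (c * (2 * h * (h * q)) + (i + h) * (h * q) + j)) * ζ ^ j) := by
        rw [← key]; congr 1
        refine sum_congr rfl fun j hj => ?_
        rw [split_apply_one p hp X hi (by simpa using hj)]
    _ = _ := by
        rw [mul_sum, mul_sum, ← sum_add_distrib]
        refine sum_congr rfl fun j _ => ?_
        rw [mul_pow, mul_pow, pow_add ξ, hξ, ← pow_mul, ← pow_mul, mul_add q, pow_add,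
          mul_comm q h, hζ, add_comm h i, two_mul h, mul_comm q i]
        ring

theorem unsplit_apply (hp : 2 ≤ p) {half h q c s i j : ℕ} (W : ℕ → ℕ) (hi : i < h)
    (hj : j < h * q) (hs : s < 2) :
    (unsplit p half (h * q) h W (c * (2 * h * (h * q)) + (i + s * h) * (h * q) + j) : K) =
      half * ((W (2 * c * (h * (h * q)) + i * (h * q) + j) : K) + (1 - 2 * s) *
        (if j < (h - i) * q then (W ((2 * c + 1) * (h * (h * q)) + i * (h * q) + (j + i * q)) : K)
          else -(W ((2 * c + 1) * (h * (h * q)) + i * (h * q) + (j - (h - i) * q)) : K))) := by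
  obtain ⟨h1, h2, h3, h4⟩ := decode (s := s) (c := c) hi hj hs
    (e := c * (2 * h * (h * q)) + (i + s * h) * (h * q) + j) (by ring)
  have hr : h * q = i * q + (h - i) * q := by rw [← add_mul]; congr 1; omega
  rw [unsplit, h1, h2, h3, h4, cast_mod, Nat.mul_div_cancel_left _ (by omega : 0 < h)]
  push_cast
  simp only [cast_sgn p hp]
  have a1 : c * (2 * h * (h * q)) = 2 * c * (h * (h * q)) := by ring
  have a2 : 2 * c * (h * (h * q)) + h * (h * q) = (2 * c + 1) * (h * (h * q)) := by ring
  rw [a1, a2]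
  by_cases hlt : j < (h - i) * q
  · rw [if_pos hlt, if_pos (by omega), Nat.mod_eq_of_lt (a := j + i * q) (by omega)]
    push_cast; ring
  · have : (j + i * q) % (h * q) = j - (h - i) * q := by
      rw [show j + i * q = (j - (h - i) * q) + h * q by omega, Nat.add_mod_right,
        Nat.mod_eq_of_lt (by omega)]
    rw [if_neg hlt, if_neg (by omega), this]
    push_cast; ring

/-- Chinese remaindering: for `ε = 1` only the even block counts and for `ε = -1` only the odd one,
which is evaluated at `ξ'` because of the substitution made in the splitting. The factor `half`
cancels `1 + ε` or `1 - ε`, whichever is 2. -/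
theorem ev_unsplit (hp : 2 ≤ p) {half h q : ℕ} (W : ℕ → ℕ) (c : ℕ) (ξ ξ' ε ζ : K)
    (hζ : ζ ^ (h * q) = -1) (hξ : ξ ^ h = ε) (hξ' : ξ = ξ' * ζ ^ q) :
    ev (2 * h) (h * q) (unsplit p half (h * q) h W) c ξ ζ = half *
      ((1 + ε) * ev h (h * q) W (2 * c) ξ ζ + (1 - ε) * ev h (h * q) W (2 * c + 1) ξ' ζ) := by
  rw [ev, ev, ev, two_mul h, sum_range_add, ← sum_add_distrib, ← two_mul h, mul_sum, mul_sum,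
    ← sum_add_distrib, mul_sum]
  refine sum_congr rfl fun i hi => ?_
  have hi : i < h := by simpa using hi
  have hr : h * q = i * q + (h - i) * q := by rw [← add_mul]; congr 1; omega
  have key := unrotate_sum (i * q) ((h - i) * q) (fun j =>
    (W ((2 * c + 1) * (h * (h * q)) + i * (h * q) + j) : K)) ζ (by rw [← hr, hζ])
  rw [← hr] at key
  have h1 : ∑ j ∈ range (h * q), (W ((2 * c + 1) * (h * (h * q)) + i * (h * q) + j) : K) * ξ' ^ i *
      ζ ^ j = ∑ j ∈ range (h * q), ξ ^ i *
      ((if j < (h - i) * q then (W ((2 * c + 1) * (h * (h * q)) + i * (h * q) + (j + i * q)) : K)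
        else -(W ((2 * c + 1) * (h * (h * q)) + i * (h * q) + (j - (h - i) * q)) : K)) *
          ζ ^ j) := by
    rw [← mul_sum, hξ', mul_pow, ← pow_mul, mul_comm q i, mul_assoc, key, mul_sum]
    refine sum_congr rfl fun j _ => by ring
  rw [h1, mul_sum, mul_sum, ← sum_add_distrib, ← sum_add_distrib, mul_sum]
  refine sum_congr rfl fun j hj => ?_
  have hj : j < h * q := by simpa using hj
  have u0 := unsplit_apply (K := K) p (half := half) (c := c) (s := 0) hp W hi hj (by omega)
  have u1 := unsplit_apply (K := K) p (half := half) (c := c) (s := 1) hp W hi hj (by omega)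
  rw [zero_mul, add_zero] at u0
  rw [one_mul, add_comm i h] at u1
  rw [u0, u1, pow_add, hξ]
  push_cast; ring

/-- Products are tested at points, not in the quotient ring. A point with ξ^{2h} = 1 has ξ^h = 1 or
ξ^h = -1, and belongs to the even or to the odd block accordingly. -/
theorem isProd_unsplit (hp : 2 ≤ p) {half h q : ℕ} (hq : 0 < h * q) (h2 : (half : K) * 2 = 1)
    (X Y W : ℕ → ℕ) (c : ℕ)
    (h₀ : IsProd K h (h * q) (split p (h * q) h X) (split p (h * q) h Y) W (2 * c))
    (h₁ : IsProd K h (h * q) (split p (h * q) h X) (split p (h * q) h Y) W (2 * c + 1)) :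
    IsProd K (2 * h) (h * q) X Y (unsplit p half (h * q) h W) c := by
  intro ξ ζ hξ hζ
  have hζ0 : ζ ≠ 0 := by
    rintro rfl
    rw [zero_pow (by omega)] at hζ; simp at hζ
  have hs : ξ ^ h = 1 ∨ ξ ^ h = -1 := mul_self_eq_one_iff.1 (by rw [← pow_add, ← two_mul, hξ])
  have e1 : ξ = ξ / ζ ^ q * ζ ^ q := (div_mul_cancel₀ _ (pow_ne_zero _ hζ0)).symm
  rcases hs with hs | hs
  · rw [ev_unsplit p hp W c ξ _ 1 ζ hζ hs e1, h₀ ξ ζ hs hζ, ev_split_zero p X c ξ ζ hs,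
      ev_split_zero p Y c ξ ζ hs]
    linear_combination (ev (2 * h) (h * q) X c ξ ζ * ev (2 * h) (h * q) Y c ξ ζ) * h2
  · have h3 : (ξ / ζ ^ q) ^ h = 1 := by
      rw [div_pow, ← pow_mul, mul_comm q, hζ, hs, div_self (by simp)]
    rw [ev_unsplit p hp W c ξ _ (-1) ζ hζ hs e1, h₁ _ ζ h3 hζ, ev_split_one p hp X c _ ζ h3 hζ,
      ev_split_one p hp Y c _ ζ h3 hζ, ← e1]
    linear_combination (ev (2 * h) (h * q) X c ξ ζ * ev (2 * h) (h * q) Y c ξ ζ) * h2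

theorem reshape_apply {m r c i j : ℕ} (X : ℕ → ℕ) (hi : i < 2 * m) (hj : j < r) :
    (reshape p m r X (c * (2 * m * r) + i * r + j) : K) =
      if i < m then (X (c * (m * r) + (i + m * j)) : K) else 0 := by
  have e1 : c * (2 * m * r) + i * r + j = j + r * (i + 2 * m * c) := by ring
  have e2 : (c * (2 * m * r) + i * r + j) / r = i + 2 * m * c := by
    rw [e1, Nat.add_mul_div_left _ _ (by omega), Nat.div_eq_of_lt hj, zero_add]
  have e3 : (c * (2 * m * r) + i * r + j) % r = j := by
    rw [e1, Nat.add_mul_mod_self_left, Nat.mod_eq_of_lt hj]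
  have e4 : (c * (2 * m * r) + i * r + j) / (2 * m * r) = c := by
    rw [mul_comm (2 * m) r, ← Nat.div_div_eq_div_mul, mul_comm r, e2,
      Nat.add_mul_div_left _ _ (by omega), Nat.div_eq_of_lt hi, zero_add]
  rw [reshape, cast_mod, e2, e3, e4, Nat.add_mul_mod_self_left, Nat.mod_eq_of_lt hi]
  split_ifs with h
  · rw [Nat.div_eq_of_lt h]; simp
  · rw [show i / m = 1 by
      rw [Nat.div_eq_iff (by omega)]; omega]
    simp

theorem ev_reshape {m r : ℕ} (X : ℕ → ℕ) (c : ℕ) (ξ ζ : K) :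
    ev (2 * m) r (reshape p m r X) c ξ ζ =
      ∑ i ∈ range m, ∑ j ∈ range r, (X (c * (m * r) + (i + m * j)) : K) * ξ ^ i * ζ ^ j := by
  rw [ev, two_mul m, sum_range_add, ← two_mul m]
  conv_rhs => rw [← add_zero (∑ i ∈ range m, _)]
  congr 1
  · refine sum_congr rfl fun i hi => sum_congr rfl fun j hj => ?_
    simp only [mem_range] at hi hj
    rw [reshape_apply p X (by omega) hj, if_pos hi]
  · refine sum_eq_zero fun i hi => sum_eq_zero fun j hj => ?_
    simp only [mem_range] at hi hj
    rw [reshape_apply p X (by omega) hj, if_neg (by omega)]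
    simp

theorem ev_one_reshape {m r : ℕ} (X : ℕ → ℕ) (c : ℕ) (ξ ζ : K) :
    ev 1 (m * r) X c ξ ζ = ∑ i ∈ range m, ∑ j ∈ range r,
      (X (c * (m * r) + (i + m * j)) : K) * ζ ^ i * (ζ ^ m) ^ j := by
  simp only [ev, sum_range_one, one_mul, pow_zero, mul_one, zero_mul, add_zero]
  rw [sum_range_mul_eq]
  refine sum_congr rfl fun i _ => sum_congr rfl fun j _ => ?_
  rw [pow_add, pow_mul]; ring

theorem unreshape_apply (hp : 2 ≤ p) {m r c i j : ℕ} (W : ℕ → ℕ) (hi : i < m) (hj : j < r) :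
    (unreshape p m r W (c * (m * r) + (i + m * j)) : K) =
      W (c * (2 * m * r) + i * r + j) +
        if j < 1 then -(W (c * (2 * m * r) + (i + m) * r + (j + (r - 1))) : K)
        else W (c * (2 * m * r) + (i + m) * r + (j - 1)) := by
  have e1 : c * (m * r) + (i + m * j) = i + m * (j + r * c) := by ring
  have e2 : (c * (m * r) + (i + m * j)) / m = j + r * c := by
    rw [e1, Nat.add_mul_div_left _ _ (by omega), Nat.div_eq_of_lt hi, zero_add]
  have e3 : (c * (m * r) + (i + m * j)) % m = i := by
    rw [e1, Nat.add_mul_mod_self_left, Nat.mod_eq_of_lt hi]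
  have e4 : (c * (m * r) + (i + m * j)) / (m * r) = c := by
    rw [← Nat.div_div_eq_div_mul, e2, Nat.add_mul_div_left _ _ (by omega),
      Nat.div_eq_of_lt hj, zero_add]
  rw [unreshape, e2, e3, e4, Nat.add_mul_mod_self_left, Nat.mod_eq_of_lt hj, cast_mod]
  push_cast
  rw [cast_sgn p hp]
  rcases Nat.eq_zero_or_pos j with rfl | h
  · rw [if_pos rfl, if_pos (by omega), zero_add, zero_add, Nat.mod_eq_of_lt (by omega)]
    push_cast; ring
  · rw [if_neg (by omega), if_neg (by omega), show j + r - 1 = j - 1 + r by omega,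
      Nat.add_mod_right, Nat.mod_eq_of_lt (by omega)]
    push_cast; ring

/-- For x = z and y = z^m, the monomial x^{i+m} becomes z^i y. So the upper half is added to the
lower one after a negacyclic rotation by one place. -/
theorem ev_unreshape (hp : 2 ≤ p) {m r : ℕ} (hr : 0 < r) (W : ℕ → ℕ) (c : ℕ) (ξ ζ : K)
    (hζ : ζ ^ (m * r) = -1) :
    ev 1 (m * r) (unreshape p m r W) c ξ ζ = ev (2 * m) r W c ζ (ζ ^ m) := by
  rw [ev_one_reshape, ev, two_mul m, sum_range_add, ← two_mul m, ← sum_add_distrib]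
  refine sum_congr rfl fun i hi => ?_
  have hi : i < m := by simpa using hi
  have key := rotate_sum 1 (r - 1) (fun j => (W (c * (2 * m * r) + (i + m) * r + j) : K)) (ζ ^ m)
    (by rw [← pow_mul, Nat.add_sub_cancel' hr, hζ])
  rw [Nat.add_sub_cancel' hr] at key
  have h1 : ∑ j ∈ range r, (W (c * (2 * m * r) + (m + i) * r + j) : K) * ζ ^ (m + i) *
      (ζ ^ m) ^ j = ζ ^ i * ((ζ ^ m) ^ 1 * ∑ j ∈ range r,
        (W (c * (2 * m * r) + (i + m) * r + j) : K) * (ζ ^ m) ^ j) := by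
    rw [mul_sum, mul_sum]
    refine sum_congr rfl fun j _ => ?_
    rw [add_comm m i, pow_add]; ring
  rw [h1, ← key, mul_sum, ← sum_add_distrib]
  refine sum_congr rfl fun j hj => ?_
  rw [unreshape_apply p hp W hi (by simpa using hj)]
  split_ifs <;> ring

/-- For a fixed value η of y the factors have degree below m in x, so their product has degree below
2m, and agreement at the 2m roots of x^{2m} = 1 makes the product formula an identity of polynomials
in x. It can then be evaluated at x = ζ, which need not be one of these roots. This is the reason
for doubling the length in `reshape`. -/
theorem isProd_unreshape [IsAlgClosed K] (hp : 2 ≤ p) {m r : ℕ} (hr : 0 < r)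
    (hm : ((2 * m : ℕ) : K) ≠ 0) (X Y W : ℕ → ℕ) (c : ℕ)
    (h : IsProd K (2 * m) r (reshape p m r X) (reshape p m r Y) W c) :
    IsProd K 1 (m * r) X Y (unreshape p m r W) c := by
  intro ξ ζ hξ hζ
  have hm0 : 0 < m := by
    rcases Nat.eq_zero_or_pos m with rfl | h
    · simp at hm
    · exact h
  rw [ev_unreshape p hp hr W c ξ ζ hζ, ev_one_reshape, ev_one_reshape]
  set η := ζ ^ m
  let FX : ℕ → K := fun i => ∑ j ∈ range r, (X (c * (m * r) + (i + m * j)) : K) * η ^ j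
  let FY : ℕ → K := fun i => ∑ j ∈ range r, (Y (c * (m * r) + (i + m * j)) : K) * η ^ j
  let FW : ℕ → K := fun i => ∑ j ∈ range r, (W (c * (2 * m * r) + i * r + j) : K) * η ^ j
  have hX : ∀ x : K, ∑ i ∈ range m, ∑ j ∈ range r,
      (X (c * (m * r) + (i + m * j)) : K) * x ^ i * η ^ j = (poly FX m).eval x := fun x => by
    rw [eval_poly]; refine sum_congr rfl fun i _ => ?_
    rw [sum_mul]; refine sum_congr rfl fun j _ => by ring
  have hY : ∀ x : K, ∑ i ∈ range m, ∑ j ∈ range r,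
      (Y (c * (m * r) + (i + m * j)) : K) * x ^ i * η ^ j = (poly FY m).eval x := fun x => by
    rw [eval_poly]; refine sum_congr rfl fun i _ => ?_
    rw [sum_mul]; refine sum_congr rfl fun j _ => by ring
  have hW : ∀ x : K, ev (2 * m) r W c x η = (poly FW (2 * m)).eval x := fun x => by
    rw [eval_poly]; refine sum_congr rfl fun i _ => ?_
    rw [sum_mul]; refine sum_congr rfl fun j _ => by ring
  have hη : η ^ r = -1 := by rw [← pow_mul, hζ]
  have key : poly FW (2 * m) - poly FX m * poly FY m = 0 := by
    refine eq_zero_of_forall_root hm one_ne_zero _ ?_ fun x hx => ?_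
    · exact (degree_sub_le _ _).trans_lt (max_lt (degree_poly_lt _ _)
        (by rw [two_mul]; exact degree_mul_lt (degree_poly_lt _ _) (degree_poly_lt _ _)))
    · have := h x η hx hη
      rw [ev_reshape p, ev_reshape p, hX, hY, hW] at this
      rw [eval_sub, eval_mul, this, sub_self]
  rw [hX, hY, hW, ← eval_mul, sub_eq_zero.1 key]

theorem isProd_base (hp : 2 ≤ p) (X Y : ℕ → ℕ) (c : ℕ) : IsProd K 1 2 X Y (base p X Y) c := by
  intro ξ ζ _ hζ
  simp only [ev, one_mul, pow_zero, mul_one, zero_mul, add_zero, sum_range_succ,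
    sum_range_zero, zero_add, pow_one]
  have h0 : c * 2 % 2 = 0 := by omega
  have h1 : (c * 2 + 1) % 2 = 1 := by omega
  simp only [base, h0, h1, cast_mod, Nat.cast_add, Nat.cast_mul, cast_sgn p hp,
    Nat.add_sub_cancel, Nat.sub_zero, Nat.sub_self, add_zero]
  push_cast
  linear_combination (-(X (c * 2 + 1) : K) * Y (c * 2 + 1)) * hζ

/-- Factors of degree below N have a product of degree below 2N, so reduction modulo z^{2N} + 1 does
not change it, and the 2N roots of -1 determine it. -/
theorem apply_of_isProd [IsAlgClosed K] {N : ℕ} (hN : ((2 * N : ℕ) : K) ≠ 0) (X Y W : ℕ → ℕ)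
    (hX : ∀ e, N ≤ e → e < 2 * N → X e = 0) (hY : ∀ e, N ≤ e → e < 2 * N → Y e = 0)
    (h : IsProd K 1 (2 * N) X Y W 0) {e : ℕ} (he : e < 2 * N) :
    (W e : K) = ∑ x ∈ antidiagonal e, (X x.1 : K) * Y x.2 := by
  have hev : ∀ (Z : ℕ → ℕ) (ζ : K),
      ev 1 (2 * N) Z 0 1 ζ = (poly (fun e => (Z e : K)) (2 * N)).eval ζ := fun Z ζ => by
    simp [ev, eval_poly]
  have hred : ∀ (Z : ℕ → ℕ), (∀ e, N ≤ e → e < 2 * N → Z e = 0) →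
      poly (fun e => (Z e : K)) (2 * N) = poly (fun e => (Z e : K)) N := fun Z hZ => by
    ext e
    rw [coeff_poly, coeff_poly]
    by_cases h1 : e < N
    · rw [if_pos h1, if_pos (by omega)]
    · rw [if_neg h1]; split_ifs with h2
      · rw [hZ e (by omega) h2, Nat.cast_zero]
      · rfl
  have key : poly (fun e => (W e : K)) (2 * N) -
      poly (fun e => (X e : K)) (2 * N) * poly (fun e => (Y e : K)) (2 * N) = 0 := by
    refine eq_zero_of_forall_root hN (neg_ne_zero.2 one_ne_zero) _ ?_ fun x hx => ?_
    · rw [hred X hX, hred Y hY]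
      exact (degree_sub_le _ _).trans_lt (max_lt (degree_poly_lt _ _)
        (by rw [two_mul]; exact degree_mul_lt (degree_poly_lt _ _) (degree_poly_lt _ _)))
    · have := h 1 x (one_pow _) hx
      rw [hev, hev, hev] at this
      rw [eval_sub, eval_mul, this, sub_self]
  have hc := congrArg (fun P : K[X] => P.coeff e) (sub_eq_zero.1 key)
  simp only [coeff_poly, if_pos he, coeff_mul] at hc
  rw [hc]
  refine sum_congr rfl fun x hx => ?_
  have := mem_antidiagonal.1 hx
  rw [if_pos (by omega), if_pos (by omega)]

end CharP

end Negacyclic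

namespace Negacyclic

open Finset

theorem ev_congr {K : Type*} [Field K] {n r c cnt : ℕ} {X X' : ℕ → ℕ} (hc : c < cnt)
    (h : ∀ e < cnt * (n * r), X e = X' e) (ξ ζ : K) : ev n r X c ξ ζ = ev n r X' c ξ ζ := by
  refine sum_congr rfl fun i hi => sum_congr rfl fun j hj => ?_
  simp only [mem_range] at hi hj
  rw [h]
  have h1 : i * r + j < n * r := by
    calc i * r + j < i * r + r := by omega
      _ = (i + 1) * r := by ring
      _ ≤ n * r := Nat.mul_le_mul_right r hi
  calc c * (n * r) + i * r + j < c * (n * r) + n * r := by omega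
    _ = (c + 1) * (n * r) := by ring
    _ ≤ _ := Nat.mul_le_mul_right _ hc

theorem IsProd.congr {K : Type*} [Field K] {n r c cnt : ℕ} {X X' Y Y' W W' : ℕ → ℕ}
    (h : IsProd K n r X Y W c) (hc : c < cnt) (hX : ∀ e < cnt * (n * r), X e = X' e)
    (hY : ∀ e < cnt * (n * r), Y e = Y' e) (hW : ∀ e < cnt * (n * r), W e = W' e) :
    IsProd K n r X' Y' W' c := fun ξ ζ hξ hζ => by
  rw [← ev_congr hc hX, ← ev_congr hc hY, ← ev_congr hc hW, h ξ ζ hξ hζ]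

end Negacyclic

/-! ### Memory regions and their rewriting -/

namespace WordRAM

open Negacyclic

theorem Runs.assign' {B x v : ℕ} {e : Expr} {s : St} {Q : St → Prop} (he : e.val s = v)
    (hv : v < B) (h : Q (s.setReg x v)) : Runs (Sem.ideal B) (.assign x e) s 1 Q := by
  subst he; exact Runs.assign hv h

theorem Runs.store' {B a v : ℕ} {d e : Expr} {s : St} {Q : St → Prop} (hd : d.val s = a)
    (he : e.val s = v) (hv : v < B) (h : Q (s.setMem a v)) :
    Runs (Sem.ideal B) (.store d e) s 1 Q := by
  subst he hd; exact Runs.store hv h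

theorem Runs.assign_seq {B x T : ℕ} {e : Expr} {q : Prog} {s : St} {Q : St → Prop} (v : ℕ)
    (he : e.val s = v) (hv : v < B) (h : Runs (Sem.ideal B) q (s.setReg x v) T Q) :
    Runs (Sem.ideal B) (.seq (.assign x e) q) s (T + 2) Q :=
  (Runs.seq (Runs.assign' he hv h)).mono_time (by omega)

theorem Runs.store_seq {B T : ℕ} {d e : Expr} {q : Prog} {s : St} {Q : St → Prop} (a v : ℕ)
    (hd : d.val s = a) (he : e.val s = v) (hv : v < B)
    (h : Runs (Sem.ideal B) q (s.setMem a v) T Q) :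
    Runs (Sem.ideal B) (.seq (.store d e) q) s (T + 2) Q :=
  (Runs.seq (Runs.store' hd he hv h)).mono_time (by omega)

theorem Runs.assign_last {B x T : ℕ} {e : Expr} {s : St} {Q : St → Prop} (v : ℕ)
    (he : e.val s = v) (hv : v < B) (h : Q (s.setReg x v)) :
    Runs (Sem.ideal B) (.assign x e) s (T + 1) Q :=
  (Runs.assign' he hv h).mono_time (by omega)

theorem Runs.seq_of {M : Sem} {p q : Prog} {T T₁ : ℕ} {s : St} {R Q : St → Prop} (T₂ : ℕ)
    (h₁ : Runs M p s T₁ R) (hT : T₁ + T₂ + 1 ≤ T) (h₂ : ∀ s', R s' → Runs M q s' T₂ Q) :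
    Runs M (.seq p q) s T Q :=
  (Runs.seq (h₁.mono le_rfl h₂)).mono_time hT

theorem cell_inj {U j j' i i' : ℕ} (hi : i < U) (hi' : i' < U) :
    U * j + i = U * j' + i' ↔ j = j' ∧ i = i' := by
  constructor
  · intro h
    have h1 := congrArg (· / U) h
    simp only [Nat.mul_add_div (by omega : U > 0), Nat.div_eq_of_lt hi, Nat.div_eq_of_lt hi'] at h1
    simp only [add_zero] at h1
    subst h1
    exact ⟨rfl, by omega⟩
  · rintro ⟨rfl, rfl⟩; rfl

/-- Cell `i` of memory region `j`; the length of the regions is in register `9`. -/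
def Expr.cell (j : ℕ) (i : Expr) : Expr := .load (.reg 9 * .const j + i)

@[simp] theorem Expr.val_cell (s : St) (j : ℕ) (i : Expr) :
    (Expr.cell j i).val s = s.mem (s.reg 9 * j + i.val s) := rfl

/-- Replaces the first entries of region `j` (their number is in register `22`) by the values of
`e`, in which register `24` is the index. Region `10` is used as a buffer. -/
def Prog.rewrite (j : ℕ) (e : Expr) : Prog :=
  .seq (.tabulate 24 (.reg 22) (.reg 9 * 10) e)
    (.tabulate 24 (.reg 22) (.reg 9 * .const j) (.cell 10 (.reg 24)))

/-- New values are collected in region `10` first, because each may depend on any old entry of the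
region. Accordingly, `e` has to be evaluated in every memory that differs from the present one at
most in region `10`. -/
theorem Runs.rewrite {B U S j : ℕ} {e : Expr} {s : St} (f : ℕ → ℕ)
    (hU : s.reg 9 = U) (hS : s.reg 22 = S) (hSU : S ≤ U) (hUB : U < B)
    (h : ∀ i < S, ∀ m' : ℕ → ℕ, (∀ a, a < U * 10 ∨ U * 11 ≤ a → m' a = s.mem a) →
      e.val ⟨Function.update s.reg 24 i, m'⟩ = f i ∧ f i < B) :
    Runs (Sem.ideal B) (.rewrite j e) s (8 * S + 7) fun s' => (∀ x ≠ 24, s'.reg x = s.reg x) ∧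
      ∀ j' i, i < U → j' ≠ 10 →
        s'.mem (U * j' + i) = if j' = j ∧ i < S then f i else s.mem (U * j' + i) := by
  refine Runs.mono (Runs.seq ((Runs.tabulate S (U * 10) f (by omega) fun i hi => ?_).mono le_rfl
    fun s' hs' => ?_) (T₂ := 4 * S + 3)) (by omega) fun s' hs' => hs'
  · refine ⟨by simp [hS], fun hi => ⟨by simp [hU], h i hi _ fun a ha => ?_⟩⟩
    simp only [fill]; rw [if_neg (by omega)]
  · subst hs'
    refine (Runs.tabulate S (U * j) f (by omega) fun i hi => ?_).mono le_rfl fun s' hs' => ?_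
    · refine ⟨by simp [hS], fun hi => ⟨by simp [hU], ?_, (h i hi _ fun _ _ => rfl).2⟩⟩
      simp only [Expr.val_cell, Function.update_apply, Nat.reduceEqDiff, ↓reduceIte, hU,
        Expr.val_reg]
      rw [fill_cell _ _ _ _ (by omega) (by omega), if_neg (by omega),
        fill_cell _ _ _ _ (by omega) (by omega), if_pos (by omega)]
    · subst hs'
      refine ⟨fun x hx => by simp [hx], fun j' i hi hj' => ?_⟩
      simp only
      rw [fill_cell _ _ _ _ (by omega) (by omega)]
      by_cases h1 : j' = j ∧ i < S
      · rw [if_pos h1, if_pos h1]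
      · rw [if_neg h1, if_neg h1, fill_cell _ _ _ _ (by omega) (by omega), if_neg (by omega)]

/-! ### The multiplication program: recursion by an explicit stack -/

namespace Conv

/-- The expression for `Negacyclic.sgn`, with the modulus in register `6`. -/
def sgnE (s : Expr) : Expr := 1 + s * (.reg 6 - 2)

/-- The expression for `Negacyclic.split`. -/
def splitE (X : Expr → Expr) (r h e : Expr) : Expr :=
  (X (e - e % (2 * h * r) + e / r % h * r +
      (e % r + r - e / (h * r) % 2 * (e / r % h * (r / h))) % r) +
    sgnE (e / (h * r) % 2) * X (e - e % (2 * h * r) + (e / r % h + h) * r +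
      (e % r + r - e / (h * r) % 2 * (e / r % h * (r / h))) % r)) *
    sgnE (.less (e % r) (e / (h * r) % 2 * (e / r % h * (r / h)))) % .reg 6

/-- The expression for `Negacyclic.unsplit`. -/
def unsplitE (W : Expr → Expr) (r h e : Expr) : Expr :=
  .reg 25 * (W (e - e % (2 * h * r) + e / r % h * r + e % r) +
    sgnE (e / (h * r) % 2) * (sgnE (1 - .less (e % r + e / r % h * (r / h)) r) *
      W (e - e % (2 * h * r) + h * r + e / r % h * r + (e % r + e / r % h * (r / h)) % r))) %
    .reg 6

/-- The expression for `Negacyclic.reshape`. -/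
def reshapeE (X : Expr → Expr) (r m e : Expr) : Expr :=
  (1 - e / r % (2 * m) / m) * X (e / (2 * m * r) * (m * r) + (e / r % (2 * m) + m * (e % r))) %
    .reg 6

/-- The expression for `Negacyclic.unreshape`. -/
def unreshapeE (W : Expr → Expr) (r m e : Expr) : Expr :=
  (W (e / (m * r) * (2 * m * r) + e % m * r + e / m % r) +
    sgnE (.same (e / m % r) 0) *
      W (e / (m * r) * (2 * m * r) + (e % m + m) * r + (e / m % r + r - 1) % r)) % .reg 6

/-- The expression for `Negacyclic.base`. -/
def baseE (X Y : Expr → Expr) (e : Expr) : Expr :=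
  (X (e - e % 2) * Y (e - e % 2 + e % 2) +
    sgnE (1 - e % 2) * (X (e - e % 2 + 1) * Y (e - e % 2 + 1 - e % 2))) % .reg 6

/-- `2 ^ b` for the exponent `b` in register `21`. -/
def rE : Expr := .cell 14 (.reg 21)

/-- `2 ^ (a - 1)` for the exponent `a` in register `20`. -/
def hE : Expr := .cell 14 (.reg 20 - 1)

/-- One step of the division of products into smaller ones. -/
def down : Prog :=
  .seq (.store (.reg 9 * 2 + 2 * .reg 23) (.reg 20)) <|
  .seq (.store (.reg 9 * 2 + (2 * .reg 23 + 1)) (.reg 21)) <|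
  .seq (.assign 23 (.reg 23 + 1)) <|
  .cond (.reg 20)
    (.seq (.rewrite 11 (splitE (.cell 11) rE hE (.reg 24))) <|
      .seq (.rewrite 12 (splitE (.cell 12) rE hE (.reg 24))) <|
      .assign 20 (.reg 20 - 1))
    (.seq (.assign 22 (2 * .reg 22)) <|
      .seq (.assign 20 (.reg 21 / 2 + 1)) <|
      .seq (.assign 21 (.reg 21 - .reg 21 / 2)) <|
      .seq (.rewrite 11 (reshapeE (.cell 11) rE hE (.reg 24))) <|
      .rewrite 12 (reshapeE (.cell 12) rE hE (.reg 24)))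

/-- One step of putting products together. -/
def up : Prog :=
  .seq (.assign 23 (.reg 23 - 1)) <|
  .cond (.cell 2 (2 * .reg 23))
    (.seq (.assign 20 (.reg 20 + 1)) <|
      .rewrite 11 (unsplitE (.cell 11) rE hE (.reg 24)))
    (.seq (.assign 22 (.reg 22 / 2)) <|
      .seq (.rewrite 11 (unreshapeE (.cell 11) rE hE (.reg 24))) <|
      .seq (.assign 20 0) <|
      .assign 21 (.cell 2 (2 * .reg 23 + 1)))

/-- The loop that divides products into smaller ones. -/
def downLoop : Prog := .loop (.reg 20 + (.reg 21 - 1)) down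

/-- The loop that puts products together. -/
def upLoop : Prog := .loop (.reg 23) up

/-- Products of blocks. -/
def baseProg : Prog := .rewrite 11 (baseE (.cell 11) (.cell 12) (.reg 24))

variable (U B p half : ℕ)

/-- What is assumed about a state in which products of length `2 ^ a * 2 ^ b` are computed. -/
structure Pre (a b cnt d : ℕ) (s : St) : Prop where
  reg6 : s.reg 6 = p
  reg9 : s.reg 9 = U
  reg20 : s.reg 20 = a
  reg21 : s.reg 21 = b
  reg22 : s.reg 22 = cnt * (2 ^ a * 2 ^ b)
  reg23 : s.reg 23 = d
  reg25 : s.reg 25 = half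
  pow : ∀ i ≤ b, s.mem (U * 14 + i) = 2 ^ i
  cnt_pos : 0 < cnt
  b_pos : 0 < b
  a_le : a ≤ b + 1
  size : cnt * (2 ^ a * 2 ^ b) * 2 ^ Nat.clog 2 b ≤ U
  depth : 2 * (d + a + 4 * b) ≤ U

/-- Region `j` of the memory. -/
def arr (s : St) (j : ℕ) : ℕ → ℕ := fun i => s.mem (U * j + i)

variable (K : Type) [Field K]

/-- What is achieved by the computation of products. -/
structure Post (a b cnt d : ℕ) (s s' : St) : Prop where
  reg : ∀ x ≠ 24, s'.reg x = s.reg x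
  mem : ∀ j i, i < U → j ≠ 10 → j ≠ 11 → j ≠ 12 → j ≠ 2 → s'.mem (U * j + i) = s.mem (U * j + i)
  stack : ∀ i < 2 * d, s'.mem (U * 2 + i) = s.mem (U * 2 + i)
  lt : ∀ i < cnt * (2 ^ a * 2 ^ b), s'.mem (U * 11 + i) < p
  prod : ∀ c < cnt, IsProd K (2 ^ a) (2 ^ b) (arr U s 11) (arr U s 12) (arr U s' 11) c

/-- Products of length `2 ^ a * 2 ^ b` are computed in time `τ` per entry. -/
def Works (a b τ : ℕ) : Prop := ∀ cnt d s rest, Pre U p half a b cnt d s →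
  To (Sem.ideal B) (τ * (cnt * (2 ^ a * 2 ^ b))) (downLoop :: .seq baseProg upLoop :: rest) s
    (upLoop :: rest) (Post U p K a b cnt d s)

variable {U B p half K}

theorem works_base [CharP K p] (hp : 2 ≤ p) (hpB : p < B) (hUB : U < B) :
    Works U B p half K 0 1 80 := by
  intro cnt d s rest h
  have h22 : s.reg 22 = cnt * 2 := by simpa using h.reg22
  have hsz : cnt * 2 ≤ U := by simpa using h.size
  have hc := h.cnt_pos
  refine To.mono (T₁ := _) (To.loopF (T := _) ?_ (To.seq ((Runs.rewrite
    (base p (arr U s 11) (arr U s 12)) h.reg9 h22 hsz hUB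
    fun i hi m' hm' => ⟨?_, ?_⟩) _))) ?_ fun s' hs' => ?_
  · simp [Sem.ideal, h.reg20, h.reg21]
  · simp only [baseE, base, sgnE, sgn, Expr.val_add, Expr.val_mul, Expr.val_sub, Expr.val_mod,
      Expr.val_cell, Expr.val_reg, Expr.val_ofNat, arr]
    simp only [Function.update_apply, Nat.reduceEqDiff, ↓reduceIte, h.reg9, h.reg6]
    rw [hm' _ (by omega), hm' _ (by omega), hm' _ (by omega), hm' _ (by omega)]
  · exact (Nat.mod_lt _ (by omega)).trans hpB
  · simp; omega
  · refine ⟨hs'.1, fun j i hi h0 h1 h2 h3 => ?_, fun i hi => ?_, fun i hi => ?_, fun c hc => ?_⟩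
    · rw [hs'.2 j i hi h0, if_neg (by tauto)]
    · have := h.depth
      rw [hs'.2 2 i (by omega) (by omega), if_neg (by omega)]
    · simp only [pow_zero, pow_one, one_mul] at hi
      rw [hs'.2 11 i (by omega) (by omega), if_pos ⟨rfl, hi⟩]
      exact Nat.mod_lt _ (by omega)
    · simp only [pow_zero, pow_one]
      refine (isProd_base p hp _ _ c).congr hc (fun _ _ => rfl) (fun _ _ => rfl) fun e he => ?_
      have he' : e < cnt * 2 := by simpa using he
      rw [arr, hs'.2 11 e (by omega) (by omega), if_pos ⟨rfl, he'⟩]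

theorem splitE_val (s : St) (r h : Expr) (j : ℕ) :
    (splitE (.cell j) r h (.reg 24)).val s =
      split (s.reg 6) (r.val s) (h.val s) (arr (s.reg 9) s j) (s.reg 24) := rfl

theorem reshapeE_val (s : St) (r h : Expr) (j : ℕ) :
    (reshapeE (.cell j) r h (.reg 24)).val s =
      reshape (s.reg 6) (h.val s) (r.val s) (arr (s.reg 9) s j) (s.reg 24) := rfl

theorem unreshapeE_val (s : St) (r h : Expr) (j : ℕ) :
    (unreshapeE (.cell j) r h (.reg 24)).val s =
      unreshape (s.reg 6) (h.val s) (r.val s) (arr (s.reg 9) s j) (s.reg 24) := rfl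

theorem one_sub_ite (c : Prop) [Decidable c] : (1 - if c then 1 else 0) = if c then 0 else 1 := by
  split_ifs <;> rfl

theorem unsplitE_val (s : St) (r h : Expr) (j : ℕ) :
    (unsplitE (.cell j) r h (.reg 24)).val s =
      unsplit (s.reg 6) (s.reg 25) (r.val s) (h.val s) (arr (s.reg 9) s j) (s.reg 24) := by
  simp only [unsplitE, unsplit, sgnE, sgn, Expr.val_add, Expr.val_mul, Expr.val_sub, Expr.val_mod,
    Expr.val_div, Expr.val_cell, Expr.val_reg, Expr.val_ofNat, Expr.val_less, arr, ← one_sub_ite]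
  rfl

/-- The state after the exponents `a` and `b` have been put on the stack. -/
def push (U : ℕ) (s : St) (a b d : ℕ) : St :=
  ((s.setMem (U * 2 + 2 * d) a).setMem (U * 2 + (2 * d + 1)) b).setReg 23 (d + 1)

theorem push_reg (s : St) (a b d x : ℕ) :
    (push U s a b d).reg x = if x = 23 then d + 1 else s.reg x := by simp [push]

theorem push_mem_of_le {s : St} {a b d i : ℕ} (hd : 2 * d + 1 < U) (hi : U * 11 ≤ i) :
    (push U s a b d).mem i = s.mem i := by
  simp only [push, St.setReg_mem, St.setMem_mem]; rw [if_neg (by omega), if_neg (by omega)]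

theorem push_mem {s : St} {a b d i j : ℕ} (hd : 2 * d + 1 < U) (hi : i < U) :
    (push U s a b d).mem (U * j + i) = if j = 2 ∧ i = 2 * d then a
      else if j = 2 ∧ i = 2 * d + 1 then b else s.mem (U * j + i) := by
  simp only [push, St.setReg_mem, St.setMem_mem, cell_inj hi hd,
    cell_inj hi (by omega : 2 * d < U)]
  by_cases h1 : j = 2 <;> by_cases h2 : i = 2 * d <;> by_cases h3 : i = 2 * d + 1 <;>
    simp [h1, h2, h3]

theorem runs_down_split {a b cnt d : ℕ} {s : St} (h : Pre U p half (a + 1) b cnt d s) (hp : 2 ≤ p)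
    (hpB : p < B) (hUB : U < B) :
    Runs (Sem.ideal B) down s (16 * (cnt * (2 ^ (a + 1) * 2 ^ b)) + 30) fun s' =>
      (∀ x, x ≠ 20 → x ≠ 23 → x ≠ 24 → s'.reg x = s.reg x) ∧ s'.reg 20 = a ∧ s'.reg 23 = d + 1 ∧
      (∀ j i, i < U → j ≠ 10 → s'.mem (U * j + i) =
        if j = 11 ∧ i < cnt * (2 ^ (a + 1) * 2 ^ b) then split p (2 ^ b) (2 ^ a) (arr U s 11) i
        else if j = 12 ∧ i < cnt * (2 ^ (a + 1) * 2 ^ b) then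
          split p (2 ^ b) (2 ^ a) (arr U s 12) i
        else (push U s (a + 1) b d).mem (U * j + i)) := by
  obtain ⟨h6, h9, h20, h21, h22, h23, h25, hpow, hc, hb, hab, hsz, hd⟩ := h
  set S := cnt * (2 ^ (a + 1) * 2 ^ b)
  have hSU : S ≤ U := (Nat.le_mul_of_pos_right _ (by positivity)).trans hsz
  set s₃ := push U s (a + 1) b d with hs₃
  -- Used for region `11`, and then for region `12` after region `11` has been overwritten;
  -- therefore the memory has to be unchanged only from region `j` on.
  have hval : ∀ (s' : St) (i j : ℕ), (∀ x, x ≠ 24 → s'.reg x = s₃.reg x) →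
      (∀ i < U, s'.mem (U * 14 + i) = s.mem (U * 14 + i)) → 11 ≤ j →
      (∀ x, U * j ≤ x → s'.mem x = s.mem x) → ∀ m' : ℕ → ℕ,
      (∀ x, U * 11 ≤ x → m' x = s'.mem x) →
      (splitE (.cell j) rE hE (.reg 24)).val ⟨Function.update s'.reg 24 i, m'⟩ =
        split p (2 ^ b) (2 ^ a) (arr U s j) i := by
    intro s' i j hr hm1 hj hm m' hm'
    have hUj := Nat.mul_le_mul_left U hj
    have h14 : ∀ i ≤ b, m' (U * 14 + i) = 2 ^ i := fun i hi => by
      rw [hm' _ (by omega), hm1 _ (by omega), hpow i hi]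
    have hA : arr U ⟨Function.update s'.reg 24 i, m'⟩ j = arr U s j := funext fun i => by
      simp only [arr]
      rw [hm' _ (by omega), hm _ (by omega)]
    rw [splitE_val]
    simp only [rE, hE, Expr.val_cell, Expr.val_sub, Expr.val_reg, Expr.val_ofNat,
      Function.update_apply, Nat.reduceEqDiff, ↓reduceIte, hr, push_reg, h6, h9, h20, h21, hs₃,
      ne_eq, not_false_eq_true, Nat.add_sub_cancel]
    rw [h14 _ le_rfl, h14 _ (by omega), hA]
  unfold down
  refine .store_seq (U * 2 + 2 * d) (a + 1) (by simp [h9, h23]) (by simp [h20]) (by omega) ?_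
  refine .store_seq (U * 2 + (2 * d + 1)) b (by simp [h9, h23]) (by simp [h21]) (by omega) ?_
  refine .assign_seq (d + 1) (by simp [h23]) (by omega) ?_
  refine Runs.condT (T := 16 * S + 23) (by simp [Sem.ideal, h20]) ?_
  refine .seq_of (8 * S + 12) (Runs.rewrite (S := S) (U := U)
    (split p (2 ^ b) (2 ^ a) (arr U s 11)) ?_ ?_ hSU hUB fun i hi m' hm' => ⟨hval s₃ i 11
      (fun _ _ => rfl) ?_ (by omega) ?_ m'
      (fun x hx => hm' x (Or.inr hx)), ?_⟩) (by omega) fun s₄ ⟨hr₄, hm₄⟩ => ?_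
  · simp [h9]
  · simp [h22]
  · intro i hi; rw [push_mem (by omega) hi, if_neg (by omega), if_neg (by omega)]
  · intro i hi; exact push_mem_of_le (by omega) hi
  · exact (Nat.mod_lt _ (by omega)).trans hpB
  refine .seq_of 1 (Runs.rewrite (S := S) (U := U)
    (split p (2 ^ b) (2 ^ a) (arr U s 12)) ?_ ?_ hSU hUB fun i hi m' hm' => ⟨hval s₄ i 12
      hr₄ ?_ (by omega) ?_ m'
      (fun x hx => hm' x (Or.inr hx)), ?_⟩) (by omega) fun s₅ ⟨hr₅, hm₅⟩ => ?_
  · rw [hr₄ _ (by omega)]; simp [h9]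
  · rw [hr₄ _ (by omega)]; simp [h22]
  · intro i hi
    rw [hm₄ _ _ hi (by omega), if_neg (by omega)]
    exact (push_mem (by omega) hi).trans (by rw [if_neg (by omega), if_neg (by omega)])
  · intro x hx
    have hU : 0 < U := by omega
    have h1 : 12 ≤ x / U := (Nat.le_div_iff_mul_le hU).2 (by rw [mul_comm]; exact hx)
    have h2 := hm₄ (x / U) (x % U) (Nat.mod_lt _ hU) (by omega)
    rw [Nat.div_add_mod, if_neg (by omega)] at h2
    rw [h2]
    exact push_mem_of_le (by omega) (by omega)
  · exact (Nat.mod_lt _ (by omega)).trans hpB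
  refine .assign_last a ?_ (by omega) ⟨?_, ?_, ?_, ?_⟩
  · simp only [Expr.val_sub, Expr.val_reg, Expr.val_ofNat]
    rw [hr₅ _ (by omega), hr₄ _ (by omega)]; simp [h20]
  · intro x hx hx' hx''
    rw [St.setReg_reg, if_neg hx, hr₅ _ hx'', hr₄ _ hx'']; simp [hx']
  · simp
  · rw [St.setReg_reg, if_neg (by omega), hr₅ _ (by omega), hr₄ _ (by omega)]; simp
  · intro j i hi hj
    rw [St.setReg_mem, hm₅ j i hi hj, hm₄ j i hi hj]
    by_cases h1 : j = 11 ∧ i < S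
    · rw [if_pos h1, if_neg (by omega), if_pos h1]
    · rw [if_neg h1, if_neg h1]; rfl

theorem runs_down_reshape {b cnt d : ℕ} {s : St} (h : Pre U p half 0 b cnt d s) (hp : 2 ≤ p)
    (hpB : p < B) (hUB : U < B) (hb2 : 2 ≤ b)
    (hSU : 2 * (cnt * 2 ^ b) ≤ U) :
    Runs (Sem.ideal B) down s (32 * (cnt * 2 ^ b) + 30) fun s' =>
      (∀ x, x ≠ 20 → x ≠ 21 → x ≠ 22 → x ≠ 23 → x ≠ 24 → s'.reg x = s.reg x) ∧
      s'.reg 20 = b / 2 + 1 ∧ s'.reg 21 = b - b / 2 ∧ s'.reg 22 = 2 * (cnt * 2 ^ b) ∧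
      s'.reg 23 = d + 1 ∧
      (∀ j i, i < U → j ≠ 10 → s'.mem (U * j + i) =
        if j = 11 ∧ i < 2 * (cnt * 2 ^ b) then
          reshape p (2 ^ (b / 2)) (2 ^ (b - b / 2)) (arr U s 11) i
        else if j = 12 ∧ i < 2 * (cnt * 2 ^ b) then
          reshape p (2 ^ (b / 2)) (2 ^ (b - b / 2)) (arr U s 12) i
        else (push U s 0 b d).mem (U * j + i)) := by
  obtain ⟨h6, h9, h20, h21, h22, h23, h25, hpow, hc, hb, hab, hsz, hd⟩ := h
  rw [pow_zero, one_mul] at h22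
  set S := cnt * 2 ^ b with hS
  have hS0 : 0 < S := by positivity
  set s₃ := push U s 0 b d with hs₃
  set s₄ := ((s₃.setReg 22 (2 * S)).setReg 20 (b / 2 + 1)).setReg 21 (b - b / 2) with hs₄
  have hval : ∀ (s' : St) (i j : ℕ), (∀ x, x ≠ 24 → s'.reg x = s₄.reg x) →
      (∀ i < U, s'.mem (U * 14 + i) = s.mem (U * 14 + i)) → 11 ≤ j →
      (∀ x, U * j ≤ x → s'.mem x = s.mem x) → ∀ m' : ℕ → ℕ,
      (∀ x, U * 11 ≤ x → m' x = s'.mem x) →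
      (reshapeE (.cell j) rE hE (.reg 24)).val ⟨Function.update s'.reg 24 i, m'⟩ =
        reshape p (2 ^ (b / 2)) (2 ^ (b - b / 2)) (arr U s j) i := by
    intro s' i j hr hm1 hj hm m' hm'
    have hUj := Nat.mul_le_mul_left U hj
    have h14 : ∀ i ≤ b, m' (U * 14 + i) = 2 ^ i := fun i hi => by
      rw [hm' _ (by omega), hm1 _ (by omega), hpow i hi]
    have hA : arr U ⟨Function.update s'.reg 24 i, m'⟩ j = arr U s j := funext fun i => by
      simp only [arr]
      rw [hm' _ (by omega), hm _ (by omega)]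
    rw [reshapeE_val]
    simp only [rE, hE, Expr.val_cell, Expr.val_sub, Expr.val_reg, Expr.val_ofNat,
      Function.update_apply, Nat.reduceEqDiff, ↓reduceIte, hr, push_reg, h6, h9, hs₃, hs₄,
      ne_eq, not_false_eq_true, Nat.add_sub_cancel, St.setReg_reg]
    rw [h14 _ (by omega), h14 _ (by omega), hA]
  unfold down
  refine .store_seq (U * 2 + 2 * d) 0 (by simp [h9, h23]) (by simp [h20]) (by omega) ?_
  refine .store_seq (U * 2 + (2 * d + 1)) b (by simp [h9, h23]) (by simp [h21]) (by omega) ?_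
  refine .assign_seq (d + 1) (by simp [h23]) (by omega) ?_
  refine Runs.condF (T := 32 * S + 23) (by simp [Sem.ideal, h20]) ?_
  refine .assign_seq (2 * S) (by simp [h22]) (by omega) ?_
  refine .assign_seq (b / 2 + 1) (by simp [h21]) (by omega) ?_
  refine .assign_seq (b - b / 2) (by simp [h21]) (by omega) ?_
  refine .seq_of (16 * S + 7) (Runs.rewrite (S := 2 * S) (U := U)
    (reshape p (2 ^ (b / 2)) (2 ^ (b - b / 2)) (arr U s 11)) ?_ ?_ hSU hUB fun i hi m' hm' =>
      ⟨hval s₄ i 11 (fun _ _ => rfl) ?_ (by omega) ?_ m'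
      (fun x hx => hm' x (Or.inr hx)), (Nat.mod_lt _ (by omega)).trans hpB⟩) (by omega)
      fun s₅ ⟨hr₅, hm₅⟩ => ?_
  · simp [h9]
  · simp
  · intro i hi; simp only [hs₄, St.setReg_mem]
    rw [push_mem (by omega) hi, if_neg (by omega), if_neg (by omega)]
  · intro i hi; exact push_mem_of_le (by omega) hi
  refine (Runs.rewrite (S := 2 * S) (U := U)
    (reshape p (2 ^ (b / 2)) (2 ^ (b - b / 2)) (arr U s 12)) ?_ ?_ hSU hUB fun i hi m' hm' =>
      ⟨hval s₅ i 12 hr₅ ?_ (by omega) ?_ m'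
      (fun x hx => hm' x (Or.inr hx)), (Nat.mod_lt _ (by omega)).trans hpB⟩).mono (by omega)
      fun s₆ ⟨hr₆, hm₆⟩ => ?_
  · rw [hr₅ _ (by omega)]; simp [h9]
  · rw [hr₅ _ (by omega)]; simp
  · intro i hi
    rw [hm₅ _ _ hi (by omega), if_neg (by omega)]
    simp only [St.setReg_mem]
    exact (push_mem (by omega) hi).trans (by rw [if_neg (by omega), if_neg (by omega)])
  · intro x hx
    have hU : 0 < U := by omega
    have h1 : 12 ≤ x / U := (Nat.le_div_iff_mul_le hU).2 (by rw [mul_comm]; exact hx)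
    have h2 := hm₅ (x / U) (x % U) (Nat.mod_lt _ hU) (by omega)
    rw [Nat.div_add_mod, if_neg (by omega)] at h2
    rw [h2]
    exact push_mem_of_le (by omega) (by omega)
  refine ⟨?_, ?_, ?_, ?_, ?_, ?_⟩
  · intro x h0 h1 h2 h3 h4
    rw [hr₆ _ h4, hr₅ _ h4]; simp [h0, h1, h2, h3]
  · rw [hr₆ _ (by omega), hr₅ _ (by omega)]; simp
  · rw [hr₆ _ (by omega), hr₅ _ (by omega)]; simp
  · rw [hr₆ _ (by omega), hr₅ _ (by omega)]; simp
  · rw [hr₆ _ (by omega), hr₅ _ (by omega)]; simp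
  · intro j i hi hj
    rw [hm₆ j i hi hj, hm₅ j i hi hj]
    by_cases h1 : j = 11 ∧ i < 2 * S
    · rw [if_pos h1, if_neg (by omega), if_pos h1]
    · rw [if_neg h1, if_neg h1]; rfl

theorem runs_up_unsplit {a b S d : ℕ} {s : St} (h6 : s.reg 6 = p) (h9 : s.reg 9 = U)
    (h20 : s.reg 20 = a) (h21 : s.reg 21 = b) (h22 : s.reg 22 = S) (h23 : s.reg 23 = d + 1)
    (h25 : s.reg 25 = half) (hpow : ∀ i ≤ b, s.mem (U * 14 + i) = 2 ^ i) (hab : a ≤ b)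
    (hst : s.mem (U * 2 + 2 * d) = a + 1) (hp : 2 ≤ p) (hpB : p < B) (hUB : U < B) (hSU : S ≤ U)
    (hd : d + a < U) :
    Runs (Sem.ideal B) up s (8 * S + 12) fun s' =>
      (∀ x, x ≠ 20 → x ≠ 23 → x ≠ 24 → s'.reg x = s.reg x) ∧ s'.reg 20 = a + 1 ∧ s'.reg 23 = d ∧
      (∀ j i, i < U → j ≠ 10 → s'.mem (U * j + i) =
        if j = 11 ∧ i < S then unsplit p half (2 ^ b) (2 ^ a) (arr U s 11) i
        else s.mem (U * j + i)) := by
  unfold up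
  refine .assign_seq d (by simp [h23]) (by omega) ?_
  refine Runs.condT (T := 8 * S + 9) (by simp [Sem.ideal, h9, hst]) ?_
  refine .assign_seq (a + 1) (by simp [h20]) (by omega) ?_
  refine (Runs.rewrite (S := S) (U := U) (unsplit p half (2 ^ b) (2 ^ a) (arr U s 11)) ?_ ?_ hSU
    hUB fun i hi m' hm' => ⟨?_, (Nat.mod_lt _ (by omega)).trans hpB⟩).mono (by omega)
      fun s₅ ⟨hr₅, hm₅⟩ => ⟨?_, ?_, ?_, ?_⟩
  · simp [h9]
  · simp [h22]
  · have hA : arr U ⟨Function.update ((s.setReg 23 d).setReg 20 (a + 1)).reg 24 i, m'⟩ 11 =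
        arr U s 11 := funext fun i => by simp only [arr]; rw [hm' _ (by omega)]; rfl
    rw [unsplitE_val]
    simp only [rE, hE, Expr.val_cell, Expr.val_sub, Expr.val_reg, Expr.val_ofNat,
      Function.update_apply, Nat.reduceEqDiff, ↓reduceIte, h6, h9, h21, h25,
      Nat.add_sub_cancel, St.setReg_reg] at hA ⊢
    rw [hm' _ (by omega), hm' _ (by omega)]
    simp only [St.setReg_mem]
    rw [hpow _ le_rfl, hpow _ hab, hA]
  · intro x h1 h2 h3; rw [hr₅ _ h3]; simp [h1, h2]
  · rw [hr₅ _ (by omega)]; simp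
  · rw [hr₅ _ (by omega)]; simp
  · exact hm₅

theorem runs_up_unreshape {b S d : ℕ} {s : St} (h6 : s.reg 6 = p) (h9 : s.reg 9 = U)
    (h20 : s.reg 20 = b / 2 + 1) (h21 : s.reg 21 = b - b / 2) (h22 : s.reg 22 = 2 * S)
    (h23 : s.reg 23 = d + 1) (hpow : ∀ i ≤ b, s.mem (U * 14 + i) = 2 ^ i)
    (hst : s.mem (U * 2 + 2 * d) = 0) (hst' : s.mem (U * 2 + (2 * d + 1)) = b) (hb2 : 2 ≤ b)
    (hp : 2 ≤ p) (hpB : p < B) (hUB : U < B) (hSU : S ≤ U) (hd : 2 * d + b < U) :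
    Runs (Sem.ideal B) up s (8 * S + 16) fun s' =>
      (∀ x, x ≠ 20 → x ≠ 21 → x ≠ 22 → x ≠ 23 → x ≠ 24 → s'.reg x = s.reg x) ∧
      s'.reg 20 = 0 ∧ s'.reg 21 = b ∧ s'.reg 22 = S ∧ s'.reg 23 = d ∧
      (∀ j i, i < U → j ≠ 10 → s'.mem (U * j + i) =
        if j = 11 ∧ i < S then
          unreshape p (2 ^ (b / 2)) (2 ^ (b - b / 2)) (arr U s 11) i
        else s.mem (U * j + i)) := by
  unfold up
  refine .assign_seq d (by simp [h23]) (by omega) ?_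
  refine Runs.condF (T := 8 * S + 13) (by simp [Sem.ideal, h9, hst]) ?_
  refine .assign_seq S (by simp [h22]) (by omega) ?_
  refine .seq_of 3 (Runs.rewrite (S := S) (U := U)
    (unreshape p (2 ^ (b / 2)) (2 ^ (b - b / 2)) (arr U s 11)) ?_ ?_ hSU
    hUB fun i hi m' hm' => ⟨?_, (Nat.mod_lt _ (by omega)).trans hpB⟩) (by omega)
      fun s₅ ⟨hr₅, hm₅⟩ => ?_
  · simp [h9]
  · simp
  · have hA : arr U ⟨Function.update ((s.setReg 23 d).setReg 22 S).reg 24 i, m'⟩ 11 =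
        arr U s 11 := funext fun i => by simp only [arr]; rw [hm' _ (by omega)]; rfl
    rw [unreshapeE_val]
    simp only [rE, hE, Expr.val_cell, Expr.val_sub, Expr.val_reg, Expr.val_ofNat,
      Function.update_apply, Nat.reduceEqDiff, ↓reduceIte, h6, h9, h20, h21,
      Nat.add_sub_cancel, St.setReg_reg] at hA ⊢
    rw [hm' _ (by omega), hm' _ (by omega)]
    simp only [St.setReg_mem]
    rw [hpow _ (by omega), hpow _ (by omega), hA]
  refine .assign_seq 0 (by simp) (by omega) ?_
  refine .assign_last b ?_ (by omega) ⟨?_, ?_, ?_, ?_, ?_, ?_⟩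
  · simp only [Expr.val_cell, Expr.val_add, Expr.val_mul, Expr.val_reg, Expr.val_ofNat,
      St.setReg_reg, St.setReg_mem]
    simp only [Nat.reduceEqDiff, ↓reduceIte]
    rw [hr₅ _ (by omega), hr₅ _ (by omega)]
    simp only [St.setReg_reg, Nat.reduceEqDiff, ↓reduceIte, h9]
    rw [hm₅ _ _ (by omega) (by omega), if_neg (by omega)]
    exact hst'
  · intro x h0 h1 h2 h3 h4; simp [h0, h1, h2, h3, hr₅ _ h4]
  · simp
  · simp
  · simp [hr₅]
  · simp [hr₅]
  · exact hm₅

/-- The recursion is unrolled into two loops. A step down doubles the number of blocks; the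
induction hypothesis treats all blocks at once and ends where the loop upwards is about to run; the
next round of that loop pops the stack entry and undoes the step. This is why `Works` ends at a
control point inside the program. -/
theorem works_split [CharP K p] {a b τ : ℕ} (hp : 2 ≤ p) (hpB : p < B) (hUB : U < B)
    (h2 : (half : K) * 2 = 1) (hab : a ≤ b) (hW : Works U B p half K a b τ) :
    Works U B p half K (a + 1) b (τ + 80) := by
  intro cnt d s rest h
  have hS : 2 * cnt * (2 ^ a * 2 ^ b) = cnt * (2 ^ (a + 1) * 2 ^ b) := by ring
  have hS0 : 0 < cnt * (2 ^ (a + 1) * 2 ^ b) := by have := h.cnt_pos; positivity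
  have hSU : cnt * (2 ^ (a + 1) * 2 ^ b) ≤ U :=
    (Nat.le_mul_of_pos_right _ (by positivity)).trans h.size
  have hb := h.b_pos
  have hd := h.depth
  refine To.mono (To.loopT (by simp [Sem.ideal, h.reg20]) ((runs_down_split h hp hpB hUB _).trans
    (fun s₁ ⟨hr₁, h20, h23, hm₁⟩ => (hW (2 * cnt) (d + 1) s₁ rest ⟨by simpa [hr₁] using h.reg6,
      by simpa [hr₁] using h.reg9, h20, by simpa [hr₁] using h.reg21,
      by rw [hS]; simpa [hr₁] using h.reg22, h23, by simpa [hr₁] using h.reg25, ?_,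
      by have := h.cnt_pos; omega, hb, by omega, by rw [hS]; exact h.size, by omega⟩).trans
    (fun s₂ hs₂ => To.loopT (T := 8 * (cnt * (2 ^ (a + 1) * 2 ^ b)) + 12) ?_ (To.mono
      (runs_up_unsplit (p := p) (U := U) (a := a) (b := b) (d := d)
      (half := half) (S := cnt * (2 ^ (a + 1) * 2 ^ b)) ?_ ?_ ?_ ?_ ?_ ?_ ?_ ?_ hab ?_ hp hpB hUB
      hSU (by omega) (upLoop :: rest)) le_rfl fun s₃ ⟨hr₃, h20', h23', hm₃⟩ =>
        (?_ : Post U p K (a + 1) b cnt d s s₃)))))) ?_ fun _ h => h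
  · intro i hi
    rw [hm₁ _ _ (by omega) (by omega), if_neg (by omega), if_neg (by omega),
      push_mem (by omega) (by omega), if_neg (by omega), if_neg (by omega), h.pow i hi]
  · simp only [Sem.ideal, Expr.val_reg]; rw [hs₂.reg _ (by omega), h23]; omega
  · rw [hs₂.reg _ (by omega), hr₁ _ (by omega) (by omega) (by omega), h.reg6]
  · rw [hs₂.reg _ (by omega), hr₁ _ (by omega) (by omega) (by omega), h.reg9]
  · rw [hs₂.reg _ (by omega), h20]
  · rw [hs₂.reg _ (by omega), hr₁ _ (by omega) (by omega) (by omega), h.reg21]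
  · rw [hs₂.reg _ (by omega), hr₁ _ (by omega) (by omega) (by omega), h.reg22]
  · rw [hs₂.reg _ (by omega), h23]
  · rw [hs₂.reg _ (by omega), hr₁ _ (by omega) (by omega) (by omega), h.reg25]
  · intro i hi
    rw [hs₂.mem _ _ (by omega) (by omega) (by omega) (by omega) (by omega),
      hm₁ _ _ (by omega) (by omega), if_neg (by omega), if_neg (by omega),
      push_mem (by omega) (by omega), if_neg (by omega), if_neg (by omega), h.pow i hi]
  · rw [hs₂.stack _ (by omega),
      hm₁ _ _ (by omega) (by omega), if_neg (by omega), if_neg (by omega),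
      push_mem (by omega) (by omega), if_pos ⟨rfl, rfl⟩]
  · rw [hS, add_mul]; omega
  · have hrall : ∀ x ≠ 24, s₃.reg x = s.reg x := fun x hx => by
      by_cases h1 : x = 20
      · rw [h1, h20', h.reg20]
      · by_cases h2 : x = 23
        · rw [h2, h23', h.reg23]
        · rw [hr₃ x h1 h2 hx, hs₂.reg x hx, hr₁ x h1 h2 hx]
    refine ⟨hrall, fun j i hi h0 h1 h2 h3 => ?_, fun i hi => ?_, fun i hi => ?_, fun c hc => ?_⟩
    · rw [hm₃ _ _ hi h0, if_neg (by omega), hs₂.mem _ _ hi h0 h1 h2 h3, hm₁ _ _ hi h0,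
        if_neg (by omega), if_neg (by omega), push_mem (by omega) hi, if_neg (by omega),
        if_neg (by omega)]
    · rw [hm₃ _ _ (by omega) (by omega), if_neg (by omega), hs₂.stack _ (by omega),
        hm₁ _ _ (by omega) (by omega), if_neg (by omega), if_neg (by omega),
        push_mem (by omega) (by omega), if_neg (by omega), if_neg (by omega)]
    · rw [hm₃ _ _ (by omega) (by omega), if_pos ⟨rfl, hi⟩]
      exact Nat.mod_lt _ (by omega)
    · have hq : 2 ^ b = 2 ^ a * 2 ^ (b - a) := by rw [← pow_add]; congr 1; omega
      have hX : ∀ e < 2 * cnt * (2 ^ a * 2 ^ b), arr U s₁ 11 e =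
          split p (2 ^ b) (2 ^ a) (arr U s 11) e := fun e he => by
        rw [hS] at he
        rw [arr, hm₁ _ _ (by omega) (by omega), if_pos ⟨rfl, he⟩]
      have hY : ∀ e < 2 * cnt * (2 ^ a * 2 ^ b), arr U s₁ 12 e =
          split p (2 ^ b) (2 ^ a) (arr U s 12) e := fun e he => by
        rw [hS] at he
        rw [arr, hm₁ _ _ (by omega) (by omega), if_neg (by omega), if_pos ⟨rfl, he⟩]
      have h₀ := (hs₂.prod (2 * c) (by omega)).congr (by omega) hX hY fun _ _ => rfl
      have h₁ := (hs₂.prod (2 * c + 1) (by omega)).congr (by omega) hX hY fun _ _ => rfl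
      have key : IsProd K (2 * 2 ^ a) (2 ^ b) (arr U s 11) (arr U s 12)
          (unsplit p half (2 ^ b) (2 ^ a) (arr U s₂ 11)) c := by
        rw [hq] at h₀ h₁ ⊢
        exact isProd_unsplit p hp (by positivity) h2 _ _ _ _ h₀ h₁
      rw [← pow_succ'] at key
      refine key.congr hc (fun _ _ => rfl) (fun _ _ => rfl) fun e he => ?_
      rw [arr, hm₃ _ _ (by omega) (by omega), if_pos ⟨rfl, he⟩]

/-- ⌈log b⌉ counts the halvings b ↦ ⌈b/2⌉, which are the levels of reshaping. Each level doubles the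
array; this explains the factor `2 ^ Nat.clog 2 b` in `Pre.size`. -/
theorem clog_half {b : ℕ} (hb : 2 ≤ b) : Nat.clog 2 b = Nat.clog 2 (b - b / 2) + 1 := by
  rw [Nat.clog_of_two_le (by omega) hb]; congr 2; omega

/-- A block of length 2^b becomes one of length 2^{⌊b/2⌋+1} · 2^{⌈b/2⌉}, which is twice as long,
hence `2 * τ`. The new exponents satisfy a ≤ b + 1, so that the powers of y include the roots of
unity required for the splittings. The quantity d + a + 4b never increases at a push, neither here
nor in `works_split`, so it bounds the height of the stack. -/
theorem works_reshape [CharP K p] [IsAlgClosed K] {b τ : ℕ} (hp : 2 ≤ p) (hpB : p < B)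
    (hUB : U < B) (h2 : (half : K) * 2 = 1) (hb2 : 2 ≤ b)
    (hW : Works U B p half K (b / 2 + 1) (b - b / 2) τ) :
    Works U B p half K 0 b (2 * τ + 100) := by
  intro cnt d s rest h
  have hSe : cnt * (2 ^ 0 * 2 ^ b) = cnt * 2 ^ b := by ring
  have hq : 2 ^ b = 2 ^ (b / 2) * 2 ^ (b - b / 2) := by rw [← pow_add]; congr 1; omega
  have hS : cnt * (2 ^ (b / 2 + 1) * 2 ^ (b - b / 2)) = 2 * (cnt * 2 ^ b) := by rw [hq]; ring
  have hS0 : 0 < cnt * 2 ^ b := by have := h.cnt_pos; positivity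
  have hsz := h.size
  rw [clog_half hb2, pow_succ, hSe] at hsz
  have hsz' : 2 * (cnt * 2 ^ b) * 2 ^ Nat.clog 2 (b - b / 2) ≤ U := by linarith
  have hSU : 2 * (cnt * 2 ^ b) ≤ U := (Nat.le_mul_of_pos_right _ (by positivity)).trans hsz'
  have hd := h.depth
  have h22 := h.reg22
  rw [hSe] at h22 ⊢
  refine To.mono (To.loopT (by simp [Sem.ideal, h.reg21]; omega)
    ((runs_down_reshape h hp hpB hUB hb2 hSU _).trans
    (fun s₁ ⟨hr₁, h20, h21, h22, h23, hm₁⟩ => (hW cnt (d + 1) s₁ rest ⟨by simpa [hr₁] using h.reg6,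
      by simpa [hr₁] using h.reg9, h20, h21,
      by rw [hS]; exact h22, h23, by simpa [hr₁] using h.reg25, ?_,
      h.cnt_pos, by omega, by omega, by rw [hS]; exact hsz', by omega⟩).trans
    (fun s₂ hs₂ => To.loopT (T := 8 * (cnt * 2 ^ b) + 16) ?_ (To.mono
      (runs_up_unreshape (p := p) (U := U) (b := b) (d := d)
      (S := cnt * 2 ^ b) ?_ ?_ ?_ ?_ ?_ ?_ ?_ ?_ ?_ hb2 hp hpB hUB
      (by omega) (by omega) (upLoop :: rest)) le_rfl fun s₃ ⟨hr₃, h20', h21', h22', h23', hm₃⟩ =>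
        (?_ : Post U p K 0 b cnt d s s₃)))))) ?_ fun _ h => h
  · intro i hi
    rw [hm₁ _ _ (by omega) (by omega), if_neg (by omega), if_neg (by omega),
      push_mem (by omega) (by omega), if_neg (by omega), if_neg (by omega), h.pow i (by omega)]
  · simp only [Sem.ideal, Expr.val_reg]; rw [hs₂.reg _ (by omega), h23]; omega
  · rw [hs₂.reg _ (by omega), hr₁ _ (by omega) (by omega) (by omega) (by omega) (by omega), h.reg6]
  · rw [hs₂.reg _ (by omega), hr₁ _ (by omega) (by omega) (by omega) (by omega) (by omega), h.reg9]
  · rw [hs₂.reg _ (by omega), h20]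
  · rw [hs₂.reg _ (by omega), h21]
  · rw [hs₂.reg _ (by omega), h22]
  · rw [hs₂.reg _ (by omega), h23]
  · intro i hi
    rw [hs₂.mem _ _ (by omega) (by omega) (by omega) (by omega) (by omega),
      hm₁ _ _ (by omega) (by omega), if_neg (by omega), if_neg (by omega),
      push_mem (by omega) (by omega), if_neg (by omega), if_neg (by omega), h.pow i hi]
  · rw [hs₂.stack _ (by omega),
      hm₁ _ _ (by omega) (by omega), if_neg (by omega), if_neg (by omega),
      push_mem (by omega) (by omega), if_pos ⟨rfl, rfl⟩]
  · rw [hs₂.stack _ (by omega),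
      hm₁ _ _ (by omega) (by omega), if_neg (by omega), if_neg (by omega),
      push_mem (by omega) (by omega), if_neg (by omega), if_pos ⟨rfl, rfl⟩]
  · rw [hS, add_mul, mul_assoc 2 τ, ← mul_assoc τ 2, mul_comm τ 2, mul_assoc 2 τ]; omega
  · have hrall : ∀ x ≠ 24, s₃.reg x = s.reg x := fun x hx => by
      by_cases h1 : x = 20
      · rw [h1, h20', h.reg20]
      · by_cases h2 : x = 23
        · rw [h2, h23', h.reg23]
        · by_cases h3 : x = 21
          · rw [h3, h21', h.reg21]
          · by_cases h4 : x = 22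
            · rw [h4, h22', h.reg22, hSe]
            · rw [hr₃ x h1 h3 h4 h2 hx, hs₂.reg x hx, hr₁ x h1 h3 h4 h2 hx]
    refine ⟨hrall, fun j i hi h0 h1 h2 h3 => ?_, fun i hi => ?_, fun i hi => ?_, fun c hc => ?_⟩
    · rw [hm₃ _ _ hi h0, if_neg (by omega), hs₂.mem _ _ hi h0 h1 h2 h3, hm₁ _ _ hi h0,
        if_neg (by omega), if_neg (by omega), push_mem (by omega) hi, if_neg (by omega),
        if_neg (by omega)]
    · rw [hm₃ _ _ (by omega) (by omega), if_neg (by omega), hs₂.stack _ (by omega),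
        hm₁ _ _ (by omega) (by omega), if_neg (by omega), if_neg (by omega),
        push_mem (by omega) (by omega), if_neg (by omega), if_neg (by omega)]
    · rw [hSe] at hi
      rw [hm₃ _ _ (by omega) (by omega), if_pos ⟨rfl, hi⟩]
      exact Nat.mod_lt _ (by omega)
    · have hX : ∀ e < cnt * (2 ^ (b / 2 + 1) * 2 ^ (b - b / 2)), arr U s₁ 11 e =
          reshape p (2 ^ (b / 2)) (2 ^ (b - b / 2)) (arr U s 11) e := fun e he => by
        rw [hS] at he
        rw [arr, hm₁ _ _ (by omega) (by omega), if_pos ⟨rfl, he⟩]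
      have hY : ∀ e < cnt * (2 ^ (b / 2 + 1) * 2 ^ (b - b / 2)), arr U s₁ 12 e =
          reshape p (2 ^ (b / 2)) (2 ^ (b - b / 2)) (arr U s 12) e := fun e he => by
        rw [hS] at he
        rw [arr, hm₁ _ _ (by omega) (by omega), if_neg (by omega), if_pos ⟨rfl, he⟩]
      have h₀ := (hs₂.prod c hc).congr hc hX hY fun _ _ => rfl
      have hne : ((2 * 2 ^ (b / 2) : ℕ) : K) ≠ 0 := by
        have : (2 : K) ≠ 0 := right_ne_zero_of_mul_eq_one h2
        push_cast
        exact mul_ne_zero this (pow_ne_zero _ this)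
      rw [pow_succ'] at h₀
      have key := isProd_unreshape p hp (by positivity) hne _ _ _ _ h₀
      rw [← hq] at key
      rw [pow_zero]
      refine key.congr hc (fun _ _ => rfl) (fun _ _ => rfl) fun e he => ?_
      rw [one_mul] at he
      have : cnt * 2 ^ b ≤ U := by omega
      rw [arr, hm₃ _ _ (by omega) (by omega), if_pos ⟨rfl, he⟩]

theorem works_add [CharP K p] {a b τ : ℕ} (hp : 2 ≤ p) (hpB : p < B) (hUB : U < B)
    (h2 : (half : K) * 2 = 1) (hab : a ≤ b + 1) (hW : Works U B p half K 0 b τ) :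
    Works U B p half K a b (τ + a * 80) := by
  induction a with
  | zero => simpa using hW
  | succ a ih =>
      rw [add_mul, one_mul, ← add_assoc]
      exact works_split hp hpB hUB h2 (by omega) (ih (by omega))

/-- The time per entry for products of length `2 ^ b`. -/
def rate (b : ℕ) : ℕ := 420 * ((b - 1) * Nat.clog 2 b) + 80 * 2 ^ Nat.clog 2 b

theorem Works.mono {a b τ τ' : ℕ} (h : Works U B p half K a b τ) (hτ : τ ≤ τ') :
    Works U B p half K a b τ' := fun cnt d s rest hs =>
  (h cnt d s rest hs).mono (Nat.mul_le_mul_right _ hτ) fun _ h => h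

/-- Below b lie ⌊b/2⌋ + 1 splittings and then the problem for ⌈b/2⌉ with twice as many entries. The
resulting recurrence is solved by `rate`, of order b log b per entry, which is O(N log N log log N)
in all for N = 2^b. -/
theorem works [CharP K p] [IsAlgClosed K] (hp : 2 ≤ p) (hpB : p < B) (hUB : U < B)
    (h2 : (half : K) * 2 = 1) : ∀ {b : ℕ}, 0 < b → Works U B p half K 0 b (rate b) := by
  intro b
  induction b using Nat.strong_induction_on with
  | _ b ih =>
      intro hb
      rcases Nat.lt_or_ge b 2 with h | h
      · obtain rfl : b = 1 := by omega
        simpa [rate] using works_base hp hpB hUB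
      · refine (works_reshape hp hpB hUB h2 h (works_add hp hpB hUB h2 (by omega)
          (ih (b - b / 2) (by omega) (by omega)))).mono ?_
        -- With b - 1 in place of b, halving the exponent compensates for the doubled number of
        -- entries exactly, so every level costs O(b) per entry.
        have hc : (b - b / 2 - 1) * 2 ≤ b - 1 := by omega
        rw [rate, rate, clog_half h, pow_succ]
        have := Nat.mul_le_mul_right (Nat.clog 2 (b - b / 2)) hc
        rw [mul_add (b - 1), mul_one]
        have e1 : (b - b / 2 - 1) * 2 * Nat.clog 2 (b - b / 2) =
          2 * ((b - b / 2 - 1) * Nat.clog 2 (b - b / 2)) := by ring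
        omega

end Conv

end WordRAM

/-! ### Truncated multiplication of power series -/

namespace WordRAM

open Negacyclic Finset.HasAntidiagonal

/-- Agreement of states except for what is used as working space by multiplications. -/
structure Agree (U : ℕ) (s s' : St) : Prop where
  reg : ∀ x, x < 20 ∨ 25 ≤ x → s'.reg x = s.reg x
  mem : ∀ j i, i < U → j ≠ 2 → j ≠ 10 → j ≠ 11 → j ≠ 12 → s'.mem (U * j + i) = s.mem (U * j + i)

theorem Agree.refl (U : ℕ) (s : St) : Agree U s s := ⟨fun _ _ => rfl, fun _ _ _ _ _ _ _ => rfl⟩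

theorem Agree.trans {U : ℕ} {s s' s'' : St} (h : Agree U s s') (h' : Agree U s' s'') :
    Agree U s s'' :=
  ⟨fun x hx => (h'.reg x hx).trans (h.reg x hx),
    fun j i hi h0 h1 h2 h3 => (h'.mem j i hi h0 h1 h2 h3).trans (h.mem j i hi h0 h1 h2 h3)⟩

theorem Agree.setReg {U : ℕ} {s s' : St} (h : Agree U s s') {x : ℕ} (v : ℕ) (hx : 20 ≤ x)
    (hx' : x < 25) : Agree U s (s'.setReg x v) :=
  ⟨fun y hy => by rw [St.setReg_reg, if_neg (by omega), h.reg y hy], h.mem⟩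

theorem Agree.rewrite {U : ℕ} {s s' : St} (h : Agree U s s') {m' : ℕ → ℕ} (i : ℕ)
    (hm : ∀ a, a < U * 10 ∨ U * 11 ≤ a → m' a = s'.mem a) :
    Agree U s ⟨Function.update s'.reg 24 i, m'⟩ :=
  ⟨fun y hy => by rw [← h.reg y hy]; simp only [Function.update_apply]; rw [if_neg (by omega)],
    fun j i hi h0 h1 h2 h3 => by
      rw [← h.mem j i hi h0 h1 h2 h3]
      refine hm _ ?_
      rcases Nat.lt_or_gt_of_ne h1 with h4 | h4
      · have := Nat.mul_le_mul_left U (show j + 1 ≤ 10 from h4)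
        rw [mul_add] at this; omega
      · have := Nat.mul_le_mul_left U (show 11 ≤ j from h4)
        omega⟩

/-- Multiplication of power series with coefficients `eX` and `eY` (in which register `24` is the
index) up to the precision `2 ^ k` in register `14`, where `k` is in register `13`. Then the entries
of region `Z` are replaced by `eZ`, in which the product is in region `11`. -/
def Prog.mul (eX eY : Expr) (Z : ℕ) (eZ : Expr) : Prog :=
  .seq (.assign 22 (2 * .reg 14)) <|
  .seq (.rewrite 11 (.less (.reg 24) (.reg 14) * eX)) <|
  .seq (.rewrite 12 (.less (.reg 24) (.reg 14) * eY)) <|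
  .seq (.assign 20 0) <|
  .seq (.assign 21 (.reg 13 + 1)) <|
  .seq (.assign 23 0) <|
  .seq (.seq Conv.downLoop (.seq Conv.baseProg Conv.upLoop)) <|
  .seq (.assign 22 (.reg 14)) <|
  .rewrite Z eZ

/-- The product of power series modulo `p`. -/
def conv (p : ℕ) (x y : ℕ → ℕ) (i : ℕ) : ℕ := (∑ u ∈ antidiagonal i, x u.1 * y u.2) % p

/-- The setting of multiplications up to precision `2 ^ k`. -/
structure MulPre (U B p half k : ℕ) (s : St) : Prop where
  reg6 : s.reg 6 = p
  reg9 : s.reg 9 = U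
  reg13 : s.reg 13 = k
  reg14 : s.reg 14 = 2 ^ k
  reg25 : s.reg 25 = half
  pow : ∀ i ≤ k + 1, s.mem (U * 14 + i) = 2 ^ i
  prime : p.Prime
  half : half * 2 % p = 1
  p_lt : p < B
  U_lt : U < B
  size : 2 ^ (k + 1) * 2 ^ Nat.clog 2 (k + 1) ≤ U
  depth : 8 * (k + 1) ≤ U

theorem MulPre.agree {U B p half k : ℕ} {s s' : St} (h : MulPre U B p half k s)
    (hs : Agree U s s') : MulPre U B p half k s' := by
  have := h.depth
  refine ⟨by rw [hs.reg _ (by omega), h.reg6], by rw [hs.reg _ (by omega), h.reg9],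
    by rw [hs.reg _ (by omega), h.reg13], by rw [hs.reg _ (by omega), h.reg14],
    by rw [hs.reg _ (by omega), h.reg25], fun i hi => ?_, h.prime, h.half, h.p_lt, h.U_lt, h.size,
    h.depth⟩
  rw [hs.mem _ _ (by omega) (by omega) (by omega) (by omega) (by omega), h.pow i hi]

/-- The time for a multiplication up to precision `2 ^ k`. -/
def mulTime (k : ℕ) : ℕ := (2 * Conv.rate (k + 1) + 100) * 2 ^ k

/-- Both factors are cut off at 2^k and padded with zeros to length 2^{k+1}. Then the negacyclic
product is the ordinary one, and its first 2^k entries are those of the product of the power series.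
-/
theorem Runs.mul_aux (K : Type) [Field K] [IsAlgClosed K] {U B p half k Z : ℕ} [CharP K p] {s : St}
    {eX eY eZ : Expr} (h : MulPre U B p half k s)
    (x y z : ℕ → ℕ)
    (hx : ∀ i < 2 ^ k, x i < B ∧ ∀ s', Agree U s s' → s'.reg 24 = i → eX.val s' = x i)
    (hy : ∀ i < 2 ^ k, y i < B ∧ ∀ s', Agree U s s' → s'.reg 24 = i → eY.val s' = y i)
    (hz : ∀ i < 2 ^ k, z i < B ∧ ∀ s', Agree U s s' → s'.reg 24 = i →
      s'.mem (U * 11 + i) = conv p x y i → eZ.val s' = z i) :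
    Runs (Sem.ideal B) (.mul eX eY Z eZ) s (mulTime k) fun s' =>
      (∀ x, x < 20 ∨ 25 ≤ x → s'.reg x = s.reg x) ∧
      ∀ j i, i < U → j ≠ 2 → j ≠ 10 → j ≠ 11 → j ≠ 12 →
        s'.mem (U * j + i) = if j = Z ∧ i < 2 ^ k then z i else s.mem (U * j + i) := by
  have hdepth := h.depth
  have hMU : 2 ^ (k + 1) ≤ U := (Nat.le_mul_of_pos_right _ (by positivity)).trans h.size
  have hM : 2 ^ (k + 1) = 2 * 2 ^ k := pow_succ' 2 k
  have hk0 : 0 < 2 ^ k := by positivity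
  have hUB := h.U_lt
  unfold Prog.mul
  have hT : mulTime k = 2 * (Conv.rate (k + 1) * 2 ^ k) + 99 * 2 ^ k + 2 ^ k := by
    rw [mulTime]; ring
  refine Runs.mono_time ?_ (show 2 * (Conv.rate (k + 1) * 2 ^ k) + 40 * 2 ^ k + 45 + 2 ≤ _ by
    rw [hT]; omega)
  refine .assign_seq (2 * 2 ^ k) (by simp [h.reg14]) (by omega) ?_
  set s₁ := s.setReg 22 (2 * 2 ^ k) with hs₁
  have a₁ : Agree U s s₁ := (Agree.refl U s).setReg _ (by omega) (by omega)
  have hmask : ∀ (e : Expr) (x : ℕ → ℕ), (∀ i < 2 ^ k, x i < B ∧ ∀ s', Agree U s s' →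
      s'.reg 24 = i → e.val s' = x i) → ∀ i s', Agree U s s' → s'.reg 24 = i →
      (Expr.less (.reg 24) (.reg 14) * e).val s' = (if i < 2 ^ k then x i else 0) ∧
        (if i < 2 ^ k then x i else 0) < B := by
    intro e x hx i s' hs' hi
    simp only [Expr.val_mul, Expr.val_less, Expr.val_reg, hi, hs'.reg 14 (by omega), h.reg14]
    split_ifs with hlt
    · obtain ⟨h1, h2⟩ := hx i hlt
      rw [h2 s' hs' hi, one_mul]; exact ⟨rfl, h1⟩
    · rw [zero_mul]; exact ⟨rfl, by omega⟩
  refine .seq_of (2 * (Conv.rate (k + 1) * 2 ^ k) + 24 * 2 ^ k + 37) (Runs.rewrite (S := 2 * 2 ^ k)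
    (U := U) (fun i => if i < 2 ^ k then x i else 0) (by simp [hs₁, h.reg9]) (by simp [hs₁])
    (by omega) (by omega) fun i hi m' hm' => hmask _ _ hx i _ (a₁.rewrite i hm') (by simp))
    (by omega) fun s₂ ⟨hr₂, hm₂⟩ => ?_
  have a₂ : Agree U s s₂ := a₁.trans ⟨fun x hx => hr₂ x (by omega),
    fun j i hi h0 h1 h2 h3 => by rw [hm₂ j i hi h1, if_neg (by omega)]⟩
  have h22 : s₂.reg 22 = 2 * 2 ^ k := by rw [hr₂ _ (by omega)]; simp [hs₁]
  refine .seq_of (2 * (Conv.rate (k + 1) * 2 ^ k) + 8 * 2 ^ k + 29) (Runs.rewrite (S := 2 * 2 ^ k)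
    (U := U) (fun i => if i < 2 ^ k then y i else 0) (by rw [a₂.reg _ (by omega), h.reg9]) h22
    (by omega) (by omega) fun i hi m' hm' => hmask _ _ hy i _ (a₂.rewrite i hm') (by simp))
    (by omega) fun s₃ ⟨hr₃, hm₃⟩ => ?_
  have a₃ : Agree U s s₃ := a₂.trans ⟨fun x hx => hr₃ x (by omega),
    fun j i hi h0 h1 h2 h3 => by rw [hm₃ j i hi h1, if_neg (by omega)]⟩
  rw [← hr₃ _ (by omega)] at h22
  refine .assign_seq 0 (by simp) (by omega) ?_
  refine .assign_seq (k + 1) (by simp [a₃.reg 13 (by omega), h.reg13]) (by omega) ?_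
  refine .assign_seq 0 (by simp) (by omega) ?_
  set s₄ := ((s₃.setReg 20 0).setReg 21 (k + 1)).setReg 23 0 with hs₄
  have a₄ : Agree U s s₄ := ((a₃.setReg _ (by omega) (by omega)).setReg _ (by omega)
    (by omega)).setReg _ (by omega) (by omega)
  have h2 : (half : K) * 2 = 1 := by
    have := congrArg (Nat.cast : ℕ → K) h.half
    rw [cast_mod] at this; push_cast at this; exact this
  have hpre : Conv.Pre U p half 0 (k + 1) 1 0 s₄ := by
    have h' := h.agree a₄
    exact ⟨h'.reg6, h'.reg9, by simp [hs₄], by simp [hs₄], by simp [hs₄, h22, hM],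
      by simp [hs₄], h'.reg25, h'.pow, by omega, by omega, by omega, by simpa using h.size,
      by omega⟩
  have hconv : Runs (Sem.ideal B) (.seq Conv.downLoop (.seq Conv.baseProg Conv.upLoop)) s₄
      (2 * (Conv.rate (k + 1) * 2 ^ k) + 2) (Conv.Post U p K 0 (k + 1) 1 0 s₄) := by
    intro rest
    refine To.mono (To.seq ((Conv.works h.prime.two_le h.p_lt hUB h2 (by omega) 1 0 s₄ rest
      hpre).trans fun s₅ hs₅ => To.loopF (T := 0) ?_ (To.refl hs₅))) (le_of_eq ?_) fun _ h => h
    · simp only [Sem.ideal, Expr.val_reg]; rw [hs₅.reg _ (by omega)]; simp [hs₄]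
    · rw [hM]; ring
  refine .seq_of (8 * 2 ^ k + 9) hconv (by omega) fun s₅ hs₅ => ?_
  have a₅ : Agree U s s₅ := a₄.trans ⟨fun x hx => hs₅.reg x (by omega),
    fun j i hi h0 h1 h2 h3 => hs₅.mem j i hi h1 h2 h3 h0⟩
  refine .assign_seq (2 ^ k) (by simp [a₅.reg 14 (by omega), h.reg14]) (by omega) ?_
  have a₆ : Agree U s (s₅.setReg 22 (2 ^ k)) := a₅.setReg _ (by omega) (by omega)
  have hres : ∀ i < 2 ^ k, s₅.mem (U * 11 + i) = conv p x y i := by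
    intro i hi
    have hX : ∀ e < 2 * 2 ^ k, Conv.arr U s₄ 11 e = if e < 2 ^ k then x e else 0 := fun e he => by
      rw [Conv.arr]; simp only [hs₄, St.setReg_mem]
      rw [hm₃ _ _ (by omega) (by omega), if_neg (by omega), hm₂ _ _ (by omega) (by omega),
        if_pos ⟨rfl, he⟩]
    have hY : ∀ e < 2 * 2 ^ k, Conv.arr U s₄ 12 e = if e < 2 ^ k then y e else 0 := fun e he => by
      rw [Conv.arr]; simp only [hs₄, St.setReg_mem]
      rw [hm₃ _ _ (by omega) (by omega), if_pos ⟨rfl, he⟩]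
    have hN : ((2 * 2 ^ k : ℕ) : K) ≠ 0 := by
      have : (2 : K) ≠ 0 := right_ne_zero_of_mul_eq_one h2
      push_cast
      exact mul_ne_zero this (pow_ne_zero _ this)
    have hprod := hs₅.prod 0 (by omega)
    rw [pow_zero, hM] at hprod
    have key := apply_of_isProd hN _ _ _ (fun e h1 h2 => by rw [hX e h2, if_neg (by omega)])
      (fun e h1 h2 => by rw [hY e h2, if_neg (by omega)]) hprod (e := i) (by omega)
    have hlt : s₅.mem (U * 11 + i) < p := hs₅.lt i (by rw [hM]; omega)
    have hsum : ∑ u ∈ antidiagonal i, (Conv.arr U s₄ 11 u.1 : K) * Conv.arr U s₄ 12 u.2 =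
        (∑ u ∈ antidiagonal i, x u.1 * y u.2 : ℕ) := by
      push_cast
      refine Finset.sum_congr rfl fun u hu => ?_
      have := mem_antidiagonal.1 hu
      rw [hX _ (by omega), hY _ (by omega), if_pos (by omega), if_pos (by omega)]
    rw [hsum] at key
    have := (CharP.natCast_eq_natCast K p).1 key
    rw [conv, ← this]; exact (Nat.mod_eq_of_lt hlt).symm
  refine (Runs.rewrite (S := 2 ^ k) (U := U) z (by rw [a₆.reg _ (by omega), h.reg9]) (by simp)
    (by omega) (by omega) fun i hi m' hm' => ⟨(hz i hi).2 _ (a₆.rewrite i hm') (by simp) ?_,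
      (hz i hi).1⟩).mono (by omega) fun s₇ ⟨hr₇, hm₇⟩ =>
        ⟨fun x hx => ?_, fun j i hi h0 h1 h2 h3 => ?_⟩
  · simp only
    rw [hm' _ (by omega)]; exact hres i hi
  · rw [hr₇ _ (by omega), a₆.reg _ hx]
  · rw [hm₇ j i hi h1, a₆.mem j i hi h0 h1 h2 h3]

/-- The algebraic closure of Z/p supplies the points at which products are tested. It occurs in the
correctness proof only; the program computes with residues. -/
theorem Runs.mul {U B p half k Z : ℕ} {s : St} {eX eY eZ : Expr} (h : MulPre U B p half k s)
    (x y z : ℕ → ℕ)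
    (hx : ∀ i < 2 ^ k, x i < B ∧ ∀ s', Agree U s s' → s'.reg 24 = i → eX.val s' = x i)
    (hy : ∀ i < 2 ^ k, y i < B ∧ ∀ s', Agree U s s' → s'.reg 24 = i → eY.val s' = y i)
    (hz : ∀ i < 2 ^ k, z i < B ∧ ∀ s', Agree U s s' → s'.reg 24 = i →
      s'.mem (U * 11 + i) = conv p x y i → eZ.val s' = z i) :
    Runs (Sem.ideal B) (.mul eX eY Z eZ) s (mulTime k) fun s' =>
      (∀ x, x < 20 ∨ 25 ≤ x → s'.reg x = s.reg x) ∧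
      ∀ j i, i < U → j ≠ 2 → j ≠ 10 → j ≠ 11 → j ≠ 12 →
        s'.mem (U * j + i) = if j = Z ∧ i < 2 ^ k then z i else s.mem (U * j + i) := by
  have : Fact p.Prime := ⟨h.prime⟩
  have : CharP (AlgebraicClosure (ZMod p)) p :=
    charP_of_injective_algebraMap (algebraMap (ZMod p) (AlgebraicClosure (ZMod p))).injective p
  exact Runs.mul_aux (AlgebraicClosure (ZMod p)) h x y z hx hy hz

end WordRAM

/-! ### Newton's iteration for reciprocals and for given logarithmic derivatives -/

namespace PowerSeries

variable {F : Type*} [CommRing F]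

/-- The Euler operator. -/
noncomputable def euler (f : F⟦X⟧) : F⟦X⟧ := X * derivative F f

theorem coeff_euler (f : F⟦X⟧) (n : ℕ) : coeff n (euler f) = n * coeff n f := by
  cases n with
  | zero => simp [euler]
  | succ n => rw [euler, coeff_succ_X_mul, coeff_derivative]; push_cast; ring

theorem euler_mul (f g : F⟦X⟧) : euler (f * g) = euler f * g + f * euler g := by
  simp only [euler, Derivation.leibniz, smul_eq_mul]; ring

theorem euler_sub (f g : F⟦X⟧) : euler (f - g) = euler f - euler g := by
  simp only [euler, map_sub, mul_sub]

theorem euler_add (f g : F⟦X⟧) : euler (f + g) = euler f + euler g := by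
  simp only [euler, map_add, mul_add]

theorem euler_one : euler (1 : F⟦X⟧) = 0 := by simp [euler]

/-- X d/dX multiplies the n-th coefficient by n, so unlike the derivative it loses no precision. -/
theorem X_pow_dvd_euler {f : F⟦X⟧} {n : ℕ} (h : X ^ n ∣ f) : X ^ n ∣ euler f := by
  rw [X_pow_dvd_iff] at h ⊢
  intro m hm
  rw [coeff_euler, h m hm, mul_zero]

/-- One step of Newton's iteration for the reciprocal. -/
theorem newton_inv {R : Type*} [CommRing R] {e e' M : ℕ} {f i j E : R⟦X⟧} (h : X ^ e ∣ i * f - 1)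
    (hE : X ^ M ∣ E - f * i)
    (hj : X ^ M ∣ j - (2 * i - i * E)) (h2 : e' ≤ 2 * e) (hM : e' ≤ M) : X ^ e' ∣ j * f - 1 := by
  -- With the exact values E = fi and j = 2i - iE the right side would be just -(if - 1)^2; the
  -- other two terms are truncation errors.
  have h1 : j * f - 1 = (j - (2 * i - i * E)) * f - i * f * (E - f * i) - (i * f - 1) ^ 2 := by ring
  have h3 : X ^ e' ∣ (i * f - 1) ^ 2 :=
    (pow_dvd_pow X h2).trans (by rw [mul_comm 2, pow_mul]; exact pow_dvd_pow_of_dvd h 2)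
  rw [h1]
  exact dvd_sub (dvd_sub (((pow_dvd_pow X hM).trans hj).mul_right _)
    (((pow_dvd_pow X hM).trans hE).mul_left _)) h3

/-- One step of Newton's iteration for a power series with given logarithmic derivative. -/
theorem newton_exp {F : Type*} [Field F] {m : ℕ} {f g i D H v g' : F⟦X⟧}
    (hf : X ^ (2 * m) ∣ euler f - H * f)
    (hg : X ^ m ∣ g - f) (hm : 0 < m) (hi : X ^ (2 * m) ∣ i * g - 1)
    (hD : X ^ (2 * m) ∣ D - euler g * i)
    (hv : ∀ n < 2 * m, coeff n v = (n : F)⁻¹ * (coeff n H - coeff n D))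
    (hchar : ∀ n, 0 < n → n < 2 * m → (n : F) ≠ 0)
    (hg' : X ^ (2 * m) ∣ g' - (g + g * v)) : X ^ (2 * m) ∣ g' - f := by
  -- To precision 2m, f = g(1 + W) with W of order at least m. Taking logarithmic derivatives gives
  -- H = D + (X dW/dX)/(1 + W), which is `h2` without the denominator.
  set W := (f - g) * i
  have hW : X ^ m ∣ W := ((dvd_sub_comm).1 hg).mul_right i
  have h1 : X ^ (2 * m) ∣ g * (1 + W) - f := by
    have : g * (1 + W) - f = (f - g) * (i * g - 1) := by simp only [W]; ring
    rw [this]; exact hi.mul_left _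
  have h2 : X ^ (2 * m) ∣ (H - D) * (1 + W) - euler W := by
    have h3 := X_pow_dvd_euler h1
    rw [euler_sub, euler_mul, euler_add, euler_one, zero_add] at h3
    have : (H - D) * (1 + W) - euler W =
        H * i * (g * (1 + W) - f) - i * (euler g * (1 + W) + g * euler W - euler f) -
        (D - euler g * i) * (1 + W) + (euler W - H * (1 + W)) * (i * g - 1) -
        i * (euler f - H * f) := by ring
    rw [this]
    exact dvd_sub (dvd_add (dvd_sub (dvd_sub (h1.mul_left _) (h3.mul_left _)) (hD.mul_right _))
      (hi.mul_left _)) (hf.mul_left _)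
  have h4 : X ^ m ∣ H - D := by
    have : H - D = ((H - D) * (1 + W) - euler W) + euler W - (H - D) * W := by ring
    rw [this]
    exact dvd_sub (dvd_add ((pow_dvd_pow X (by omega)).trans h2) (X_pow_dvd_euler hW))
      (hW.mul_left _)
  -- H - D and W both have order at least m, so their product is negligible. The equation becomes
  -- linear and can be solved coefficient by coefficient.
  have h5 : X ^ (2 * m) ∣ H - D - euler W := by
    have : H - D - euler W = ((H - D) * (1 + W) - euler W) - (H - D) * W := by ring
    rw [this]
    exact dvd_sub h2 (by rw [two_mul, pow_add]; exact mul_dvd_mul h4 hW)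
  have h6 : X ^ (2 * m) ∣ v - W := by
    rw [X_pow_dvd_iff] at h5 ⊢
    intro n hn
    have h7 := h5 n hn
    rw [map_sub, map_sub, coeff_euler, sub_eq_zero] at h7
    rw [map_sub, hv n hn, h7, sub_eq_zero]
    -- At index 0 the convention `0⁻¹ = 0` yields the right value, because W has no constant term.
    rcases Nat.eq_zero_or_pos n with rfl | h0
    · rw [Nat.cast_zero, inv_zero, zero_mul]
      exact ((X_pow_dvd_iff.1 hW) 0 hm).symm
    · rw [inv_mul_cancel_left₀ (hchar n h0 hn)]
  have : g' - f = (g' - (g + g * v)) + g * (v - W) + (g * (1 + W) - f) := by ring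
  rw [this]
  exact dvd_add (dvd_add hg' (h6.mul_left _)) h1

end PowerSeries

/-! ### Newton's iteration as a program -/

namespace WordRAM

open PowerSeries Finset.HasAntidiagonal

variable (p : ℕ)

/-- The power series with coefficients `a` modulo `p`. -/
noncomputable def ser (a : ℕ → ℕ) : (ZMod p)⟦X⟧ := PowerSeries.mk fun i => (a i : ZMod p)

@[simp] theorem coeff_ser (a : ℕ → ℕ) (i : ℕ) : coeff i (ser p a) = a i := coeff_mk _ _

theorem cast_conv (x y : ℕ → ℕ) (i : ℕ) :
    (conv p x y i : ZMod p) = coeff i (ser p x * ser p y) := by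
  rw [conv, ZMod.natCast_mod, coeff_mul]; simp

theorem X_pow_dvd_ser_sub {a : ℕ → ℕ} {f : (ZMod p)⟦X⟧} {M : ℕ}
    (h : ∀ i < M, (a i : ZMod p) = coeff i f) : X ^ M ∣ ser p a - f := by
  rw [X_pow_dvd_iff]
  intro i hi
  rw [map_sub, coeff_ser, h i hi, sub_self]

/-- One Newton step for the reciprocal of the series in region `6`, which is in region `7`. -/
def Prog.fixInv : Prog :=
  .seq (.mul (.cell 6 (.reg 24)) (.cell 7 (.reg 24)) 9 (.cell 11 (.reg 24)))
    (.mul (.cell 7 (.reg 24)) (.cell 9 (.reg 24)) 7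
      ((2 * .cell 7 (.reg 24) + (.reg 6 - 1) * .cell 11 (.reg 24)) % .reg 6))

/-- One Newton step for the series in region `6`, whose logarithmic derivative is in region `5`. -/
def Prog.newtonStep : Prog :=
  .seq (.assign 13 (.reg 13 + 1)) <|
  .seq (.assign 14 (2 * .reg 14)) <|
  .seq .fixInv <| .seq .fixInv <|
  .seq (.mul (.reg 24 * .cell 6 (.reg 24) % .reg 6) (.cell 7 (.reg 24)) 9
    (.cell 3 (.reg 24) * (.cell 5 (.reg 24) + (.reg 6 - 1) * .cell 11 (.reg 24)) % .reg 6)) <|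
  .mul (.cell 6 (.reg 24)) (.cell 9 (.reg 24)) 6 ((.cell 6 (.reg 24) + .cell 11 (.reg 24)) % .reg 6)

/-- Computes the power series with constant coefficient `1` and given logarithmic derivative. -/
def Prog.newton : Prog :=
  .seq (.assign 22 (.reg 4)) <|
  .seq (.rewrite 6 (.same (.reg 24) 0)) <|
  .seq (.rewrite 7 (.same (.reg 24) 0)) <|
  .seq (.assign 13 0) <|
  .seq (.assign 14 1) <|
  .loop (.less (.reg 13) (.reg 3)) .newtonStep

open Conv (arr)

theorem conv_lt {p : ℕ} (hp : 0 < p) (x y : ℕ → ℕ) (i : ℕ) : conv p x y i < p := Nat.mod_lt _ hp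

variable {p} {U B half k N : ℕ}

/-- Subtraction modulo p is programmed as addition of a multiple by p - 1, since machine subtraction
is truncated. -/
theorem cast_pred (hp : 0 < p) : ((p - 1 : ℕ) : ZMod p) = -1 := by
  rw [Nat.cast_sub hp]; simp

theorem runs_fixInv {s : St} (h : MulPre U B p half k s) (hN : 2 ^ k ≤ N) (hNU : N ≤ U)
    (hF : ∀ i < N, s.mem (U * 6 + i) < p) (hI : ∀ i < N, s.mem (U * 7 + i) < p) :
    Runs (Sem.ideal B) .fixInv s (2 * mulTime k + 1) fun s' =>
      (∀ x, x < 20 ∨ 25 ≤ x → s'.reg x = s.reg x) ∧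
      (∀ j i, i < U → j ≠ 2 → j ≠ 7 → j ≠ 9 → j ≠ 10 → j ≠ 11 → j ≠ 12 →
        s'.mem (U * j + i) = s.mem (U * j + i)) ∧ (∀ i < N, s'.mem (U * 7 + i) < p) ∧
      ∀ e e' f, X ^ e ∣ ser p (arr U s 7) * f - 1 →
        (∀ i < 2 ^ k, (s.mem (U * 6 + i) : ZMod p) = coeff i f) → e' ≤ 2 * e → e' ≤ 2 ^ k →
        X ^ e' ∣ ser p (arr U s' 7) * f - 1 := by
  have hp := h.prime.pos
  have hpB := h.p_lt
  refine .seq_of (mulTime k) (Runs.mul h (arr U s 6) (arr U s 7)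
    (conv p (arr U s 6) (arr U s 7)) (fun i hi => ⟨(hF i (by omega)).trans hpB, ?_⟩)
    (fun i hi => ⟨(hI i (by omega)).trans hpB, ?_⟩) fun i hi => ⟨(conv_lt hp _ _ _).trans hpB, ?_⟩)
    (by omega) fun s₁ ⟨hr₁, hm₁⟩ => ?_
  · intro s' hs' hi'
    simp only [Expr.val_cell, Expr.val_reg, hi', hs'.reg 9 (by omega), h.reg9, arr]
    exact hs'.mem _ _ (by omega) (by omega) (by omega) (by omega) (by omega)
  · intro s' hs' hi'
    simp only [Expr.val_cell, Expr.val_reg, hi', hs'.reg 9 (by omega), h.reg9, arr]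
    exact hs'.mem _ _ (by omega) (by omega) (by omega) (by omega) (by omega)
  · intro s' hs' hi' hc
    simp only [Expr.val_cell, Expr.val_reg, hi', hs'.reg 9 (by omega), h.reg9]
    exact hc
  have h' : MulPre U B p half k s₁ := by
    have := h.depth
    refine ⟨by rw [hr₁ _ (by omega), h.reg6], by rw [hr₁ _ (by omega), h.reg9],
      by rw [hr₁ _ (by omega), h.reg13], by rw [hr₁ _ (by omega), h.reg14],
      by rw [hr₁ _ (by omega), h.reg25], fun i hi => ?_, h.prime, h.half, h.p_lt, h.U_lt, h.size,
      h.depth⟩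
    rw [hm₁ _ _ (by omega) (by omega) (by omega) (by omega) (by omega), if_neg (by omega),
      h.pow i hi]
  have h7 : ∀ i < U, s₁.mem (U * 7 + i) = s.mem (U * 7 + i) := fun i hi => by
    rw [hm₁ _ _ hi (by omega) (by omega) (by omega) (by omega), if_neg (by omega)]
  have h9 : ∀ i < 2 ^ k, s₁.mem (U * 9 + i) = conv p (arr U s 6) (arr U s 7) i := fun i hi => by
    rw [hm₁ _ _ (by omega) (by omega) (by omega) (by omega) (by omega), if_pos ⟨rfl, hi⟩]
  refine (Runs.mul h' (arr U s 7) (arr U s₁ 9)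
    (fun i => (2 * arr U s 7 i + (p - 1) * conv p (arr U s 7) (arr U s₁ 9) i) % p)
    (fun i hi => ⟨(hI i (by omega)).trans hpB, ?_⟩)
    (fun i hi => ⟨by rw [arr, h9 i hi]; exact (conv_lt hp _ _ _).trans hpB, ?_⟩)
    fun i hi => ⟨(Nat.mod_lt _ hp).trans hpB, ?_⟩).mono le_rfl fun s₂ ⟨hr₂, hm₂⟩ =>
      ⟨fun x hx => by rw [hr₂ x hx, hr₁ x hx], fun j i hi h0 h1 h2 h3 h4 h5 => ?_, ?_, ?_⟩
  · intro s' hs' hi'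
    simp only [Expr.val_cell, Expr.val_reg, hi', hs'.reg 9 (by omega), h'.reg9, arr]
    rw [hs'.mem _ _ (by omega) (by omega) (by omega) (by omega) (by omega), h7 _ (by omega)]
  · intro s' hs' hi'
    simp only [Expr.val_cell, Expr.val_reg, hi', hs'.reg 9 (by omega), h'.reg9, arr]
    exact hs'.mem _ _ (by omega) (by omega) (by omega) (by omega) (by omega)
  · intro s' hs' hi' hc
    simp only [Expr.val_cell, Expr.val_reg, Expr.val_mod, Expr.val_add, Expr.val_mul, Expr.val_sub,
      Expr.val_ofNat, hi', hs'.reg 9 (by omega), h'.reg9, hs'.reg 6 (by omega), h'.reg6, hc, arr]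
    rw [hs'.mem _ _ (by omega) (by omega) (by omega) (by omega) (by omega), h7 _ (by omega)]
  · rw [hm₂ _ _ hi h0 h3 h4 h5, if_neg (by omega), hm₁ _ _ hi h0 h3 h4 h5, if_neg (by omega)]
  · intro i hi
    rw [hm₂ _ _ (by omega) (by omega) (by omega) (by omega) (by omega)]
    split_ifs
    · exact Nat.mod_lt _ hp
    · rw [h7 _ (by omega)]; exact hI i hi
  · intro e e' f he hf h2 hM
    refine newton_inv (M := 2 ^ k) (E := ser p (arr U s₁ 9)) he ?_ ?_ h2 hM
    · have h1 : X ^ 2 ^ k ∣ ser p (arr U s₁ 9) - ser p (arr U s 6) * ser p (arr U s 7) :=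
        X_pow_dvd_ser_sub p fun i hi => by rw [arr, h9 i hi, cast_conv]
      have h3 : X ^ 2 ^ k ∣ ser p (arr U s 6) - f := X_pow_dvd_ser_sub p fun i hi => hf i hi
      have h4 := dvd_add h1 (h3.mul_right (ser p (arr U s 7)))
      have h5 : ∀ a b c : (ZMod p)⟦X⟧, a - b * c + (b - f) * c = a - f * c :=
        fun a b c => by ring
      rw [h5] at h4
      exact h4
    · refine X_pow_dvd_ser_sub p fun i hi => ?_
      rw [arr, hm₂ _ _ (by omega) (by omega) (by omega) (by omega) (by omega), if_pos ⟨rfl, hi⟩,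
        ZMod.natCast_mod]
      push_cast
      rw [cast_pred hp, cast_conv, map_sub, show (2 : (ZMod p)⟦X⟧) = C 2 from rfl, coeff_C_mul,
        coeff_ser]
      ring

end WordRAM

namespace WordRAM

open PowerSeries Finset.HasAntidiagonal
open Conv (arr)

/-- The setting of Newton's iteration up to precision `2 ^ K`. -/
structure NewtonPre (U B p half K : ℕ) (s : St) : Prop where
  reg3 : s.reg 3 = K
  reg4 : s.reg 4 = 2 ^ K
  reg6 : s.reg 6 = p
  reg9 : s.reg 9 = U
  reg25 : s.reg 25 = half
  pow : ∀ i ≤ K + 1, s.mem (U * 14 + i) = 2 ^ i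
  prime : p.Prime
  half : half * 2 % p = 1
  p_lt : p < B
  U_lt : U < B
  size : 2 ^ (K + 1) * 2 ^ Nat.clog 2 (K + 1) ≤ U
  depth : 8 * (K + 1) ≤ U
  le_p : 2 ^ K ≤ p
  inv : ∀ i < 2 ^ K, (s.mem (U * 3 + i) : ZMod p) = (i : ZMod p)⁻¹

/-- Agreement of states except for what is used by Newton's iteration. -/
structure NewtonAgree (U : ℕ) (s s' : St) : Prop where
  reg : ∀ x, x < 13 ∨ 25 ≤ x → s'.reg x = s.reg x
  mem : ∀ j i, i < U → j ≠ 2 → j ≠ 6 → j ≠ 7 → j ≠ 9 → j ≠ 10 → j ≠ 11 → j ≠ 12 →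
    s'.mem (U * j + i) = s.mem (U * j + i)

theorem NewtonAgree.trans {U : ℕ} {s s' s'' : St} (h : NewtonAgree U s s')
    (h' : NewtonAgree U s' s'') : NewtonAgree U s s'' :=
  ⟨fun x hx => (h'.reg x hx).trans (h.reg x hx), fun j i hi h0 h1 h2 h3 h4 h5 h6 =>
    (h'.mem j i hi h0 h1 h2 h3 h4 h5 h6).trans (h.mem j i hi h0 h1 h2 h3 h4 h5 h6)⟩

variable {U B p half K k : ℕ}

theorem two_pow_le_size {U K : ℕ} (h : 2 ^ (K + 1) * 2 ^ Nat.clog 2 (K + 1) ≤ U) :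
    2 * 2 ^ K ≤ U := by
  rw [← pow_succ']; exact (Nat.le_mul_of_pos_right _ (by positivity)).trans h

theorem NewtonPre.agree {s s' : St} (h : NewtonPre U B p half K s) (hs : NewtonAgree U s s') :
    NewtonPre U B p half K s' := by
  have h1 := h.depth
  have h2 := two_pow_le_size h.size
  refine ⟨by rw [hs.reg _ (by omega), h.reg3], by rw [hs.reg _ (by omega), h.reg4],
    by rw [hs.reg _ (by omega), h.reg6], by rw [hs.reg _ (by omega), h.reg9],
    by rw [hs.reg _ (by omega), h.reg25], fun i hi => ?_, h.prime, h.half, h.p_lt, h.U_lt, h.size,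
    h.depth, h.le_p, fun i hi => ?_⟩
  · rw [hs.mem _ _ (by omega) (by omega) (by omega) (by omega) (by omega) (by omega) (by omega)
      (by omega), h.pow i hi]
  · rw [hs.mem _ _ (by omega) (by omega) (by omega) (by omega) (by omega) (by omega) (by omega)
      (by omega), h.inv i hi]

theorem NewtonPre.mulPre {s : St} (h : NewtonPre U B p half K s) (hk : k ≤ K) (h13 : s.reg 13 = k)
    (h14 : s.reg 14 = 2 ^ k) : MulPre U B p half k s := by
  have h1 := h.depth
  refine ⟨h.reg6, h.reg9, h13, h14, h.reg25, fun i hi => h.pow i (by omega), h.prime, h.half,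
    h.p_lt, h.U_lt, le_trans ?_ h.size, by omega⟩
  exact Nat.mul_le_mul (Nat.pow_le_pow_right (by omega) (by omega))
    (Nat.pow_le_pow_right (by omega) (Nat.clog_mono_right 2 (by omega)))

theorem NewtonPre.natCast_ne_zero {s : St} (h : NewtonPre U B p half K s) {n : ℕ} (h0 : 0 < n)
    (hn : n < 2 ^ K) : (n : ZMod p) ≠ 0 := by
  rw [Ne, ZMod.natCast_eq_zero_iff]
  exact Nat.not_dvd_of_pos_of_lt h0 (hn.trans_le h.le_p)

/-- What holds after `k` steps of Newton's iteration for the series `f`. -/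
structure NewtonInv (U p K : ℕ) (f : (ZMod p)⟦X⟧) (k : ℕ) (s : St) : Prop where
  reg13 : s.reg 13 = k
  reg14 : s.reg 14 = 2 ^ k
  six_lt : ∀ i < 2 ^ K, s.mem (U * 6 + i) < p
  seven_lt : ∀ i < 2 ^ K, s.mem (U * 7 + i) < p
  six : X ^ 2 ^ k ∣ ser p (arr U s 6) - f
  seven : ∃ e ≤ 2 ^ k, 2 ^ k ≤ 2 * e ∧ X ^ e ∣ ser p (arr U s 7) * f - 1

/-- The reciprocal lags behind by one doubling: at the start it is valid to about half of the
precision 2^k. The first call of `fixInv` makes it a reciprocal of the present approximation g to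
precision 2^k, the second to 2^{k+1}, as `newton_exp` requires. After g has been improved, it
inverts f only to precision 2^k again, since it was computed for the old g. -/
theorem runs_newtonStep {s : St} {f : (ZMod p)⟦X⟧} (h : NewtonPre U B p half K s) (hk : k < K)
    (hf : X ^ 2 ^ K ∣ euler f - ser p (arr U s 5) * f) (hI : NewtonInv U p K f k s) :
    Runs (Sem.ideal B) .newtonStep s (6 * mulTime (k + 1) + 9) fun s' =>
      NewtonAgree U s s' ∧ NewtonInv U p K f (k + 1) s' := by
  have : Fact p.Prime := ⟨h.prime⟩
  have hp := h.prime.pos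
  have hpB := h.p_lt
  have hUB := h.U_lt
  have hd := h.depth
  have hU := two_pow_le_size h.size
  have h2 : 2 ^ (k + 1) ≤ 2 ^ K := Nat.pow_le_pow_right (by omega) hk
  have hk2 : 2 ^ (k + 1) = 2 * 2 ^ k := pow_succ' 2 k
  have hkU : k < U := by omega
  unfold Prog.newtonStep
  refine Runs.mono_time (T₁ := (6 * mulTime (k + 1) + 5) + 2 + 2) ?_ (by omega)
  refine .assign_seq (k + 1) (by simp [hI.reg13]) (by omega) ?_
  refine .assign_seq (2 ^ (k + 1)) (by simp [hI.reg14, hk2]) (by omega) ?_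
  set s₀ := (s.setReg 13 (k + 1)).setReg 14 (2 ^ (k + 1)) with hs₀
  have g₀ : NewtonAgree U s s₀ := by
    refine ⟨fun x hx => ?_, fun _ _ _ _ _ _ _ _ _ _ => by simp [hs₀]⟩
    simp only [hs₀, St.setReg_reg]; rw [if_neg (by omega), if_neg (by omega)]
  have m₀ : s₀.mem = s.mem := rfl
  have M₀ : MulPre U B p half (k + 1) s₀ := (h.agree g₀).mulPre hk (by simp [hs₀]) (by simp [hs₀])
  refine .seq_of (4 * mulTime (k + 1) + 3) (runs_fixInv M₀ h2 (by omega) hI.six_lt hI.seven_lt)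
    (by omega) fun s₁ ⟨hr₁, hm₁, hlt₁, hd₁⟩ => ?_
  have g₁ : NewtonAgree U s₀ s₁ := ⟨fun x hx => hr₁ x (by omega),
    fun j i hi h0 h1 h2 h3 h4 h5 h6 => hm₁ j i hi h0 h2 h3 h4 h5 h6⟩
  have M₁ : MulPre U B p half (k + 1) s₁ := (h.agree (g₀.trans g₁)).mulPre hk
    (by rw [hr₁ _ (by omega), M₀.reg13]) (by rw [hr₁ _ (by omega), M₀.reg14])
  have e₁ : ∀ i < U, s₁.mem (U * 6 + i) = s.mem (U * 6 + i) := fun i hi =>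
    hm₁ _ _ hi (by omega) (by omega) (by omega) (by omega) (by omega) (by omega)
  refine .seq_of (2 * mulTime (k + 1) + 1) (runs_fixInv M₁ h2 (by omega)
    (fun i hi => by rw [e₁ i (by omega)]; exact hI.six_lt i hi) hlt₁) (by omega)
    fun s₂ ⟨hr₂, hm₂, hlt₂, hd₂⟩ => ?_
  have g₂ : NewtonAgree U s₁ s₂ := ⟨fun x hx => hr₂ x (by omega),
    fun j i hi h0 h1 h2 h3 h4 h5 h6 => hm₂ j i hi h0 h2 h3 h4 h5 h6⟩
  have G₂ := (g₀.trans g₁).trans g₂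
  have P₂ := h.agree G₂
  have M₂ : MulPre U B p half (k + 1) s₂ := P₂.mulPre hk
    (by rw [hr₂ _ (by omega), M₁.reg13]) (by rw [hr₂ _ (by omega), M₁.reg14])
  have e₂ : ∀ i < U, s₂.mem (U * 6 + i) = s.mem (U * 6 + i) := fun i hi => by
    rw [hm₂ _ _ hi (by omega) (by omega) (by omega) (by omega) (by omega) (by omega), e₁ i hi]
  have e₂5 : ∀ i < U, s₂.mem (U * 5 + i) = s.mem (U * 5 + i) := fun i hi => by
    rw [G₂.mem _ _ hi (by omega) (by omega) (by omega) (by omega) (by omega) (by omega) (by omega)]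
  -- the reciprocal
  set g := ser p (arr U s 6) with hg
  have hinv : X ^ (2 ^ (k + 1)) ∣ ser p (arr U s₂ 7) * g - 1 := by
    obtain ⟨e, he, he2, hdvd⟩ := hI.seven
    have h1 : X ^ e ∣ ser p (arr U s₀ 7) * g - 1 := by
      have : ser p (arr U s₀ 7) * g - 1 =
          ser p (arr U s 7) * (g - f) + (ser p (arr U s 7) * f - 1) := by
        rw [show arr U s₀ 7 = arr U s 7 from rfl]; ring
      rw [this]
      exact dvd_add (((pow_dvd_pow X he).trans hI.six).mul_left _) hdvd
    have h3 := hd₁ e (2 ^ k) g h1 (fun i hi => by rw [m₀, hg, coeff_ser]; rfl) he2 (by omega)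
    exact hd₂ (2 ^ k) (2 ^ (k + 1)) g h3
      (fun i hi => by rw [e₁ i (by omega), hg, coeff_ser]; rfl) (by omega) le_rfl
  -- the logarithmic derivative and its deviation
  let x : ℕ → ℕ := fun i => i * s.mem (U * 6 + i) % p
  let D := conv p x (arr U s₂ 7)
  refine .seq_of (mulTime (k + 1)) (Runs.mul (Z := 9) M₂ x (arr U s₂ 7)
    (fun i => s.mem (U * 3 + i) * (s.mem (U * 5 + i) + (p - 1) * D i) % p)
    (fun i hi => ⟨(Nat.mod_lt _ hp).trans hpB, ?_⟩)
    (fun i hi => ⟨(hlt₂ i (by omega)).trans hpB, ?_⟩)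
    fun i hi => ⟨(Nat.mod_lt _ hp).trans hpB, ?_⟩) (by omega) fun s₃ ⟨hr₃, hm₃⟩ => ?_
  · intro s' hs' hi'
    simp only [Expr.val_cell, Expr.val_reg, Expr.val_mod, Expr.val_mul, hi', hs'.reg 9 (by omega),
      hs'.reg 6 (by omega), M₂.reg9, M₂.reg6]
    rw [hs'.mem _ _ (by omega) (by omega) (by omega) (by omega) (by omega), e₂ i (by omega)]
  · intro s' hs' hi'
    simp only [Expr.val_cell, Expr.val_reg, hi', hs'.reg 9 (by omega), M₂.reg9, arr]
    exact hs'.mem _ _ (by omega) (by omega) (by omega) (by omega) (by omega)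
  · intro s' hs' hi' hc
    simp only [Expr.val_cell, Expr.val_reg, Expr.val_mod, Expr.val_add, Expr.val_mul, Expr.val_sub,
      Expr.val_one, hi', hs'.reg 9 (by omega), hs'.reg 6 (by omega), M₂.reg9, M₂.reg6, hc]
    rw [hs'.mem _ _ (by omega) (by omega) (by omega) (by omega) (by omega),
      hs'.mem _ _ (by omega) (by omega) (by omega) (by omega) (by omega), e₂5 i (by omega),
      G₂.mem _ _ (by omega) (by omega) (by omega) (by omega) (by omega) (by omega) (by omega)
        (by omega)]
  have g₃ : NewtonAgree U s₂ s₃ := ⟨fun x hx => hr₃ x (by omega),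
    fun j i hi h0 h1 h2 h3 h4 h5 h6 => by rw [hm₃ j i hi h0 h4 h5 h6, if_neg (by omega)]⟩
  have G₃ := G₂.trans g₃
  have M₃ : MulPre U B p half (k + 1) s₃ := (h.agree G₃).mulPre hk
    (by rw [hr₃ _ (by omega), M₂.reg13]) (by rw [hr₃ _ (by omega), M₂.reg14])
  have e₃ : ∀ j i, i < U → j = 6 ∨ j = 7 → s₃.mem (U * j + i) = s₂.mem (U * j + i) :=
    fun j i hi hj => by
      rw [hm₃ _ _ hi (by omega) (by omega) (by omega) (by omega), if_neg (by omega)]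
  have e₃9 : ∀ i < 2 ^ (k + 1), s₃.mem (U * 9 + i) =
      s.mem (U * 3 + i) * (s.mem (U * 5 + i) + (p - 1) * D i) % p := fun i hi => by
    rw [hm₃ _ _ (by omega) (by omega) (by omega) (by omega) (by omega), if_pos ⟨rfl, hi⟩]
  refine (Runs.mul (Z := 6) M₃ (arr U s 6) (arr U s₃ 9)
    (fun i => (s.mem (U * 6 + i) + conv p (arr U s 6) (arr U s₃ 9) i) % p)
    (fun i hi => ⟨(hI.six_lt i (by omega)).trans hpB, ?_⟩)
    (fun i hi => ⟨by rw [arr, e₃9 i hi]; exact (Nat.mod_lt _ hp).trans hpB, ?_⟩)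
    fun i hi => ⟨(Nat.mod_lt _ hp).trans hpB, ?_⟩).mono le_rfl fun s₄ ⟨hr₄, hm₄⟩ => ?_
  · intro s' hs' hi'
    simp only [Expr.val_cell, Expr.val_reg, hi', hs'.reg 9 (by omega), M₃.reg9, arr]
    rw [hs'.mem _ _ (by omega) (by omega) (by omega) (by omega) (by omega), e₃ 6 _ (by omega)
      (by omega), e₂ i (by omega)]
  · intro s' hs' hi'
    simp only [Expr.val_cell, Expr.val_reg, hi', hs'.reg 9 (by omega), M₃.reg9, arr]
    rw [hs'.mem _ _ (by omega) (by omega) (by omega) (by omega) (by omega)]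
  · intro s' hs' hi' hc
    simp only [Expr.val_cell, Expr.val_reg, Expr.val_mod, Expr.val_add, hi',
      hs'.reg 9 (by omega), hs'.reg 6 (by omega), M₃.reg9, M₃.reg6, hc]
    rw [hs'.mem _ _ (by omega) (by omega) (by omega) (by omega) (by omega), e₃ 6 _ (by omega)
      (by omega), e₂ i (by omega)]
  have e₄ : ∀ i < U, s₄.mem (U * 7 + i) = s₂.mem (U * 7 + i) := fun i hi => by
    rw [hm₄ _ _ hi (by omega) (by omega) (by omega) (by omega), if_neg (by omega),
      e₃ 7 i hi (by omega)]
  have hsix : X ^ (2 ^ (k + 1)) ∣ ser p (arr U s₄ 6) - f := by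
    rw [hk2] at hinv h2 ⊢
    refine newton_exp (i := ser p (arr U s₂ 7)) (D := ser p D) (H := ser p (arr U s 5))
      (v := ser p (arr U s₃ 9)) ((pow_dvd_pow X h2).trans hf) hI.six (by positivity) hinv
      ?_ ?_ (fun n h0 hn => h.natCast_ne_zero h0 (by omega)) ?_
    · refine X_pow_dvd_ser_sub p fun i hi => ?_
      rw [cast_conv]
      congr 2
      ext j
      rw [coeff_ser, coeff_euler, coeff_ser, ZMod.natCast_mod, Nat.cast_mul]; rfl
    · intro n hn
      rw [coeff_ser, coeff_ser, coeff_ser, arr, e₃9 n (by omega), ZMod.natCast_mod, Nat.cast_mul,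
        h.inv n (by omega), Nat.cast_add, Nat.cast_mul, cast_pred hp]
      simp only [arr]; ring
    · refine X_pow_dvd_ser_sub p fun i hi => ?_
      rw [arr, hm₄ _ _ (by omega) (by omega) (by omega) (by omega) (by omega),
        if_pos ⟨rfl, by omega⟩, ZMod.natCast_mod, Nat.cast_add, cast_conv, map_add]
      rw [coeff_ser]; rfl
  refine ⟨G₃.trans ⟨fun x hx => hr₄ x (by omega), fun j i hi h0 h1 h2 h3 h4 h5 h6 => by
    rw [hm₄ j i hi h0 h4 h5 h6, if_neg (by omega)]⟩, ?_, ?_, fun i hi => ?_, fun i hi => ?_, hsix,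
    2 ^ k, by omega, by omega, ?_⟩
  · rw [hr₄ _ (by omega), M₃.reg13]
  · rw [hr₄ _ (by omega), M₃.reg14]
  · rw [hm₄ _ _ (by omega) (by omega) (by omega) (by omega) (by omega)]
    split_ifs
    · exact Nat.mod_lt _ hp
    · rw [e₃ 6 _ (by omega) (by omega), e₂ _ (by omega)]; exact hI.six_lt i hi
  · rw [e₄ _ (by omega)]; exact hlt₂ i hi
  · have h1 : X ^ 2 ^ k ∣ ser p (arr U s₄ 7) - ser p (arr U s₂ 7) :=
      X_pow_dvd_ser_sub p fun i hi => by rw [arr, e₄ i (by omega), coeff_ser]; rfl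
    have h3 : ser p (arr U s₄ 7) * f - 1 = (ser p (arr U s₄ 7) - ser p (arr U s₂ 7)) * f -
      ser p (arr U s₂ 7) * (g - f) + (ser p (arr U s₂ 7) * g - 1) := by ring
    rw [h3]
    exact dvd_add (dvd_sub (h1.mul_right _) (hI.six.mul_left _))
      ((pow_dvd_pow X (by omega)).trans hinv)

/-- The time for Newton's iteration up to precision `2 ^ K`. -/
def newtonTime (K : ℕ) : ℕ := (24 * Conv.rate (K + 1) + 1250) * 2 ^ K

theorem rate_mono {a b : ℕ} (h : a ≤ b) : Conv.rate a ≤ Conv.rate b := by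
  have h1 := Nat.clog_mono_right 2 h
  have h2 := Nat.pow_le_pow_right (n := 2) (by omega) h1
  have h3 : (a - 1) * Nat.clog 2 a ≤ (b - 1) * Nat.clog 2 b := Nat.mul_le_mul (by omega) h1
  unfold Conv.rate
  omega

theorem runs_newton {s : St} {f : (ZMod p)⟦X⟧} (h : NewtonPre U B p half K s)
    (hf : X ^ 2 ^ K ∣ euler f - ser p (arr U s 5) * f) (hf0 : coeff 0 f = 1) :
    Runs (Sem.ideal B) .newton s (newtonTime K) fun s' =>
      NewtonAgree U s s' ∧ ∀ i < 2 ^ K, (s'.mem (U * 6 + i) : ZMod p) = coeff i f ∧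
        s'.mem (U * 6 + i) < p := by
  have : Fact p.Prime := ⟨h.prime⟩
  have hp1 := h.prime.one_lt
  have hpB := h.p_lt
  have hUB := h.U_lt
  have hU := two_pow_le_size h.size
  have hd := h.depth
  have hK0 : 0 < 2 ^ K := by positivity
  unfold Prog.newton
  -- The precision doubles in each round, so the costs are dominated by a geometric progression and
  -- the last round determines the order of magnitude.
  have hloop : ∀ k ≤ K, ∑ i ∈ Finset.range k, (6 * mulTime (i + 1) + 10) ≤
      (24 * Conv.rate (K + 1) + 1210) * 2 ^ k := by
    intro k hk
    induction k with
    | zero => simp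
    | succ k ih =>
        rw [Finset.sum_range_succ]
        have h1 := ih (by omega)
        have h2 : mulTime (k + 1) ≤ (2 * Conv.rate (K + 1) + 100) * 2 ^ (k + 1) :=
          Nat.mul_le_mul_right _ (by have := rate_mono (show k + 1 + 1 ≤ K + 1 by omega); omega)
        have h3 : 0 < 2 ^ k := by positivity
        calc _ ≤ (24 * Conv.rate (K + 1) + 1210) * 2 ^ k +
              (6 * ((2 * Conv.rate (K + 1) + 100) * 2 ^ (k + 1)) + 10 * 2 ^ k) := by omega
          _ = (24 * Conv.rate (K + 1) + 1210) * 2 ^ (k + 1) := by ring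
  refine Runs.mono_time
    (T₁ := (((∑ i ∈ Finset.range K, (6 * mulTime (i + 1) + 9 + 1) + 1) + 2 + 2) +
    (8 * 2 ^ K + 7) + 1 + (8 * 2 ^ K + 7) + 1) + 2) ?_ ?_
  · refine .assign_seq (2 ^ K) (by simp [h.reg4]) (by omega) ?_
    have g₀ : NewtonAgree U s (s.setReg 22 (2 ^ K)) :=
      ⟨fun x hx => by rw [St.setReg_reg, if_neg (by omega)], fun _ _ _ _ _ _ _ _ _ _ => rfl⟩
    refine .seq_of (((∑ i ∈ Finset.range K, (6 * mulTime (i + 1) + 9 + 1) + 1) + 2 + 2) +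
      (8 * 2 ^ K + 7) + 1) (Runs.rewrite (S := 2 ^ K) (U := U) (fun i => if i = 0 then 1 else 0)
      (by simp [h.reg9]) (by simp) (by omega) (by omega) fun i hi m' hm' => ⟨by simp, ?_⟩)
      (by omega) fun s₁ ⟨hr₁, hm₁⟩ => ?_
    · split_ifs <;> omega
    have g₁ := g₀.trans ⟨fun x hx => hr₁ x (by omega),
      fun j i hi h0 h1 h2 h3 h4 h5 h6 => by rw [hm₁ j i hi h4, if_neg (by omega)]⟩
    refine .seq_of ((∑ i ∈ Finset.range K, (6 * mulTime (i + 1) + 9 + 1) + 1) + 2 + 2)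
      (Runs.rewrite (S := 2 ^ K) (U := U) (fun i => if i = 0 then 1 else 0)
      (by rw [g₁.reg _ (by omega), h.reg9]) (by rw [hr₁ _ (by omega)]; simp) (by omega) (by omega)
      fun i hi m' hm' => ⟨by simp, ?_⟩) (by omega) fun s₂ ⟨hr₂, hm₂⟩ => ?_
    · split_ifs <;> omega
    have g₂ := g₁.trans ⟨fun x hx => hr₂ x (by omega),
      fun j i hi h0 h1 h2 h3 h4 h5 h6 => by rw [hm₂ j i hi h4, if_neg (by omega)]⟩
    refine .assign_seq 0 (by simp) (by omega) (.assign_seq 1 (by simp) (by omega) ?_)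
    set s₃ := (s₂.setReg 13 0).setReg 14 1 with hs₃
    have g₃ : NewtonAgree U s s₃ := g₂.trans ⟨fun x hx => by
      simp only [hs₃, St.setReg_reg]; rw [if_neg (by omega), if_neg (by omega)],
      fun _ _ _ _ _ _ _ _ _ _ => rfl⟩
    have h6 : ∀ i < 2 ^ K, s₃.mem (U * 6 + i) = if i = 0 then 1 else 0 := fun i hi => by
      rw [hs₃, St.setReg_mem, St.setReg_mem, hm₂ _ _ (by omega) (by omega), if_neg (by omega),
        hm₁ _ _ (by omega) (by omega), if_pos ⟨rfl, hi⟩]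
    have h7 : ∀ i < 2 ^ K, s₃.mem (U * 7 + i) = if i = 0 then 1 else 0 := fun i hi => by
      rw [hs₃, St.setReg_mem, St.setReg_mem, hm₂ _ _ (by omega) (by omega), if_pos ⟨rfl, hi⟩]
    refine Runs.loop (fun k s' => k ≤ K ∧ NewtonAgree U s s' ∧ NewtonInv U p K f k s') K
      (fun i => 6 * mulTime (i + 1) + 9) ⟨by omega, g₃, ?_⟩ ?_ ?_
    -- The series 1 is correct to precision 1, both for f and for its reciprocal, because f has
    -- constant coefficient 1.
    · refine ⟨by simp [hs₃], by simp [hs₃], fun i hi => ?_, fun i hi => ?_, ?_, 1, le_rfl,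
        by omega, ?_⟩
      · rw [h6 i hi]; split_ifs <;> omega
      · rw [h7 i hi]; split_ifs <;> omega
      · refine X_pow_dvd_ser_sub p fun i hi => ?_
        obtain rfl : i = 0 := by omega
        rw [arr, h6 0 hK0, hf0]; simp
      · rw [X_pow_dvd_iff]
        intro i hi
        obtain rfl : i = 0 := by omega
        rw [map_sub, coeff_mul]
        simpa [arr, hf0, sub_eq_zero] using congrArg (Nat.cast (R := ZMod p)) (h7 0 hK0)
    · rintro k hk s' ⟨-, ha, hI⟩
      refine ⟨by simp [Sem.ideal, hI.reg13, (h.agree ha).reg3, hk], ?_⟩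
      have e5 : ∀ i < 2 ^ K, s'.mem (U * 5 + i) = s.mem (U * 5 + i) := fun i hi =>
        ha.mem _ _ (by omega) (by omega) (by omega) (by omega) (by omega) (by omega) (by omega)
          (by omega)
      refine (runs_newtonStep (h.agree ha) hk ?_
        hI).mono le_rfl fun s'' ⟨h1, h2⟩ => ⟨hk, ha.trans h1, h2⟩
      have : X ^ 2 ^ K ∣ ser p (arr U s' 5) - ser p (arr U s 5) :=
        X_pow_dvd_ser_sub p fun i hi => by rw [arr, e5 i hi, coeff_ser]; rfl
      have h3 : euler f - ser p (arr U s' 5) * f = euler f - ser p (arr U s 5) * f -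
        (ser p (arr U s' 5) - ser p (arr U s 5)) * f := by ring
      rw [h3]
      exact dvd_sub hf (this.mul_right _)
    · rintro s' ⟨-, ha, hI⟩
      refine ⟨by simp [Sem.ideal, hI.reg13, (h.agree ha).reg3], ha, fun i hi =>
        ⟨?_, hI.six_lt i hi⟩⟩
      have := X_pow_dvd_iff.1 hI.six i hi
      rw [map_sub, coeff_ser, sub_eq_zero] at this
      exact this
  · have := hloop K le_rfl
    have h2 : newtonTime K = (24 * Conv.rate (K + 1) + 1210) * 2 ^ K + 40 * 2 ^ K := by
      rw [newtonTime]; ring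
    rw [h2]
    simp only [add_assoc, Nat.reduceAdd] at this ⊢
    omega

end WordRAM

/-! ### The weighted generating function of the subset sums and its random coefficients -/

namespace SubsetSumSeries

open PowerSeries Finset

section Euler

variable {R : Type*} [CommRing R]

theorem euler_pow {f h : R⟦X⟧} (hf : euler f = h * f) (n : ℕ) :
    euler (f ^ n) = n * h * f ^ n := by
  induction n with
  | zero => simp [euler_one]
  | succ n ih => rw [pow_succ, euler_mul, ih, hf]; push_cast; ring

theorem euler_prod {ι : Type*} (s : Finset ι) {f h : ι → R⟦X⟧}
    (hf : ∀ i ∈ s, euler (f i) = h i * f i) :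
    euler (∏ i ∈ s, f i) = (∑ i ∈ s, h i) * ∏ i ∈ s, f i := by
  classical
  induction s using Finset.induction_on with
  | empty => simp [euler_one]
  | insert a s ha ih =>
      rw [prod_insert ha, sum_insert ha, euler_mul, ih fun i hi => hf i (mem_insert_of_mem hi),
        hf a (mem_insert_self a s)]
      ring

/-- The logarithmic derivative of `1 + r X ^ v`. -/
noncomputable def logDeriv (v : ℕ) (r : R) : R⟦X⟧ :=
  PowerSeries.mk fun j => if j ≠ 0 ∧ v ∣ j then v * r * (-r) ^ (j / v - 1) else 0

/-- The quotient v r X^v / (1 + r X^v) is a geometric series with ratio -r X^v. After multiplication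
by the denominator the coefficients at j and j - v cancel, except for j = v. -/
theorem euler_one_add {v : ℕ} (hv : 0 < v) (r : R) :
    euler (1 + C r * X ^ v) = logDeriv v r * (1 + C r * X ^ v) := by
  ext j
  have h1 : logDeriv v r * (1 + C r * X ^ v) = logDeriv v r + C r * (logDeriv v r * X ^ v) := by
    ring
  rw [h1, coeff_euler, map_add, map_add, coeff_C_mul, coeff_C_mul, coeff_X_pow, coeff_mul_X_pow',
    coeff_one, logDeriv, coeff_mk, coeff_mk]
  rcases Nat.eq_zero_or_pos j with rfl | hj
  · simp [hv.ne']
  rw [if_neg hj.ne', zero_add]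
  by_cases hd : v ∣ j
  · obtain ⟨c, rfl⟩ := hd
    have hc : 0 < c := Nat.pos_of_mul_pos_left hj
    rw [if_pos (show v * c ≠ 0 ∧ v ∣ v * c from ⟨hj.ne', dvd_mul_right v c⟩),
      if_pos (Nat.le_mul_of_pos_right v hc), Nat.mul_div_cancel_left _ hv]
    obtain ⟨d, rfl⟩ : ∃ d, c = d + 1 := ⟨c - 1, by omega⟩
    rcases Nat.eq_zero_or_pos d with rfl | hd
    · simp
    · have h2 : v * (d + 1) - v = v * d := by rw [mul_add, mul_one, Nat.add_sub_cancel]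
      have h3 : v * d ≠ 0 := (Nat.mul_pos hv hd).ne'
      have h4 : v * (d + 1) ≠ v := by rw [mul_add]; omega
      rw [if_neg h4, h2, if_pos (show v * d ≠ 0 ∧ v ∣ v * d from ⟨h3, dvd_mul_right v d⟩),
        Nat.mul_div_cancel_left _ hv]
      obtain ⟨e, rfl⟩ : ∃ e, d = e + 1 := ⟨d - 1, by omega⟩
      simp only [Nat.add_sub_cancel, pow_succ]
      ring
  · rw [if_neg (by rintro rfl; exact hd dvd_rfl), if_neg (by tauto)]
    split_ifs with h2 h3
    · exact absurd ((Nat.dvd_sub_iff_left h2 dvd_rfl).1 h3.2) hd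
    · simp
    · simp

variable (t : ℕ) (μ : ℕ → ℕ) (r : ℕ → R)

/-- The generating function of the sums, with weights. -/
noncomputable def gen : R⟦X⟧ := ∏ v : Fin (t + 1), (1 + C (r v) * X ^ (v : ℕ)) ^ μ v

/-- The logarithmic derivative of the generating function. -/
noncomputable def genLog : R⟦X⟧ := ∑ v : Fin (t + 1), (μ v : R⟦X⟧) * logDeriv v (r v)

theorem euler_gen (h0 : μ 0 = 0) : euler (gen t μ r) = genLog t μ r * gen t μ r := by
  refine euler_prod _ fun v _ => ?_
  rcases Nat.eq_zero_or_pos (v : ℕ) with hv | hv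
  · rw [hv, h0]; simp [euler_one]
  · exact euler_pow (euler_one_add hv _) _

theorem coeff_genLog (j : ℕ) : coeff j (genLog t μ r) =
    ∑ v : Fin (t + 1), if j ≠ 0 ∧ (v : ℕ) ∣ j then μ v * v * r v * (-r v) ^ (j / v - 1) else 0 := by
  rw [genLog, map_sum]
  refine sum_congr rfl fun v _ => ?_
  rw [← map_natCast (C (R := R)), coeff_C_mul, logDeriv, coeff_mk]
  split_ifs <;> ring

/-- The multiplicities of the numbers that are chosen. -/
def choices : Finset (Fin (t + 1) → ℕ) := Fintype.piFinset fun v => range (μ v + 1)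

theorem gen_eq_sum : gen t μ r = ∑ c ∈ choices t μ,
    C (∏ v : Fin (t + 1), (((μ v).choose (c v) : ℕ) : R) * r v ^ c v) * X ^
      (∑ v : Fin (t + 1), (v : ℕ) * c v) := by
  rw [gen, choices]
  have : ∀ v : Fin (t + 1), (1 + C (r v) * X ^ (v : ℕ) : R⟦X⟧) ^ μ v =
      ∑ c ∈ range (μ v + 1), C ((((μ v).choose c : ℕ) : R) * r v ^ c) * X ^ ((v : ℕ) * c) := by
    intro v
    rw [add_comm, add_pow]
    refine sum_congr rfl fun c _ => ?_
    rw [mul_pow, one_pow, map_mul, map_pow, map_natCast, ← pow_mul]; ring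
  rw [prod_congr rfl fun v _ => this v, prod_univ_sum]
  refine sum_congr rfl fun c _ => ?_
  rw [prod_mul_distrib, map_prod, prod_pow_eq_pow_sum]

theorem coeff_gen (s : ℕ) : coeff s (gen t μ r) = ∑ c ∈ choices t μ,
    if ∑ v : Fin (t + 1), (v : ℕ) * c v = s then ∏ v : Fin (t + 1),
      (((μ v).choose (c v) : ℕ) : R) * r v ^ c v else 0 := by
  rw [gen_eq_sum, map_sum]
  refine sum_congr rfl fun c _ => ?_
  rw [coeff_C_mul, coeff_X_pow]
  simp only [eq_comm, mul_ite, mul_one, mul_zero]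

theorem coeff_zero_gen (h0 : μ 0 = 0) : coeff 0 (gen t μ r) = 1 := by
  rw [gen, coeff_zero_eq_constantCoeff, map_prod]
  refine prod_eq_one fun v _ => ?_
  rcases Nat.eq_zero_or_pos (v : ℕ) with hv | hv
  · rw [hv, h0, pow_zero, map_one]
  · simp [hv.ne']

/-- The direction without error: it holds whatever the weights are. -/
theorem exists_choice_of_coeff_ne_zero {s : ℕ} (h : coeff s (gen t μ r) ≠ 0) :
    ∃ c ∈ choices t μ, ∑ v : Fin (t + 1), (v : ℕ) * c v = s := by
  rw [coeff_gen] at h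
  obtain ⟨c, hc, h⟩ := exists_ne_zero_of_sum_ne_zero h
  exact ⟨c, hc, by by_contra h'; exact h (if_neg h')⟩

end Euler

section Random

variable (p t : ℕ) [Fact p.Prime] (μ : ℕ → ℕ) (s : ℕ)

/-- The coefficient of the generating function as a polynomial in the weights. -/
noncomputable def coeffPoly : MvPolynomial (Fin (t + 1)) (ZMod p) := ∑ c ∈ choices t μ,
  if ∑ v : Fin (t + 1), (v : ℕ) * c v = s then
    MvPolynomial.monomial (Finsupp.equivFunOnFinite.symm c)
      (∏ v : Fin (t + 1), (((μ v).choose (c v) : ℕ) : ZMod p))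
  else 0

theorem eval_coeffPoly (r : ℕ → ZMod p) :
    MvPolynomial.eval (fun v : Fin (t + 1) => r v) (coeffPoly p t μ s) = coeff s (gen t μ r) := by
  rw [coeff_gen, coeffPoly, map_sum]
  refine sum_congr rfl fun c _ => ?_
  split_ifs
  · rw [MvPolynomial.eval_monomial, prod_mul_distrib, Finsupp.prod_fintype _ _ (by simp)]; simp
  · simp

/-- The degree of the monomial of c is ∑ c_v, and every v that occurs is at least 1, so ∑ c_v ≤ ∑ v
c_v = s. The index 0 is excluded by `μ 0 = 0`. -/
theorem totalDegree_coeffPoly_le (h0 : μ 0 = 0) : (coeffPoly p t μ s).totalDegree ≤ s := by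
  refine MvPolynomial.totalDegree_finsetSum_le fun c hc => ?_
  split_ifs with h
  · refine (MvPolynomial.totalDegree_monomial_le _ _).trans ?_
    rw [Finsupp.sum_fintype _ _ (by simp), ← h]
    refine sum_le_sum fun v _ => ?_
    rcases Nat.eq_zero_or_pos (v : ℕ) with hv | hv
    · have := Fintype.mem_piFinset.1 hc v
      rw [hv, h0, mem_range] at this
      simp only [Finsupp.equivFunOnFinite_symm_apply_apply, id]; omega
    · exact Nat.le_mul_of_pos_left _ hv
  · simp

/-- Different choices have different exponent vectors, so monomials do not cancel. The binomial of
μ_v over c_v divides μ_v!, which is prime to p because μ_v < p. -/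
theorem coeffPoly_ne_zero (hμ : ∀ v, μ v < p) {c : Fin (t + 1) → ℕ} (hc : c ∈ choices t μ)
    (hs : ∑ v : Fin (t + 1), (v : ℕ) * c v = s) : coeffPoly p t μ s ≠ 0 := by
  intro h
  have h1 := congrArg (MvPolynomial.coeff (Finsupp.equivFunOnFinite.symm c)) h
  rw [coeffPoly, MvPolynomial.coeff_sum, sum_eq_single c, if_pos hs, MvPolynomial.coeff_monomial,
    if_pos rfl, MvPolynomial.coeff_zero, prod_eq_zero_iff] at h1
  · obtain ⟨v, -, h2⟩ := h1
    rw [ZMod.natCast_eq_zero_iff] at h2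
    have h3 : c v ≤ μ v := by have := Fintype.mem_piFinset.1 hc v; rw [mem_range] at this; omega
    have h4 : p ∣ (μ v).factorial := by
      rw [← Nat.choose_mul_factorial_mul_factorial h3]
      exact (h2.mul_right _).mul_right _
    exact absurd ((Fact.out : p.Prime).dvd_factorial.1 h4) (by have := hμ v; omega)
  · intro b _ hb
    split_ifs
    · rw [MvPolynomial.coeff_monomial, if_neg]
      exact fun h => hb (Finsupp.equivFunOnFinite.symm.injective h)
    · simp
  · exact fun h => absurd hc h

/-- At most one half of the weights lead to a coefficient that vanishes. -/
theorem two_mul_card_le {m : ℕ} (hm : 2 * s ≤ m) (hm0 : 0 < m) (hmp : m ≤ p) (h0 : μ 0 = 0)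
    (hμ : ∀ v, μ v < p)
    (h : ∃ c ∈ choices t μ, ∑ v : Fin (t + 1), (v : ℕ) * c v = s)
      (w : (Fin (t + 1) → Fin m) → ℕ → ZMod p)
    (hw : ∀ ρ (v : Fin (t + 1)), w ρ v = ((ρ v : ℕ) : ZMod p)) :
    2 * #{ρ : Fin (t + 1) → Fin m | coeff s (gen t μ (w ρ)) = 0} ≤ m ^ (t + 1) := by
  obtain ⟨c, hc, hs⟩ := h
  have hinj : Function.Injective fun i : Fin m => ((i : ℕ) : ZMod p) := fun i j hij => by
    have := (ZMod.natCast_eq_natCast_iff' _ _ _).1 hij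
    rw [Nat.mod_eq_of_lt (by omega), Nat.mod_eq_of_lt (by omega)] at this
    exact Fin.ext this
  set S : Finset (ZMod p) := univ.map ⟨fun i : Fin m => ((i : ℕ) : ZMod p), hinj⟩ with hS
  have hcard : #S = m := by simp [hS]
  -- The fraction of zeros in the grid is at most degree / m ≤ s / m ≤ 1/2. The residues 0, …, m - 1
  -- are distinct because m ≤ p.
  have key := MvPolynomial.schwartz_zippel_totalDegree (coeffPoly_ne_zero p t μ s hμ hc hs) S
  rw [hcard] at key
  have hle : #{ρ : Fin (t + 1) → Fin m | coeff s (gen t μ (w ρ)) = 0} ≤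
      #{f ∈ Fintype.piFinset fun _ : Fin (t + 1) => S | MvPolynomial.eval f
        (coeffPoly p t μ s) = 0} := by
    refine card_le_card_of_injOn (fun ρ v => ((ρ v : ℕ) : ZMod p)) (fun ρ hρ => ?_)
      fun ρ _ ρ' _ h => funext fun v => hinj (congrFun h v)
    simp only [coe_filter, mem_univ, true_and, Set.mem_ofPred_eq, Fintype.mem_piFinset] at hρ ⊢
    refine ⟨fun v => by simp [hS], ?_⟩
    rw [← hρ, ← eval_coeffPoly]
    congr 2
    ext v; rw [hw]
  have hdeg := totalDegree_coeffPoly_le p t μ s h0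
  have hmQ : (0 : ℚ≥0) < m := by exact_mod_cast hm0
  rw [div_le_div_iff₀ (by positivity) hmQ] at key
  have key' : #{f ∈ Fintype.piFinset fun _ : Fin (t + 1) => S |
      MvPolynomial.eval f (coeffPoly p t μ s) = 0} * m ≤
      (coeffPoly p t μ s).totalDegree * m ^ (t + 1) := by exact_mod_cast key
  refine Nat.le_of_mul_le_mul_right (c := m) ?_ hm0
  nlinarith [pow_pos hm0 (t + 1)]

/-- In independent repetitions, all coefficients vanish only with small probability. -/
theorem two_pow_mul_card_le {m L : ℕ} (hm : 2 * s ≤ m) (hm0 : 0 < m) (hmp : m ≤ p) (h0 : μ 0 = 0)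
    (hμ : ∀ v, μ v < p) (h : ∃ c ∈ choices t μ, ∑ v : Fin (t + 1), (v : ℕ) * c v = s)
    (w : (Fin (L * (t + 1)) → Fin m) → ℕ → ℕ → ZMod p)
    (hw : ∀ ρ (l : Fin L) (v : Fin (t + 1)),
      w ρ l v = ((ρ (finProdFinEquiv (l, v)) : ℕ) : ZMod p)) :
    2 ^ L * #{ρ : Fin (L * (t + 1)) → Fin m | ∀ l < L, coeff s (gen t μ (w ρ l)) = 0} ≤
      m ^ (L * (t + 1)) := by
  -- Weights are functions on all natural numbers, of which `gen` reads only those up to t; the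
  -- values beyond do not matter.
  let ext (f : Fin (t + 1) → Fin m) (v : ℕ) : ZMod p :=
    if h : v < t + 1 then ((f ⟨v, h⟩ : ℕ) : ZMod p) else 0
  have hext : ∀ f (v : Fin (t + 1)), ext f v = ((f v : ℕ) : ZMod p) := fun f v => dif_pos v.2
  set bad : Finset (Fin (t + 1) → Fin m) := {f | coeff s (gen t μ (ext f)) = 0} with hbad
  have h1 : 2 * #bad ≤ m ^ (t + 1) := two_mul_card_le p t μ s hm hm0 hmp h0 hμ h ext
    fun ρ v => hext ρ v
  -- The long vector consists of L independent weight vectors, and failure means that each of them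
  -- is bad.
  have h2 : #{ρ : Fin (L * (t + 1)) → Fin m | ∀ l < L, coeff s (gen t μ (w ρ l)) = 0} ≤
      #(Fintype.piFinset fun _ : Fin L => bad) := by
    refine card_le_card_of_injOn (fun ρ l v => ρ (finProdFinEquiv (l, v))) (fun ρ hρ => ?_)
      fun ρ _ ρ' _ h => funext fun x => ?_
    · simp only [coe_filter, mem_univ, true_and, Set.mem_ofPred_eq, mem_coe, Fintype.mem_piFinset,
        hbad, mem_filter] at hρ ⊢
      intro l
      rw [← hρ l l.2]
      congr 1
      refine prod_congr rfl fun v _ => ?_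
      rw [hw]
      exact congrArg (fun a => (1 + C a * X ^ (v : ℕ)) ^ μ v)
        (hext (fun v => ρ (finProdFinEquiv (l, v))) v)
    · have : ρ (finProdFinEquiv (finProdFinEquiv.symm x)) = ρ'
          (finProdFinEquiv (finProdFinEquiv.symm x)) :=
        congrFun (congrFun h (finProdFinEquiv.symm x).1) (finProdFinEquiv.symm x).2
      rwa [Equiv.apply_symm_apply] at this
  rw [Fintype.card_piFinset_const] at h2
  calc _ ≤ 2 ^ L * #bad ^ L := Nat.mul_le_mul_left _ h2
    _ = (2 * #bad) ^ L := (mul_pow ..).symm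
    _ ≤ (m ^ (t + 1)) ^ L := Nat.pow_le_pow_left h1 L
    _ = _ := by rw [← pow_mul, mul_comm]

end Random

/-- Sums of sub-multisets in terms of multiplicities. -/
theorem exists_choice_iff {n t : ℕ} {z : Fin n → ℕ} (hz : ∀ i, 0 < z i) {μ : ℕ → ℕ}
    (hμ : ∀ v ≤ t, μ v = min t #{i | z i = v}) {s : ℕ} (hs : s ≤ t) :
    (∃ c ∈ choices t μ, ∑ v : Fin (t + 1), (v : ℕ) * c v = s) ↔ s ∈ subsetSums z t := by
  constructor
  · rintro ⟨c, hc, hsum⟩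
    refine ⟨hs, ?_⟩
    have h1 : ∀ v : Fin (t + 1), ∃ Y ⊆ ({i | z i = v} : Finset (Fin n)), #Y = c v := fun v => by
      refine exists_subset_card_eq ?_
      have := Fintype.mem_piFinset.1 hc v
      rw [mem_range, hμ v (by omega)] at this
      omega
    choose Y hY hcard using h1
    refine ⟨univ.biUnion Y, ?_⟩
    rw [sum_biUnion, ← hsum]
    · refine sum_congr rfl fun v _ => ?_
      rw [sum_congr rfl fun i hi => (mem_filter.1 (hY v hi)).2, sum_const, hcard, smul_eq_mul,
        mul_comm]
    · intro v _ v' _ hv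
      refine disjoint_left.2 fun i hi hi' => hv (Fin.ext ?_)
      rw [← (mem_filter.1 (hY v hi)).2, ← (mem_filter.1 (hY v' hi')).2]
  · rintro ⟨-, Y, hY⟩
    have hle : ∀ i ∈ Y, z i < t + 1 := fun i hi => by
      have : z i ≤ ∑ i ∈ Y, z i := single_le_sum (fun _ _ => Nat.zero_le _) hi
      omega
    have hsum : ∑ v : Fin (t + 1), (v : ℕ) * #{i ∈ Y | z i = v} = s := by
      rw [← hY, Fin.sum_univ_eq_sum_range fun v => v * #{i ∈ Y | z i = v},
        ← sum_fiberwise_of_maps_to (g := z) (t := range (t + 1)) fun i hi => mem_range.2 (hle i hi)]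
      refine sum_congr rfl fun v _ => ?_
      rw [sum_congr rfl fun i hi => (mem_filter.1 hi).2, sum_const, smul_eq_mul, mul_comm]
    refine ⟨fun v => #{i ∈ Y | z i = v}, Fintype.mem_piFinset.2 fun v => ?_, hsum⟩
    rw [mem_range, hμ v (by omega), Nat.lt_succ_iff, le_min_iff]
    refine ⟨?_, card_le_card (filter_subset_filter _ (subset_univ Y))⟩
    -- Capping multiplicities at t loses nothing: a value v ≥ 1 that is used c_v times contributes
    -- at least c_v to a sum that is at most t.
    rcases Nat.eq_zero_or_pos (v : ℕ) with hv | hv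
    · rw [hv, filter_false_of_mem fun i _ => (hz i).ne']; simp
    · have : (v : ℕ) * #{i ∈ Y | z i = v} ≤ s := by
        rw [← hsum]
        exact single_le_sum (f := fun v : Fin (t + 1) => (v : ℕ) * #{i ∈ Y | z i = v})
          (fun _ _ => Nat.zero_le _) (mem_univ v)
      exact (Nat.le_mul_of_pos_left _ hv).trans (this.trans hs)

end SubsetSumSeries

/-! ### Harmonic sums, frame conditions, setup, and the dynamic program -/

namespace WordRAM

open Finset

/-- Dyadic blocks: a block of 2^k terms, each at most M / 2^k, adds at most M. -/
theorem sum_div_le (M k : ℕ) : ∑ i ∈ range (2 ^ k - 1), M / (i + 1) ≤ M * k := by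
  induction k with
  | zero => simp
  | succ k ih =>
      have h1 : 2 ^ (k + 1) - 1 = (2 ^ k - 1) + 2 ^ k := by
        have : 0 < 2 ^ k := by positivity
        rw [pow_succ]; omega
      rw [h1, sum_range_add, mul_add, mul_one]
      refine Nat.add_le_add ih ?_
      calc _ ≤ ∑ _i ∈ range (2 ^ k), M / 2 ^ k := sum_le_sum fun i _ =>
            Nat.div_le_div_left (by have : 0 < 2 ^ k := by positivity
                                    omega) (by positivity)
        _ = 2 ^ k * (M / 2 ^ k) := by simp
        _ ≤ M := Nat.mul_div_le _ _

theorem sum_div_le_of_lt {M k N : ℕ} (h : N < 2 ^ k) : ∑ i ∈ range N, M / (i + 1) ≤ M * k :=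
  (sum_le_sum_of_subset (range_subset_range.2 (by omega))).trans (sum_div_le M k)

/-- The states agree except for registers in `R` and regions in `J`. -/
structure Frame (U : ℕ) (R J : List ℕ) (s s' : St) : Prop where
  reg : ∀ x ∉ R, s'.reg x = s.reg x
  mem : ∀ j ∉ J, ∀ i < U, s'.mem (U * j + i) = s.mem (U * j + i)

theorem Frame.refl (U : ℕ) (R J : List ℕ) (s : St) : Frame U R J s s :=
  ⟨fun _ _ => rfl, fun _ _ _ _ => rfl⟩

theorem Frame.mono {U : ℕ} {R R' J J' : List ℕ} {s s' : St} (h : Frame U R J s s') (hR : R ⊆ R')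
    (hJ : J ⊆ J') : Frame U R' J' s s' :=
  ⟨fun x hx => h.reg x fun h' => hx (hR h'), fun j hj => h.mem j fun h' => hj (hJ h')⟩

theorem Frame.trans {U : ℕ} {R J : List ℕ} {s s' s'' : St} (h : Frame U R J s s')
    (h' : Frame U R J s' s'') : Frame U R J s s'' :=
  ⟨fun x hx => (h'.reg x hx).trans (h.reg x hx),
    fun j hj i hi => (h'.mem j hj i hi).trans (h.mem j hj i hi)⟩

theorem Frame.setReg {U : ℕ} {R J : List ℕ} {s s' : St} (h : Frame U R J s s') {x : ℕ} (v : ℕ)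
    (hx : x ∈ R) : Frame U R J s (s'.setReg x v) :=
  ⟨fun y hy => by rw [St.setReg_reg, if_neg (by rintro rfl; exact hy hx), h.reg y hy], h.mem⟩

theorem St.setMem_cell {U i i' : ℕ} (s : St) (j j' v : ℕ) (hi : i < U) (hi' : i' < U) :
    (s.setMem (U * j + i) v).mem (U * j' + i') =
      if j' = j ∧ i' = i then v else s.mem (U * j' + i') := by
  simp only [St.setMem_mem, cell_inj hi' hi]

theorem Frame.setMem {U : ℕ} {R J : List ℕ} {s s' : St} (h : Frame U R J s s') {j i : ℕ} (v : ℕ)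
    (hj : j ∈ J) (hi : i < U) : Frame U R J s (s'.setMem (U * j + i) v) :=
  ⟨h.reg, fun j' hj' i' hi' => by
    rw [St.setMem_cell _ _ _ _ hi hi',
      if_neg (by rintro ⟨rfl, -⟩; exact hj' hj), h.mem j' hj' i' hi']⟩

theorem Frame.tabulate {U N x j : ℕ} {R J : List ℕ} {s s' : St} (h : Frame U R J s s') (v : ℕ)
    (f : ℕ → ℕ) (hx : x ∈ R) (hj : j ∈ J) (hN : N ≤ U) :
    Frame U R J s ⟨Function.update s'.reg x v, fill s'.mem (U * j) N f⟩ :=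
  ⟨fun y hy => by
    simp only [Function.update_apply]; rw [if_neg (by rintro rfl; exact hy hx), h.reg y hy],
    fun j' hj' i hi => by
      simp only
      rw [fill_cell _ _ _ _ hN hi, if_neg (by rintro ⟨rfl, -⟩; exact hj' hj), h.mem j' hj' i hi]⟩

/-- `for x = a, a + v, a + 2v, …, K - 1`. -/
def Prog.stride (x : ℕ) (a v K : Expr) (p : Prog) : Prog :=
  .seq (.assign x a) (.loop (Expr.less (.reg x) K) (.seq p (.assign x (.reg x + v))))

/-- The counter may pass the limit `N` by less than `V` in the last round; hence the requirement `N
+ V ≤ B`. -/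
theorem Runs.stride {B x : ℕ} {a v K : Expr} {p : Prog} {s : St} {Q : St → Prop} (I : ℕ → St → Prop)
    (A V N M c : ℕ) (ha : a.val s = A) (hN : N + V ≤ B) (hA : A < B) (h0 : I 0 (s.setReg x A))
    (hM : ∀ k < M, A + k * V < N) (hM' : N ≤ A + M * V)
    (hreg : ∀ k s', I k s' → s'.reg x = A + k * V ∧ K.val s' = N)
    (hstep : ∀ k < M, ∀ s', I k s' → Runs (Sem.ideal B) p s' c fun s'' => v.val s'' = V ∧
      s''.reg x = A + k * V ∧ I (k + 1) (s''.setReg x (A + (k + 1) * V)))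
    (hend : ∀ s', I M s' → Q s') :
    Runs (Sem.ideal B) (.stride x a v K p) s (M * (c + 3) + 3) Q := by
  refine Runs.mono_time (T₁ := (M * (c + 1 + 1 + 1) + 1) + 2) ?_ (by ring_nf; omega)
  refine .assign_seq A ha hA ?_
  refine Runs.loop_const I M (c + 1 + 1) h0 ?_ ?_
  · intro k hk s' hs'
    obtain ⟨h1, h2⟩ := hreg k s' hs'
    refine ⟨by simp [Sem.ideal, h1, h2, hM k hk], Runs.seq ((hstep k hk s' hs').mono le_rfl ?_)⟩
    rintro s'' ⟨h3, h4, h5⟩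
    have h6 : A + k * V + V = A + (k + 1) * V := by ring
    have := hM k hk
    exact Runs.assign' (v := A + (k + 1) * V) (by simp [h3, h4, h6]) (by omega) h5
  · intro s' hs'
    obtain ⟨h1, h2⟩ := hreg M s' hs'
    exact ⟨by simp only [Sem.ideal, Expr.val_less, Expr.val_reg, h1, h2]; rw [if_neg (by omega)],
      hend s' hs'⟩

/-- Computes the length of the memory regions, and the least power of two above the bound. -/
def Prog.setup : Prog :=
  .seq (.assign 9 (64 * ((.reg 0 + .reg 1) * (.reg 0 + .reg 1)))) <|
  .seq (.assign 3 0) <|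
  .seq (.assign 4 1) <|
  .loop (.less (.reg 4) (.reg 1 + 1)) <|
    .seq (.assign 4 (2 * .reg 4)) (.assign 3 (.reg 3 + 1))

theorem two_pow_clog_le (t : ℕ) (ht : 1 ≤ t) : 2 ^ Nat.clog 2 (t + 1) ≤ 2 * t := by
  have h := Nat.pow_pred_clog_lt_self (b := 2) (by omega) (show 1 < t + 1 by omega)
  have h1 : 0 < Nat.clog 2 (t + 1) := Nat.clog_pos (by omega) (by omega)
  obtain ⟨k, hk⟩ : ∃ k, Nat.clog 2 (t + 1) = k + 1 := ⟨_, (Nat.succ_pred_eq_of_pos h1).symm⟩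
  rw [hk] at h ⊢
  rw [pow_succ]; simp only [Nat.pred_succ] at h; omega

/-- Regions of quadratic length leave room for all arrays. They cost no time, since the memory
behind the input is zero from the beginning. -/
theorem runs_setup {B n t : ℕ} {s : St} (h0 : s.reg 0 = n) (h1 : s.reg 1 = t) (ht : 1 ≤ t)
    (hB : 64 * (n + t) ^ 2 < B) :
    Runs (Sem.ideal B) .setup s (5 * Nat.clog 2 (t + 1) + 7) fun s' =>
      s'.mem = s.mem ∧ (∀ x, x ≠ 3 → x ≠ 4 → x ≠ 9 → s'.reg x = s.reg x) ∧
      s'.reg 3 = Nat.clog 2 (t + 1) ∧ s'.reg 4 = 2 ^ Nat.clog 2 (t + 1) ∧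
      s'.reg 9 = 64 * (n + t) ^ 2 := by
  have hK := two_pow_clog_le t ht
  have hlt : ∀ k, k < 2 ^ k := fun k => Nat.lt_two_pow_self
  have hnt : n + t ≤ (n + t) ^ 2 := Nat.le_self_pow (by omega) _
  unfold Prog.setup
  refine Runs.mono_time (T₁ := (Nat.clog 2 (t + 1) * (3 + 1) + 1) + 2 + 2 + 2) ?_ (by omega)
  refine .assign_seq (64 * (n + t) ^ 2) (by simp [h0, h1]; ring) hB ?_
  refine .assign_seq 0 (by simp) (by omega) (.assign_seq 1 (by simp) (by omega) ?_)
  refine Runs.loop_const (fun k s' => k ≤ Nat.clog 2 (t + 1) ∧ s'.mem = s.mem ∧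
    (∀ x, x ≠ 3 → x ≠ 4 → x ≠ 9 → s'.reg x = s.reg x) ∧ s'.reg 3 = k ∧ s'.reg 4 = 2 ^ k ∧
    s'.reg 9 = 64 * (n + t) ^ 2) _ 3
      ⟨by omega, rfl, fun x h3 h4 h9 => ?_, by simp, by simp, by simp⟩
    ?_ ?_
  · simp [h3, h4, h9]
  · rintro k hk s' ⟨-, hm, hx, h3, h4, h9⟩
    have h2 : 2 ^ k < t + 1 := (Nat.lt_clog_iff_pow_lt (by omega)).1 hk
    have h5 : 2 ^ (k + 1) ≤ 2 * t := (Nat.pow_le_pow_right (by omega) hk).trans hK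
    refine ⟨by simp [Sem.ideal, h4, hx, h1]; omega, ?_⟩
    refine .assign_seq (2 ^ (k + 1)) (by simp [h4, pow_succ']) (by omega) ?_
    have := hlt (k + 1)
    refine Runs.assign' (v := k + 1) (by simp [h3]) (by omega)
      ⟨hk, hm, fun x h3 h4 h9 => ?_, by simp,
      by simp, by simp [h9]⟩
    simp [h3, h4, hx x h3 h4 h9]
  · rintro s' ⟨-, hm, hx, h3, h4, h9⟩
    have : t + 1 ≤ 2 ^ Nat.clog 2 (t + 1) := Nat.le_pow_clog (by omega) _
    refine ⟨by simp [Sem.ideal, h4, hx, h1]; omega, hm, hx, h3, h4, h9⟩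

/-- Dynamic programming over all numbers. -/
def Prog.dp : Prog :=
  .seq (.store (.reg 9 * 8 + 0) 1) <|
  .seq (.assign 22 (.reg 1 + 1)) <|
  .upto 7 (.reg 0) <| .rewrite 8 <|
    .less 0 (.cell 8 (.reg 24) +
      .less (.cell 0 (.reg 7)) (.reg 24 + 1) * .cell 8 (.reg 24 - .cell 0 (.reg 7)))

theorem exists_sum_succ {n i s : ℕ} (z : Fin n → ℕ) (hi : i < n) :
    (∃ Y : Finset (Fin n), (∀ y ∈ Y, (y : ℕ) < i + 1) ∧ ∑ y ∈ Y, z y = s) ↔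
      (∃ Y : Finset (Fin n), (∀ y ∈ Y, (y : ℕ) < i) ∧ ∑ y ∈ Y, z y = s) ∨
      (z ⟨i, hi⟩ ≤ s ∧
        ∃ Y : Finset (Fin n), (∀ y ∈ Y, (y : ℕ) < i) ∧ ∑ y ∈ Y, z y = s - z ⟨i, hi⟩) := by
  constructor
  · rintro ⟨Y, hY, hs⟩
    by_cases hmem : (⟨i, hi⟩ : Fin n) ∈ Y
    · refine .inr ⟨hs ▸ single_le_sum (fun _ _ => Nat.zero_le _) hmem, Y.erase ⟨i, hi⟩,
        fun y hy => ?_, ?_⟩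
      · have h1 := hY y (mem_of_mem_erase hy)
        have h2 : (y : ℕ) ≠ i := fun h => ne_of_mem_erase hy (Fin.ext h)
        omega
      · rw [← hs, ← add_sum_erase _ _ hmem]; omega
    · refine .inl ⟨Y, fun y hy => ?_, hs⟩
      have h1 := hY y hy
      have h2 : (y : ℕ) ≠ i := fun h =>
        hmem (by rwa [show (⟨i, hi⟩ : Fin n) = y from Fin.ext h.symm])
      omega
  · rintro (⟨Y, hY, hs⟩ | ⟨hle, Y, hY, hs⟩)
    · exact ⟨Y, fun y hy => (hY y hy).trans (by omega), hs⟩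
    · have hmem : (⟨i, hi⟩ : Fin n) ∉ Y := fun h => absurd (hY _ h) (by simp)
      refine ⟨insert ⟨i, hi⟩ Y, fun y hy => ?_, ?_⟩
      · rcases mem_insert.1 hy with rfl | hy
        · simp
        · exact (hY y hy).trans (by omega)
      · rw [sum_insert hmem, hs]; omega

theorem or_bit (P Q : Prop) [Decidable P] [Decidable Q] [Decidable (P ∨ Q)] :
    (if 0 < (if P then 1 else 0) + (if Q then 1 else 0) then 1 else 0) =
      if P ∨ Q then 1 else 0 := by
  by_cases hP : P <;> by_cases hQ : Q <;> simp [hP, hQ]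

/-- The buffer in `rewrite` makes each new row refer to the old row only, so no number is used
twice. -/
theorem runs_dp {U B n t : ℕ} {s : St} {z : Fin n → ℕ} (h0 : s.reg 0 = n) (h1 : s.reg 1 = t)
    (h9 : s.reg 9 = U) (hUB : U < B) (hnU : n ≤ U) (htU : t + 1 ≤ U)
    (hz : ∀ i : Fin n, s.mem (U * 0 + i) = min (z i) (t + 1))
      (h8 : ∀ i < U, s.mem (U * 8 + i) = 0) :
    Runs (Sem.ideal B) .dp s (n * (8 * t + 18) + 7) fun s' => s'.reg 1 = t ∧ s'.reg 9 = U ∧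
      ∀ i ≤ t, s'.mem (U * 8 + i) ≠ 0 ↔ i ∈ subsetSums z t := by
  classical
  let f (k i : ℕ) : ℕ := if ∃ Y : Finset (Fin n), (∀ y ∈ Y, (y : ℕ) < k) ∧ ∑ y ∈ Y,
    z y = i then 1 else 0
  unfold Prog.dp
  refine Runs.mono_time (T₁ := (∑ _i ∈ range n, (8 * (t + 1) + 7 + 3) + 3) + 2 + 2) ?_
    (by simp only [sum_const, card_range, smul_eq_mul]; ring_nf; omega)
  refine .store_seq (U * 8 + 0) 1 (by simp [h9]) (by simp) (by omega) ?_
  refine .assign_seq (t + 1) (by simp [h1]) (by omega) ?_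
  refine Runs.upto (fun k s' => s'.reg 7 = k ∧ k ≤ n ∧ s'.reg 0 = n ∧ s'.reg 1 = t ∧ s'.reg 9 = U ∧
    s'.reg 22 = t + 1 ∧ (∀ i : Fin n, s'.mem (U * 0 + i) = min (z i) (t + 1)) ∧
    ∀ i ≤ t, s'.mem (U * 8 + i) = f k i) n _ (by omega) ?_ ?_ ?_ ?_
  · refine ⟨by simp, by omega, by simp [h0], by simp [h1], by simp [h9], by simp, fun i => ?_,
      fun i hi => ?_⟩
    · rw [← hz i]
      simp only [St.setReg_mem]
      rw [St.setMem_cell _ _ _ _ (by omega) (by omega), if_neg (by omega)]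
    · simp only [St.setReg_mem]
      rw [St.setMem_cell _ _ _ _ (by omega) (by omega), h8 i (by omega)]
      simp only [f, true_and]
      refine if_congr ⟨?_, ?_⟩ rfl rfl
      · rintro rfl; exact ⟨∅, by simp, by simp⟩
      · rintro ⟨Y, hY, hs⟩
        rw [eq_empty_of_forall_notMem fun y hy => absurd (hY y hy) (by omega)] at hs
        simpa using hs.symm
  · rintro k s' ⟨h7, -, h0, -⟩
    exact ⟨h7, by simp [h0]⟩
  · rintro k hk s' ⟨h7, -, h0, h1, h9, h22, hz, hf⟩
    refine (Runs.rewrite (f (k + 1)) h9 h22 htU hUB fun i hi m' hm' => ⟨?_, ?_⟩).mono le_rfl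
      fun s'' ⟨hr, hm⟩ => ⟨by rw [hr _ (by omega), h7], ?_⟩
    · have e1 : m' (U * 0 + k) = min (z ⟨k, hk⟩) (t + 1) := by
        rw [hm' _ (by omega)]; exact hz ⟨k, hk⟩
      have e2 : ∀ i ≤ t, m' (U * 8 + i) = f k i := fun i hi => by
        rw [hm' _ (by omega)]; exact hf i hi
      -- Capping at t + 1 is harmless, as every index i is at most t.
      have e3 : (min (z ⟨k, hk⟩) (t + 1) < i + 1) ↔ z ⟨k, hk⟩ ≤ i := by omega
      simp only [Expr.val_less, Expr.val_zero, Expr.val_add, Expr.val_cell, Expr.val_mul,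
        Expr.val_sub, Expr.val_reg, Expr.val_one, Function.update_self, Function.update_apply,
        Nat.reduceEqDiff, if_false, h9, h7, e1, e3]
      rw [e2 i (by omega), e2 _ (by omega)]
      simp only [f]
      rw [if_congr (exists_sum_succ z hk) rfl rfl]
      by_cases hle : z ⟨k, hk⟩ ≤ i
      · rw [if_pos hle, min_eq_left (by omega), one_mul, or_bit]
        exact if_congr (or_congr_right (and_iff_right hle).symm) rfl rfl
      · rw [if_neg hle, zero_mul, add_zero]
        rw [if_congr (or_iff_left fun h => hle h.1) rfl rfl]
        split_ifs <;> omega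
    · simp only [f]; split_ifs <;> omega
    · have hr' : ∀ x, x ≠ 24 → x ≠ 7 → (s''.setReg 7 (k + 1)).reg x = s'.reg x := fun x h h' => by
        rw [St.setReg_reg, if_neg h', hr x h]
      refine ⟨by simp, hk, by rw [hr' _ (by omega) (by omega), h0],
        by rw [hr' _ (by omega) (by omega), h1], by rw [hr' _ (by omega) (by omega), h9],
        by rw [hr' _ (by omega) (by omega), h22], fun i => ?_, fun i hi => ?_⟩
      · simp only [St.setReg_mem]
        rw [hm _ _ (by omega) (by omega), if_neg (by omega), hz i]
      · simp only [St.setReg_mem]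
        rw [hm _ _ (by omega) (by omega), if_pos (by omega)]
  · rintro s' ⟨-, -, -, h1, h9, -, -, hf⟩
    refine ⟨h1, h9, fun i hi => ?_⟩
    rw [hf i hi]
    simp only [f, subsetSums, Set.mem_ofPred_eq, hi, true_and, ne_eq, ite_eq_right_iff,
      Nat.one_ne_zero, imp_false, not_not, Fin.is_lt, implies_true]

end WordRAM

/-! ### Tables: a prime, reciprocals, powers of two, multiplicities -/

namespace WordRAM

open Finset

/-- Marks the composite numbers below the bound in register `11`. -/
def Prog.sieve : Prog :=
  .upto 8 (.reg 11) <|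
    .stride 10 (2 * (.reg 8 + 2)) (.reg 8 + 2) (.reg 11) (.store (.reg 9 * 13 + .reg 10) 1)

/-- Multiples of every d ≥ 2 are marked, not only those of primes; the harmonic sum over d still
gives time O(N log N). -/
theorem runs_sieve {B U N k : ℕ} {s : St} (h9 : s.reg 9 = U) (h11 : s.reg 11 = N) (hN : 1 ≤ N)
    (hNU : N ≤ U) (hUB : U * 16 < B) (hk : N < 2 ^ k) (h13 : ∀ i < U, s.mem (U * 13 + i) = 0) :
    Runs (Sem.ideal B) .sieve s (4 * N * k + 6 * N + 3) fun s' => Frame U [8, 10] [13] s s' ∧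
      ∀ j < N, s'.mem (U * 13 + j) ≠ 0 ↔ ∃ d, 2 ≤ d ∧ d < j ∧ d ∣ j := by
  unfold Prog.sieve
  have htime : ∑ d ∈ range N, ((((N - 1) / (d + 2) - 1) * (1 + 3) + 3) + 3) + 3 ≤
      4 * N * k + 6 * N + 3 := by
    have h1 := sum_div_le_of_lt (M := N) hk
    have h2 : ∑ d ∈ range N, ((((N - 1) / (d + 2) - 1) * (1 + 3) + 3) + 3) ≤
        ∑ d ∈ range N, (4 * (N / (d + 1)) + 6) := sum_le_sum fun d _ => by
      have : (N - 1) / (d + 2) ≤ N / (d + 1) := Nat.div_le_div (by omega) (by omega) (by omega)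
      omega
    have h4 : ∑ d ∈ range N, (4 * (N / (d + 1)) + 6) = 4 * ∑ d ∈ range N, N / (d + 1) + N * 6 := by
      rw [sum_add_distrib, ← mul_sum]; simp
    have h3 : 4 * N * k = 4 * (N * k) := by ring
    omega
  refine Runs.mono_time ?_ htime
  refine Runs.upto (fun D s' => s'.reg 8 = D ∧ Frame U [8, 10] [13] s s' ∧
    ∀ j < N, s'.mem (U * 13 + j) ≠ 0 ↔ ∃ d, 2 ≤ d ∧ d < D + 2 ∧ d < j ∧ d ∣ j) N _ (by omega)
    ⟨by simp, (Frame.refl ..).setReg _ (by decide), fun j hj => ?_⟩ ?_ ?_ ?_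
  · simp only [St.setReg_mem, h13 j (by omega)]
    simp only [ne_eq, not_true_eq_false, false_iff, not_exists]; omega
  · rintro D s' ⟨h8, hF, -⟩
    exact ⟨h8, by simp [hF.reg 11 (by decide), h11]⟩
  · rintro D hD s' ⟨h8, hF, hj⟩
    set q := (N - 1) / (D + 2) with hq
    have hq1 : q * (D + 2) ≤ N - 1 := Nat.div_mul_le_self _ _
    have hq2 : N - 1 < (q + 1) * (D + 2) := by
      rw [mul_comm]; exact Nat.lt_mul_div_succ _ (by omega)
    refine Runs.stride (fun k s' => s'.reg 10 = 2 * (D + 2) + k * (D + 2) ∧ s'.reg 8 = D ∧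
      Frame U [8, 10] [13] s s' ∧ ∀ j < N, s'.mem (U * 13 + j) ≠ 0 ↔
        (∃ d, 2 ≤ d ∧ d < D + 2 ∧ d < j ∧ d ∣ j) ∨ ∃ i < k, j = (i + 2) * (D + 2))
      (2 * (D + 2)) (D + 2) N (q - 1) 1 (by simp [h8]) (by omega) (by omega)
      ⟨by simp, by simp [h8], hF.setReg _ (by decide), fun j hj' => by simp [hj j hj']⟩ ?_ ?_ ?_ ?_
        ?_
    · intro k hk
      have : (k + 2) * (D + 2) ≤ q * (D + 2) := Nat.mul_le_mul_right _ (by omega)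
      rw [← add_mul, add_comm 2 k]; omega
    · have : (q + 1) * (D + 2) ≤ (2 + (q - 1)) * (D + 2) := Nat.mul_le_mul_right _ (by omega)
      rw [← add_mul]; omega
    · rintro k s' ⟨h10, -, hF, -⟩
      exact ⟨h10, by simp [hF.reg 11 (by decide), h11]⟩
    · rintro k hk s'' ⟨h10, h8, hF, hI⟩
      have hlt : 2 * (D + 2) + k * (D + 2) < N := by
        have : (k + 2) * (D + 2) ≤ q * (D + 2) := Nat.mul_le_mul_right _ (by omega)
        rw [← add_mul, add_comm 2 k]; omega
      refine Runs.store' (a := U * 13 + (2 * (D + 2) + k * (D + 2))) (v := 1)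
        (by simp [hF.reg 9 (by decide), h9, h10]) (by simp) (by omega) ⟨by simp [h8], by simp [h10],
          by simp, by simp [h8], (hF.setMem _ (by decide) (by omega)).setReg _ (by decide),
          fun j hj' => ?_⟩
      simp only [St.setReg_mem]
      rw [St.setMem_cell _ _ _ _ (by omega) (by omega)]
      have e : (∃ i < k + 1, j = (i + 2) * (D + 2)) ↔
          (∃ i < k, j = (i + 2) * (D + 2)) ∨ j = 2 * (D + 2) + k * (D + 2) := by
        constructor
        · rintro ⟨i, hi, h⟩
          rcases Nat.lt_succ_iff_lt_or_eq.1 hi with hi | rfl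
          · exact .inl ⟨i, hi, h⟩
          · exact .inr (by rw [h]; ring)
        · rintro (⟨i, hi, h⟩ | h)
          · exact ⟨i, by omega, h⟩
          · exact ⟨k, by omega, by rw [h]; ring⟩
      rw [e]
      split_ifs with h
      · exact ⟨fun _ => .inr (.inr h.2), fun _ => by omega⟩
      · rw [hI j hj']
        have : j ≠ 2 * (D + 2) + k * (D + 2) := fun h' => h ⟨rfl, h'⟩
        rw [or_iff_left this]
    · rintro s'' ⟨-, h8, hF, hI⟩
      refine ⟨h8, by simp, hF.setReg _ (by decide), fun j hj' => ?_⟩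
      simp only [St.setReg_mem]
      rw [hI j hj']
      constructor
      · rintro (⟨d, h1, h2, h3⟩ | ⟨i, hi, rfl⟩)
        · exact ⟨d, h1, by omega, h3⟩
        · exact ⟨D + 2, by omega, by omega, by nlinarith, dvd_mul_left _ _⟩
      · rintro ⟨d, h1, h2, h3, c, rfl⟩
        rcases Nat.lt_or_ge d (D + 2) with h4 | h4
        · exact .inl ⟨d, h1, h4, h3, dvd_mul_right _ _⟩
        · obtain rfl : d = D + 2 := by omega
          have h5 : 2 ≤ c := by
            by_contra h
            have : c ≤ 1 := by omega
            nlinarith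
          have h6 : c ≤ q := by
            rw [hq, Nat.le_div_iff_mul_le (by omega), mul_comm]; omega
          exact .inr ⟨c - 2, by omega, by rw [Nat.sub_add_cancel h5, mul_comm]⟩
  · rintro s' ⟨-, hF, hI⟩
    refine ⟨hF, fun j hj => ?_⟩
    rw [hI j hj]
    exact exists_congr fun d => ⟨fun h => ⟨h.1, h.2.2⟩, fun h => ⟨h.1, by omega, h.2⟩⟩

/-- Finds the least prime above the number in register `5`. -/
def Prog.findPrime : Prog :=
  .seq (.assign 6 (.reg 5 + 1)) <| .loop (.cell 13 (.reg 6)) (.assign 6 (.reg 6 + 1))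

/-- Bertrand's postulate keeps the search within the range of the sieve. -/
theorem runs_findPrime {B U N m : ℕ} {s : St} (h9 : s.reg 9 = U) (h5 : s.reg 5 = m) (hm : 1 ≤ m)
    (hmN : 2 * m < N) (hNU : N ≤ U) (hUB : U * 16 < B)
    (h13 : ∀ j < N, s.mem (U * 13 + j) ≠ 0 ↔ ∃ d, 2 ≤ d ∧ d < j ∧ d ∣ j) :
    Runs (Sem.ideal B) .findPrime s (2 * m + 3) fun s' => Frame U [6] [] s s' ∧
      (s'.reg 6).Prime ∧ m < s'.reg 6 ∧ s'.reg 6 ≤ 2 * m := by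
  have hex : ∃ p, p.Prime ∧ m < p := (Nat.exists_prime_lt_and_le_two_mul m (by omega)).imp
    fun p h => ⟨h.1, h.2.1⟩
  classical
  obtain ⟨hp, hmp⟩ := Nat.find_spec hex
  have hmin : ∀ q, q < Nat.find hex → m < q → ¬ q.Prime := fun q hq h h' =>
    Nat.find_min hex hq ⟨h', h⟩
  have hle : Nat.find hex ≤ 2 * m := by
    obtain ⟨q, h1, h2, h3⟩ := Nat.exists_prime_lt_and_le_two_mul m (by omega)
    exact (Nat.find_min' hex ⟨h1, h2⟩).trans h3
  generalize Nat.find hex = p at *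
  obtain ⟨M, rfl⟩ : ∃ M, p = m + 1 + M := ⟨p - (m + 1), by omega⟩
  unfold Prog.findPrime
  refine Runs.mono_time (T₁ := (M * (1 + 1) + 1) + 2) ?_ (by omega)
  refine .assign_seq (m + 1) (by simp [h5]) (by omega) ?_
  refine Runs.loop_const (fun k s' => s' = s.setReg 6 (m + 1 + k)) M 1 rfl ?_ ?_
  · rintro k hk _ rfl
    refine ⟨?_, Runs.assign' (v := m + 1 + (k + 1)) (by simp; ring) (by omega)
      (by simp [St.setReg])⟩
    have hnp := hmin (m + 1 + k) (by omega) (by omega)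
    simp only [Sem.ideal, Expr.val_cell, Expr.val_reg, St.setReg_mem, St.setReg_reg]
    simp only [if_true, Nat.reduceEqDiff, if_false, h9]
    rw [h13 _ (by omega)]
    refine ⟨(m + 1 + k).minFac, (Nat.minFac_prime (by omega)).two_le, ?_, Nat.minFac_dvd _⟩
    exact lt_of_le_of_ne (Nat.minFac_le (by omega))
      fun h => hnp ((Nat.prime_def_minFac).2 ⟨by omega, h⟩)
  · rintro _ rfl
    refine ⟨?_, (Frame.refl ..).setReg _ (by decide), by simpa using hp, by simp; omega,
      by simpa using hle⟩
    simp only [Sem.ideal, Expr.val_cell, Expr.val_reg, St.setReg_mem, St.setReg_reg]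
    simp only [if_true, Nat.reduceEqDiff, if_false, h9]
    by_contra h
    rw [← ne_eq, h13 _ (by omega)] at h
    obtain ⟨d, h1, h2, h3⟩ := h
    rcases (Nat.dvd_prime hp).1 h3 with h4 | h4 <;> omega

/-- Tabulates the reciprocals modulo the prime in register `6`. -/
def Prog.inverses : Prog :=
  .tabulate 24 (.reg 4) (.reg 9 * 3) (.same (.reg 24) 1 +
    (.reg 6 - .reg 6 / .reg 24) * .cell 3 (.reg 6 % .reg 24) % .reg 6)

/-- From p = i⌊p/i⌋ + (p mod i) it follows that 1/i = -⌊p/i⌋ / (p mod i), and p mod i is a smaller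
index, so the table can be filled in increasing order. -/
theorem inv_val_eq {p i : ℕ} [Fact p.Prime] (h2 : 2 ≤ i) (hi : i < p) :
    (p - p / i) * ((p % i : ℕ) : ZMod p)⁻¹.val % p = (i : ZMod p)⁻¹.val := by
  have hp := (Fact.out : p.Prime)
  have hne : ∀ j, 0 < j → j < p → (j : ZMod p) ≠ 0 := fun j h h' => by
    rw [Ne, ZMod.natCast_eq_zero_iff]; exact Nat.not_dvd_of_pos_of_lt h h'
  have h0 : 0 < p % i := Nat.pos_of_ne_zero fun h => by
    rcases (Nat.dvd_prime hp).1 (Nat.dvd_of_mod_eq_zero h) with h | h <;> omega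
  have h1 : p % i < i := Nat.mod_lt _ (by omega)
  rw [← Nat.mod_eq_of_lt (ZMod.val_lt ((i : ZMod p)⁻¹)), ← ZMod.natCast_eq_natCast_iff']
  push_cast [Nat.div_le_self]
  rw [ZMod.natCast_zmod_val, ZMod.natCast_zmod_val, ZMod.natCast_self, zero_sub]
  have h3 := hne i (by omega) hi
  have h4 := hne (p % i) h0 (h1.trans hi)
  have h5 : ((p % i : ℕ) : ZMod p) = -(i * (p / i : ℕ)) := by
    rw [eq_neg_iff_add_eq_zero, ← Nat.cast_mul, ← Nat.cast_add, Nat.mod_add_div, ZMod.natCast_self]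
  rw [h5] at h4 ⊢
  have h6 : ((p / i : ℕ) : ZMod p) ≠ 0 := by
    rintro h; rw [h] at h4; simp at h4
  field_simp

theorem runs_inverses {B U p N : ℕ} {s : St} (hp : p.Prime) (h4 : s.reg 4 = N) (h6 : s.reg 6 = p)
    (h9 : s.reg 9 = U) (hNp : N ≤ p) (hpU : p < U) (hUB : U * 16 < B)
    (h3 : ∀ i < U, s.mem (U * 3 + i) = 0) :
    Runs (Sem.ideal B) .inverses s (4 * N + 3) fun s' => Frame U [24] [3] s s' ∧
      ∀ i < N, (s'.mem (U * 3 + i) : ZMod p) = (i : ZMod p)⁻¹ := by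
  have : Fact p.Prime := ⟨hp⟩
  let f (i : ℕ) : ℕ := ((i : ZMod p)⁻¹).val
  refine (Runs.tabulate N (U * 3) f
    (by omega) fun i hi => ⟨by simp [h4], fun hi => ⟨by simp [h9], ?_,
    (ZMod.val_lt _).trans (by omega)⟩⟩).mono le_rfl ?_
  · have hmem : ∀ j < U, fill s.mem (U * 3) i f (U * 3 + j) = if j < i then f j else 0 :=
      fun j hj => by
        rw [fill_cell _ _ _ _ (by omega) hj, h3 j hj]; simp
    have hmod : p % i ≤ p := Nat.mod_le _ _
    simp only [Expr.val_add, Expr.val_same, Expr.val_reg, Expr.val_one, Expr.val_mod, Expr.val_mul,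
      Expr.val_sub, Expr.val_div, Expr.val_cell, Function.update_self, Function.update_apply,
      Nat.reduceEqDiff, if_false, h6, h9]
    rw [hmem _ (by omega)]
    rcases Nat.lt_or_ge i 2 with h2 | h2
    -- At index 0, `p % 0 = p` refers to a cell that is still zero, which produces the convention
    -- `0⁻¹ = 0`. At index 1, `p % 1 = 0` refers to this zero, and the comparison in the program
    -- adds the 1.
    · interval_cases i
      · simp [f]
      · have : (1 : ZMod p).val = 1 := ZMod.val_one p
        simp [f, this]
    · rw [if_neg (by omega), if_pos (Nat.mod_lt _ (by omega)), zero_add]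
      exact inv_val_eq h2 (by omega)
  · rintro _ rfl
    refine ⟨(Frame.refl ..).tabulate _ _ (by decide) (by decide) (by omega), fun i hi => ?_⟩
    simp only
    rw [fill_cell _ _ _ _ (by omega) (by omega), if_pos ⟨rfl, hi⟩]
    exact ZMod.natCast_zmod_val _

/-- Tabulates powers of two. -/
def Prog.powers : Prog :=
  .tabulate 24 (.reg 3 + 2) (.reg 9 * 14) (.same (.reg 24) 0 + 2 * .cell 14 (.reg 24 - 1))

theorem runs_powers {B U K : ℕ} {s : St} (h3 : s.reg 3 = K) (h9 : s.reg 9 = U)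
    (hK : K + 2 ≤ U) (hKB : 2 ^ (K + 1) < B) (hUB : U * 16 < B)
    (h14 : ∀ i < U, s.mem (U * 14 + i) = 0) :
    Runs (Sem.ideal B) .powers s (4 * K + 11) fun s' => Frame U [24] [14] s s' ∧
      ∀ i ≤ K + 1, s'.mem (U * 14 + i) = 2 ^ i := by
  refine (Runs.tabulate (K + 2) (U * 14) (fun i => 2 ^ i) (by omega) fun i hi => ⟨by simp [h3],
    fun hi => ⟨by simp [h9], ?_, (Nat.pow_le_pow_right (by omega) (by omega)).trans_lt hKB⟩⟩).mono
    (by omega) ?_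
  · simp only [Expr.val_add, Expr.val_same, Expr.val_reg, Expr.val_mul,
      Expr.val_sub, Expr.val_cell, Expr.val_ofNat, Function.update_self, Function.update_apply,
      Nat.reduceEqDiff, if_false, h9]
    rw [fill_cell _ _ _ _ (by omega) (by omega), h14 _ (by omega)]
    -- At index 0 the truncated `0 - 1` refers to a cell that is still zero, and the comparison in
    -- the program supplies 2^0.
    rcases Nat.eq_zero_or_pos i with rfl | h
    · simp
    · rw [if_neg (by omega), if_pos ⟨rfl, by omega⟩, zero_add, ← pow_succ', Nat.sub_add_cancel h]
  · rintro _ rfl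
    refine ⟨(Frame.refl ..).tabulate _ _ (by decide) (by decide) (by omega), fun i hi => ?_⟩
    simp only
    rw [fill_cell _ _ _ _ (by omega) (by omega), if_pos ⟨rfl, by omega⟩]

/-- Counts how often each number occurs. -/
def Prog.count : Prog :=
  .upto 8 (.reg 0) <| .store (.reg 9 * 1 + .cell 0 (.reg 8))
    (.cell 1 (.cell 0 (.reg 8)) + .less (.cell 1 (.cell 0 (.reg 8))) (.reg 1))

/-- Numbers above t are all counted in cell t + 1, outside the range that is used later. The bit
that is added becomes 0 once the count has reached t. -/
theorem runs_count {B U n t : ℕ} {s : St} {z : Fin n → ℕ} (h0 : s.reg 0 = n) (h1 : s.reg 1 = t)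
    (h9 : s.reg 9 = U) (hUB : U * 16 < B) (hnU : n ≤ U) (htU : t + 1 < U)
    (hz : ∀ i : Fin n, s.mem (U * 0 + i) = min (z i) (t + 1))
      (h1m : ∀ i < U, s.mem (U * 1 + i) = 0) :
    Runs (Sem.ideal B) .count s (4 * n + 3) fun s' => Frame U [8] [1] s s' ∧
      ∀ v ≤ t, s'.mem (U * 1 + v) = min t #{i | z i = v} := by
  unfold Prog.count
  refine Runs.mono_time (T₁ := ∑ _i ∈ range n, (1 + 3) + 3) ?_ (by simp; omega)
  refine Runs.upto (fun k s' => s'.reg 8 = k ∧ k ≤ n ∧ Frame U [8] [1] s s' ∧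
    ∀ v < U, s'.mem (U * 1 + v) = min t #{i : Fin n | (i : ℕ) < k ∧ min (z i) (t + 1) = v}) n _
    (by omega) ⟨by simp, by omega, (Frame.refl ..).setReg _ (by decide), fun v hv => ?_⟩ ?_ ?_ ?_
  · simpa using h1m v hv
  · rintro k s' ⟨h8, -, hF, -⟩
    exact ⟨h8, by simp [hF.reg 0 (by decide), h0]⟩
  · rintro k hk s' ⟨h8, -, hF, hI⟩
    have ez : s'.mem (U * 0 + k) = min (z ⟨k, hk⟩) (t + 1) := by
      rw [hF.mem 0 (by decide) _ (by omega)]; exact hz ⟨k, hk⟩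
    set c := s'.mem (U * 1 + min (z ⟨k, hk⟩) (t + 1)) with hc
    have hct : c ≤ t := by rw [hc, hI _ (by omega)]; exact min_le_left _ _
    refine Runs.store' (a := U * 1 + min (z ⟨k, hk⟩) (t + 1)) (v := c + if c < t then 1 else 0)
      (by simp only [Expr.val_add, Expr.val_mul, Expr.val_reg, Expr.val_one, Expr.val_cell,
        hF.reg 9 (by decide), h9, h8, ez])
      (by simp only [Expr.val_add, Expr.val_less, Expr.val_reg, Expr.val_cell,
        hF.reg 9 (by decide), hF.reg 1 (by decide), h9, h8, h1, ez, hc])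
      (by split_ifs <;> omega) ⟨by simp [h8], by simp, hk,
        (hF.setMem _ (by decide) (by omega)).setReg _ (by decide), fun v hv => ?_⟩
    simp only [St.setReg_mem]
    rw [St.setMem_cell _ _ _ _ (by omega) hv]
    have hcard : #{i : Fin n | (i : ℕ) < k + 1 ∧ min (z i) (t + 1) = v} =
        #{i : Fin n | (i : ℕ) < k ∧ min (z i) (t + 1) = v} +
          if v = min (z ⟨k, hk⟩) (t + 1) then 1 else 0 := by
      split_ifs with h
      · rw [← card_insert_of_notMem (a := (⟨k, hk⟩ : Fin n)) (by simp)]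
        congr 1
        ext i
        simp only [mem_filter, mem_univ, true_and, mem_insert]
        constructor
        · rintro ⟨h1, h2⟩
          rcases Nat.lt_succ_iff_lt_or_eq.1 h1 with h1 | h1
          · exact .inr ⟨h1, h2⟩
          · exact .inl (Fin.ext h1)
        · rintro (rfl | ⟨h1, h2⟩)
          · exact ⟨by simp, h.symm⟩
          · exact ⟨by omega, h2⟩
      · rw [add_zero]
        congr 1
        ext i
        simp only [mem_filter, mem_univ, true_and]
        constructor
        · rintro ⟨h1, h2⟩
          refine ⟨lt_of_le_of_ne (by omega) fun h3 => h ?_, h2⟩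
          rw [← h2, show i = ⟨k, hk⟩ from Fin.ext h3]
        · rintro ⟨h1, h2⟩
          exact ⟨by omega, h2⟩
    rw [hcard]
    simp only [true_and]
    split_ifs with h h2
    · rw [hc, hI _ (by omega), ← h] at h2 ⊢
      omega
    · rw [hc, hI _ (by omega), ← h] at h2 ⊢
      omega
    · rw [hI v hv, add_zero]
  · rintro s' ⟨-, -, hF, hI⟩
    refine ⟨hF, fun v hv => ?_⟩
    rw [hI v (by omega)]
    congr 2
    ext i
    simp only [mem_filter, mem_univ, true_and, Fin.is_lt]
    omega

end WordRAM

/-! ### The logarithmic derivative of the generating function -/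

namespace WordRAM

open Finset SubsetSumSeries

/-- Adds a geometric progression to the entries of region `5` at multiples of a number. -/
def Prog.addMultiples : Prog :=
  .stride 10 (.reg 8 + 1) (.reg 8 + 1) (.reg 4) <|
    .seq (.store (.reg 9 * 5 + .reg 10) ((.cell 5 (.reg 10) + .reg 11) % .reg 6))
      (.assign 11 (.reg 11 * (.reg 6 - .reg 12) % .reg 6))

theorem lt_succ_mul_iff_of_dvd {d j k : ℕ} (hd : d ∣ j) (h0 : 0 < d) :
    j < (k + 1) * d ↔ j < k * d ∨ j = k * d := by
  obtain ⟨c, rfl⟩ := hd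
  rw [mul_comm d c, Nat.mul_lt_mul_right h0, Nat.mul_lt_mul_right h0, Nat.mul_left_inj h0.ne']
  omega

/-- Register `11` runs through x, x(-a), x(-a)^2, … while register `10` runs through the multiples
of D + 1 below N; no other index is visited, and no power is computed anew. -/
theorem runs_addMultiples {B U p N D a : ℕ} {s : St} {x : ZMod p} (ha : a < p)
    (h4 : s.reg 4 = N) (h6 : s.reg 6 = p) (h8 : s.reg 8 = D) (h9 : s.reg 9 = U) (h12 : s.reg 12 = a)
    (h11 : s.reg 11 < p) (hx : (s.reg 11 : ZMod p) = x)
    (hNU : N ≤ U) (hpU : p < U) (hDN : D + 1 < N) (hUB : U * 16 < B)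
    (h5 : ∀ j < N, s.mem (U * 5 + j) < p) :
    Runs (Sem.ideal B) .addMultiples s (6 * ((N - 1) / (D + 1)) + 3) fun s' =>
      Frame U [10, 11] [5] s s' ∧ ∀ j < N, s'.mem (U * 5 + j) < p ∧
        (s'.mem (U * 5 + j) : ZMod p) = s.mem (U * 5 + j) +
          if j ≠ 0 ∧ (D + 1) ∣ j then x * (-a) ^ (j / (D + 1) - 1) else 0 := by
  have hp : 0 < p := by omega
  have hcast : ∀ a : ℕ, ((a % p : ℕ) : ZMod p) = a := fun a => ZMod.natCast_mod a p
  set q := (N - 1) / (D + 1) with hq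
  have hq1 : q * (D + 1) ≤ N - 1 := Nat.div_mul_le_self _ _
  have hq2 : N - 1 < (q + 1) * (D + 1) := by
    rw [mul_comm]; exact Nat.lt_mul_div_succ _ (by omega)
  have hkD : ∀ k, (D + 1) + k * (D + 1) = (k + 1) * (D + 1) := fun k => by ring
  have hkq : ∀ k < q, (k + 1) * (D + 1) < N := fun k hk => by
    have : (k + 1) * (D + 1) ≤ q * (D + 1) := Nat.mul_le_mul_right _ (by omega)
    omega
  refine (Runs.stride (fun k s' => s'.reg 10 = (k + 1) * (D + 1) ∧ s'.reg 11 < p ∧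
      (s'.reg 11 : ZMod p) = x * (-a) ^ k ∧ Frame U [10, 11] [5] s s' ∧
      ∀ j < N, s'.mem (U * 5 + j) < p ∧ (s'.mem (U * 5 + j) : ZMod p) = s.mem (U * 5 + j) +
        if j ≠ 0 ∧ (D + 1) ∣ j ∧ j < (k + 1) * (D + 1) then x * (-a) ^ (j / (D + 1) - 1) else 0)
      (D + 1) (D + 1) N q 3 (by simp [h8]) (by omega) (by omega) ?_ (fun k hk => ?_) ?_ ?_ ?_
      ?_).mono_time (by omega)
  · refine ⟨by simp, by simpa using h11, by simp [hx], (Frame.refl ..).setReg _ (by decide),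
      fun j hj => ⟨h5 j hj, ?_⟩⟩
    simp only [St.setReg_mem]
    rw [left_eq_add]
    refine if_neg fun ⟨h1, h2, h3⟩ => ?_
    have := Nat.le_of_dvd (Nat.pos_of_ne_zero h1) h2
    omega
  · rw [hkD]; exact hkq k hk
  · rw [hkD]; omega
  · rintro k s' ⟨h10, -, -, hF, -⟩
    exact ⟨by rw [hkD]; exact h10, by simp [hF.reg 4 (by decide), h4]⟩
  · rintro k hk s' ⟨h10, h11, hx, hF, hI⟩
    have hlt := hkq k hk
    have hF9 := hF.reg 9 (by decide)
    have hF6 := hF.reg 6 (by decide)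
    have hF8 := hF.reg 8 (by decide)
    have hF12 := hF.reg 12 (by decide)
    rw [hkD, hkD]
    generalize hj₀ : (k + 1) * (D + 1) = j₀ at *
    refine .store_seq (U * 5 + j₀) ((s'.mem (U * 5 + j₀) + s'.reg 11) % p)
      (by simp [hF9, h9, h10]) (by simp [hF9, hF6, h9, h6, h10])
      ((Nat.mod_lt _ hp).trans (by omega)) ?_
    refine Runs.assign' (v := s'.reg 11 * (p - a) % p)
      (by simp [hF6, hF12, h6, h12]) ((Nat.mod_lt _ hp).trans (by omega))
      ⟨by simp [hF8, h8], by simp [h10], by simp, by simpa using Nat.mod_lt _ hp, ?_,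
        ((hF.setMem _ (by decide) (by omega)).setReg _ (by decide)).setReg _ (by decide),
        fun j hj => ?_⟩
    · simp only [St.setReg_reg, Nat.reduceEqDiff, if_false, if_true]
      rw [hcast, Nat.cast_mul, hx, Nat.cast_sub ha.le, ZMod.natCast_self]; ring
    · obtain ⟨h1, h2⟩ := hI j hj
      simp only [St.setReg_mem]
      rw [St.setMem_cell _ _ _ _ (by omega) (by omega)]
      by_cases h : j = j₀
      · subst h
        rw [if_pos ⟨rfl, rfl⟩]
        refine ⟨Nat.mod_lt _ hp, ?_⟩
        have h7 : (D + 1) ∣ j := hj₀ ▸ dvd_mul_left _ _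
        have h8 : j ≠ 0 := by rw [← hj₀]; positivity
        rw [if_neg (by omega), add_zero] at h2
        rw [hcast, Nat.cast_add, hx, h2, if_pos ⟨h8, h7, by
          rw [lt_succ_mul_iff_of_dvd h7 (by omega)]; exact .inr hj₀.symm⟩, ← hj₀,
          Nat.mul_div_cancel _ (by omega), Nat.add_sub_cancel]
      · rw [if_neg (by tauto)]
        refine ⟨h1, h2.trans ?_⟩
        congr 1
        refine if_congr (and_congr_right fun _ => and_congr_right fun h7 => ?_) rfl rfl
        rw [lt_succ_mul_iff_of_dvd h7 (by omega), hj₀, or_iff_left h]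
  · rintro s' ⟨-, -, -, hF, hI⟩
    refine ⟨hF, fun j hj => ⟨(hI j hj).1, (hI j hj).2.trans ?_⟩⟩
    congr 1
    exact if_congr (and_congr_right fun _ => and_iff_left (by omega)) rfl rfl

/-- Computes the logarithmic derivative of the generating function with the weights of the
repetition in register `7`. -/
def Prog.logDeriv : Prog :=
  .seq (.assign 22 (.reg 4)) <|
  .seq (.rewrite 5 0) <|
  .upto 8 (.reg 1) <|
    .seq (.assign 12 (.cell 4 (.reg 7 * (.reg 1 + 1) + (.reg 8 + 1)))) <|
    .seq (.assign 11 (.cell 1 (.reg 8 + 1) * (.reg 8 + 1) % .reg 6 * .reg 12 % .reg 6)) <|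
    .addMultiples

/-- The value v takes time proportional to N / v, which adds up to a harmonic sum of order N log t.
The loop runs over v = D + 1, since v = 0 contributes nothing. -/
theorem runs_logDeriv {B U p N t l k : ℕ} {s : St} {μ : ℕ → ℕ} {r : ℕ → ZMod p} (hp : 0 < p)
    (h1 : s.reg 1 = t) (h4 : s.reg 4 = N) (h6 : s.reg 6 = p) (h7 : s.reg 7 = l) (h9 : s.reg 9 = U)
    (hNU : N ≤ U) (hpU : p < U) (htN : t < N) (hl : l * (t + 1) + t < U) (hUB : U * 16 < B)
    (hk : t < 2 ^ k) (hμ : ∀ v ≤ t, s.mem (U * 1 + v) = μ v)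
    (hr : ∀ v ≤ t, s.mem (U * 4 + (l * (t + 1) + v)) < p ∧
      (s.mem (U * 4 + (l * (t + 1) + v)) : ZMod p) = r v) :
    Runs (Sem.ideal B) .logDeriv s (6 * N * k + 10 * t + 8 * N + 13) fun s' =>
      Frame U [8, 10, 11, 12, 22, 24] [5, 10] s s' ∧ ∀ j < N, s'.mem (U * 5 + j) < p ∧
        (s'.mem (U * 5 + j) : ZMod p) = PowerSeries.coeff j (genLog t μ r) := by
  let term (v j : ℕ) : ZMod p :=
    if j ≠ 0 ∧ v ∣ j then μ v * v * r v * (-r v) ^ (j / v - 1) else 0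
  have hterm : ∀ j, PowerSeries.coeff j (genLog t μ r) = ∑ v ∈ range t, term (v + 1) j :=
    fun j => by
    rw [coeff_genLog, Fin.sum_univ_eq_sum_range fun v => term v j, sum_range_succ']
    simp [term]
  simp only [hterm]
  have hcast : ∀ a : ℕ, ((a % p : ℕ) : ZMod p) = a := fun a => ZMod.natCast_mod a p
  unfold Prog.logDeriv
  have htime : ∑ D ∈ range t, ((((N - 1) / (D + 1)) * (3 + 3) + 3 + 2 + 2) + 3) + 3 ≤
      6 * N * k + 10 * t + 3 := by
    have h1 := sum_div_le_of_lt (M := N) hk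
    have h2 : ∑ D ∈ range t, ((((N - 1) / (D + 1)) * (3 + 3) + 3 + 2 + 2) + 3) ≤
        ∑ d ∈ range t, (6 * (N / (d + 1)) + 10) := sum_le_sum fun d _ => by
      have : (N - 1) / (d + 1) ≤ N / (d + 1) := Nat.div_le_div_right (by omega)
      omega
    have h4 : ∑ d ∈ range t, (6 * (N / (d + 1)) + 10) = 6 * ∑ d ∈ range t,
      N / (d + 1) + t * 10 := by
      rw [sum_add_distrib, ← mul_sum]; simp
    have h3 : 6 * N * k = 6 * (N * k) := by ring
    omega
  refine Runs.mono_time (T₁ := ((8 * N + 7) + (6 * N * k + 10 * t + 3) + 1) + 2) ?_ (by omega)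
  refine .assign_seq N (by simp [h4]) (by omega) ?_
  have g₀ : Frame U [8, 10, 11, 12, 22, 24] [5, 10] s (s.setReg 22 N) :=
    (Frame.refl ..).setReg _ (by decide)
  refine .seq_of (6 * N * k + 10 * t + 3) (Runs.rewrite (S := N) (U := U) (fun _ => 0)
    (by simp [h9]) (by simp) hNU (by omega) fun i hi m' hm' => ⟨rfl, by omega⟩) (by omega)
    fun s₁ ⟨hr₁, hm₁⟩ => ?_
  have g₁ : Frame U [8, 10, 11, 12, 22, 24] [5, 10] s s₁ := g₀.trans ⟨fun x hx => hr₁ x fun h => by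
    subst h; exact hx (by decide), fun j hj i hi => by
      simp only [List.mem_cons, List.not_mem_nil, or_false, not_or] at hj
      rw [hm₁ j i hi hj.2, if_neg (by tauto)]⟩
  refine Runs.mono_time ?_ htime
  refine Runs.upto (fun D s' => s'.reg 8 = D ∧ D ≤ t ∧ Frame U [8, 10, 11, 12, 22, 24] [5, 10] s
    s' ∧
    ∀ j < N, s'.mem (U * 5 + j) < p ∧
      (s'.mem (U * 5 + j) : ZMod p) = ∑ v ∈ range D, term (v + 1) j) t _ (by omega)
    ⟨by simp, by omega, g₁.setReg _ (by decide), fun j hj => ?_⟩ ?_ ?_ ?_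
  · simp only [St.setReg_mem]
    rw [hm₁ _ _ (by omega) (by omega), if_pos ⟨rfl, hj⟩]
    exact ⟨hp, by simp⟩
  · rintro D s' ⟨h8, -, hF, -⟩
    exact ⟨h8, by simp [hF.reg 1 (by decide), h1]⟩
  · rintro D hD s' ⟨h8, -, hF, hI⟩
    obtain ⟨hrlt, hrc⟩ := hr (D + 1) (by omega)
    set a := s.mem (U * 4 + (l * (t + 1) + (D + 1))) with ha
    have e4 : s'.mem (U * 4 + (l * (t + 1) + (D + 1))) = a :=
      hF.mem 4 (by decide) _ (by omega)
    have e1 : s'.mem (U * 1 + (D + 1)) = μ (D + 1) := by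
      rw [hF.mem 1 (by decide) _ (by omega), hμ _ (by omega)]
    refine .assign_seq a ?_ (by omega) ?_
    · simp only [Expr.val_cell, Expr.val_add, Expr.val_mul, Expr.val_reg, Expr.val_one,
        hF.reg 9 (by decide), hF.reg 7 (by decide), hF.reg 1 (by decide), h8, h9, h7, h1, e4]
    have g₂ := hF.setReg (x := 12) a (by decide)
    refine .assign_seq (μ (D + 1) * (D + 1) % p * a % p) ?_ ((Nat.mod_lt _ hp).trans (by omega)) ?_
    · simp only [Expr.val_cell, Expr.val_add, Expr.val_mul, Expr.val_mod, Expr.val_reg,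
          Expr.val_one,
        g₂.reg 9 (by decide), g₂.reg 6 (by decide), h9, h6]
      simp only [St.setReg_mem, St.setReg_reg, Nat.reduceEqDiff, if_false, if_true, h8, e1]
    have g₃ := g₂.setReg (x := 11) (μ (D + 1) * (D + 1) % p * a % p) (by decide)
    refine (runs_addMultiples (N := N) (D := D) (U := U)
      (s := (s'.setReg 12 a).setReg 11 (μ (D + 1) * (D + 1) % p * a % p))
      (x := (μ (D + 1) : ZMod p) * ((D + 1 : ℕ) : ZMod p) * r (D + 1)) hrlt
      (by rw [g₃.reg 4 (by decide), h4]) (by rw [g₃.reg 6 (by decide), h6]) (by simp [h8])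
      (by rw [g₃.reg 9 (by decide), h9]) (by simp) (by simpa using Nat.mod_lt _ hp)
      (by simp [hcast, hrc]) hNU hpU (by omega) hUB fun j hj => (hI j hj).1).mono (by omega)
      fun s'' ⟨hF', hI'⟩ => ⟨by simp [hF'.reg 8 (by decide), h8], by simp, hD,
        (g₃.trans (hF'.mono (by decide) (by decide))).setReg _ (by decide),
        fun j hj => ⟨(hI' j hj).1, (hI' j hj).2.trans ?_⟩⟩
    simp only [St.setReg_mem]
    rw [(hI j hj).2, sum_range_succ, hrc]
  · rintro s' ⟨-, -, hF, hI⟩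
    exact ⟨hF, hI⟩

end WordRAM

/-! ### Repetitions and their preparation -/

namespace WordRAM

open Finset SubsetSumSeries PowerSeries

theorem NewtonAgree.frame {U : ℕ} {s s' : St} (h : NewtonAgree U s s') :
    Frame U [13, 14, 15, 16, 17, 18, 19, 20, 21, 22, 23, 24] [2, 6, 7, 9, 10, 11, 12] s s' := by
  refine ⟨fun x hx => h.reg x ?_, fun j hj i hi => ?_⟩
  · simp only [List.mem_cons, List.not_mem_nil, or_false, not_or] at hx; omega
  · simp only [List.mem_cons, List.not_mem_nil, or_false, not_or] at hj
    exact h.mem j i hi hj.1 hj.2.1 hj.2.2.1 hj.2.2.2.1 hj.2.2.2.2.1 hj.2.2.2.2.2.1 hj.2.2.2.2.2.2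

/-- The registers that are used by the repetitions. -/
def repRegs : List ℕ := [7, 8, 10, 11, 12, 13, 14, 15, 16, 17, 18, 19, 20, 21, 22, 23, 24]

/-- The memory regions that are used by the repetitions. -/
def repRegions : List ℕ := [2, 5, 6, 7, 8, 9, 10, 11, 12]

theorem NewtonPre.frame {U B p half K : ℕ} {s s' : St} (h : NewtonPre U B p half K s)
    (hs : Frame U repRegs (4 :: repRegions) s s') : NewtonPre U B p half K s' := by
  have h1 := h.depth
  have h2 := two_pow_le_size h.size
  refine ⟨by rw [hs.reg _ (by decide), h.reg3], by rw [hs.reg _ (by decide), h.reg4],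
    by rw [hs.reg _ (by decide), h.reg6], by rw [hs.reg _ (by decide), h.reg9],
    by rw [hs.reg _ (by decide), h.reg25], fun i hi => ?_, h.prime, h.half, h.p_lt, h.U_lt, h.size,
    h.depth, h.le_p, fun i hi => ?_⟩
  · rw [hs.mem _ (by decide) _ (by omega), h.pow i hi]
  · rw [hs.mem _ (by decide) _ (by omega), h.inv i hi]

/-- One repetition. -/
def Prog.rep : Prog :=
  .seq .logDeriv <|
  .seq .newton <|
  .seq (.assign 22 (.reg 4)) <|
  .rewrite 8 (.less 0 (.cell 8 (.reg 24) + .cell 6 (.reg 24)))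

/-- The time for one repetition. -/
def repTime (K : ℕ) : ℕ := newtonTime K + 6 * 2 ^ K * K + 26 * 2 ^ K + 27

theorem runs_rep {B U p half K t l : ℕ} {s : St} {μ : ℕ → ℕ} {r : ℕ → ZMod p}
    (h : NewtonPre U B p half K s) (h1 : s.reg 1 = t) (h7 : s.reg 7 = l) (hpU : p < U)
    (htN : t < 2 ^ K) (hl : l * (t + 1) + t < U) (hUB : U * 16 < B) (h0 : μ 0 = 0)
    (hμ : ∀ v ≤ t, s.mem (U * 1 + v) = μ v)
    (hr : ∀ v ≤ t, s.mem (U * 4 + (l * (t + 1) + v)) < p ∧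
      (s.mem (U * 4 + (l * (t + 1) + v)) : ZMod p) = r v) :
    Runs (Sem.ideal B) .rep s (repTime K) fun s' => s'.reg 7 = l ∧
      Frame U repRegs repRegions s s' ∧
      ∀ i < 2 ^ K, s'.mem (U * 8 + i) ≠ 0 ↔
        s.mem (U * 8 + i) ≠ 0 ∨ coeff i (gen t μ r) ≠ 0 := by
  have hp := h.prime.pos
  have hU := two_pow_le_size h.size
  unfold Prog.rep
  refine .seq_of (newtonTime K + (8 * 2 ^ K + 7 + 2) + 1) (runs_logDeriv hp h1 h.reg4 h.reg6 h7
    h.reg9 (by omega) hpU htN hl hUB htN hμ hr) (by rw [repTime]; omega) fun s₁ ⟨F₁, hI₁⟩ => ?_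
  have G₁ : Frame U repRegs repRegions s s₁ := F₁.mono (by decide) (by decide)
  have N₁ := h.frame (G₁.mono (by decide) (by decide))
  refine .seq_of (8 * 2 ^ K + 7 + 2) (runs_newton (f := gen t μ r) N₁ ?_
    (coeff_zero_gen t μ r h0)) (by omega) fun s₂ ⟨F₂, hI₂⟩ => ?_
  · have h2 : X ^ 2 ^ K ∣ ser p (Conv.arr U s₁ 5) - genLog t μ r :=
      X_pow_dvd_ser_sub p fun i hi => (hI₁ i hi).2
    rw [euler_gen t μ r h0, ← sub_mul]
    exact (dvd_sub_comm.1 h2).mul_right _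
  have G₂ : Frame U repRegs repRegions s s₂ := G₁.trans (F₂.frame.mono (by decide) (by decide))
  have N₂ := h.frame (G₂.mono (by decide) (by decide))
  refine .assign_seq (2 ^ K) (by simp [N₂.reg4]) (by omega) ?_
  have e8 : ∀ i < U, s₂.mem (U * 8 + i) = s.mem (U * 8 + i) := fun i hi => by
    rw [F₂.frame.mem 8 (by decide) i hi, F₁.mem 8 (by decide) i hi]
  refine (Runs.rewrite (S := 2 ^ K) (U := U)
    (fun i => if 0 < s.mem (U * 8 + i) + s₂.mem (U * 6 + i) then 1 else 0)
    (by simp [N₂.reg9]) (by simp) (by omega) (by omega) fun i hi m' hm' => ⟨?_, ?_⟩).mono le_rfl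
    fun s₃ ⟨hr₃, hm₃⟩ => ⟨?_, G₂.trans ⟨fun x hx => ?_, fun j hj i hi => ?_⟩, fun i hi => ?_⟩
  · simp only [Expr.val_less, Expr.val_zero, Expr.val_add, Expr.val_cell, Expr.val_reg,
      Function.update_apply, if_true, Nat.reduceEqDiff, if_false, St.setReg_reg, N₂.reg9]
    rw [hm' _ (by omega), hm' _ (by omega), St.setReg_mem, e8 i (by omega)]
  · split_ifs <;> omega
  · rw [hr₃ _ (by decide), St.setReg_reg, if_neg (by decide), F₂.frame.reg 7 (by decide),
      F₁.reg 7 (by decide), h7]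
  · rw [hr₃ _ (by rintro rfl; exact hx (by decide)), St.setReg_reg,
      if_neg (by rintro rfl; exact hx (by decide))]
  · rw [hm₃ _ _ hi (by rintro rfl; exact hj (by decide)),
      if_neg (by rintro ⟨rfl, -⟩; exact hj (by decide)), St.setReg_mem]
  · have h2 : coeff i (gen t μ r) = 0 ↔ s₂.mem (U * 6 + i) = 0 := by
      rw [← (hI₂ i hi).1, ZMod.natCast_eq_zero_iff]
      exact ⟨fun h => Nat.eq_zero_of_dvd_of_lt h (hI₂ i hi).2, fun h => h ▸ dvd_zero p⟩
    rw [hm₃ _ _ (by omega) (by decide), if_pos ⟨rfl, hi⟩, Ne, Ne, Ne, h2]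
    split_ifs with h3
    · exact ⟨fun _ => by omega, fun _ h => h⟩
    · omega

/-- All repetitions. -/
def Prog.reps : Prog := .upto 7 (.reg 2) .rep

theorem runs_reps {B U p half K t L : ℕ} {s : St} {μ : ℕ → ℕ} {r : ℕ → ℕ → ZMod p}
    (h : NewtonPre U B p half K s) (h1 : s.reg 1 = t) (h2 : s.reg 2 = L) (hpU : p < U)
    (htN : t < 2 ^ K) (hL : L * (t + 1) ≤ U) (hUB : U * 16 < B) (h0 : μ 0 = 0)
    (hμ : ∀ v ≤ t, s.mem (U * 1 + v) = μ v) (h8 : ∀ i < U, s.mem (U * 8 + i) = 0)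
    (hr : ∀ l < L, ∀ v ≤ t, s.mem (U * 4 + (l * (t + 1) + v)) < p ∧
      (s.mem (U * 4 + (l * (t + 1) + v)) : ZMod p) = r l v) :
    Runs (Sem.ideal B) .reps s (L * (repTime K + 3) + 3) fun s' => s'.reg 1 = t ∧ s'.reg 9 = U ∧
      ∀ i < 2 ^ K, s'.mem (U * 8 + i) ≠ 0 ↔ ∃ l < L, coeff i (gen t μ (r l)) ≠ 0 := by
  have hU := two_pow_le_size h.size
  have hlU : ∀ l < L, l * (t + 1) + t < U := fun l hl => by
    have : (l + 1) * (t + 1) ≤ L * (t + 1) := Nat.mul_le_mul_right _ hl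
    rw [add_mul] at this; omega
  have hLU : L ≤ U := (Nat.le_mul_of_pos_right L (by omega)).trans hL
  refine Runs.mono_time (T₁ := ∑ _i ∈ range L, (repTime K + 3) + 3) ?_ (by simp)
  refine Runs.upto (fun l s' => s'.reg 7 = l ∧ Frame U repRegs repRegions s s' ∧
    ∀ i < 2 ^ K, s'.mem (U * 8 + i) ≠ 0 ↔ ∃ l' < l, coeff i (gen t μ (r l')) ≠ 0) L _ (by omega)
    ⟨by simp, (Frame.refl ..).setReg _ (by decide), fun i hi => by simp [h8 i (by omega)]⟩ ?_ ?_ ?_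
  · rintro l s' ⟨h7, hF, -⟩
    exact ⟨h7, by simp [hF.reg 2 (by decide), h2]⟩
  · rintro l hl s' ⟨h7, hF, hI⟩
    have hlU' := hlU l hl
    refine (runs_rep (μ := μ) (r := r l)
      (h.frame (hF.mono (by decide) (by decide))) (by rw [hF.reg 1 (by decide), h1]) h7 hpU htN
      hlU' hUB h0 (fun v hv => by rw [hF.mem 1 (by decide) _ (by omega), hμ v hv])
      fun v hv => by rw [hF.mem 4 (by decide) _ (by omega)]; exact hr l hl v hv).mono le_rfl
      fun s'' ⟨h7', hF', hI'⟩ => ⟨h7', by simp, (hF.trans hF').setReg _ (by decide), fun i hi => ?_⟩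
    simp only [St.setReg_mem]
    rw [hI' i hi, hI i hi]
    constructor
    · rintro (⟨l', h1, h2⟩ | h)
      · exact ⟨l', by omega, h2⟩
      · exact ⟨l, by omega, h⟩
    · rintro ⟨l', h1, h2⟩
      rcases Nat.lt_succ_iff_lt_or_eq.1 h1 with h1 | rfl
      · exact .inl ⟨l', h1, h2⟩
      · exact .inr h2
  · rintro s' ⟨-, hF, hI⟩
    exact ⟨by rw [hF.reg 1 (by decide), h1], by rw [hF.reg 9 (by decide), h.reg9], hI⟩

/-- The state after the setup, and bounds for the size of the memory regions. -/
structure Fresh (U B n t L K : ℕ) (z : Fin n → ℕ) (s : St) : Prop where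
  reg0 : s.reg 0 = n
  reg1 : s.reg 1 = t
  reg2 : s.reg 2 = L
  reg3 : s.reg 3 = K
  reg4 : s.reg 4 = 2 ^ K
  reg9 : s.reg 9 = U
  input : ∀ i : Fin n, s.mem (U * 0 + i) = min (z i) (t + 1)
  zero : ∀ j i, 0 < j → i < U → s.mem (U * j + i) = 0
  lt : t < 2 ^ K
  le : 2 ^ K ≤ 2 * t
  n_le : n ≤ U
  U_ge : 16 * t + 16 ≤ U
  U_lt : U * 16 < B

/-- The state before the random numbers are drawn. -/
structure Ready (U B n t L K p half : ℕ) (z : Fin n → ℕ) (s : St) : Prop where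
  newton : NewtonPre U B p half K s
  reg1 : s.reg 1 = t
  reg2 : s.reg 2 = L
  reg5 : s.reg 5 = 2 * 2 ^ K
  lt : t < 2 ^ K
  lt_p : 2 * 2 ^ K < p
  p_lt : p < U
  U_lt : U * 16 < B
  count : ∀ v ≤ t, s.mem (U * 1 + v) = min t #{i | z i = v}
  output : ∀ i < U, s.mem (U * 8 + i) = 0

/-- The preparations for the repetitions. -/
def Prog.prep : Prog :=
  .seq (.assign 5 (2 * .reg 4)) <|
  .seq (.assign 11 (2 * .reg 5 + 1)) <|
  .seq .sieve <|
  .seq .findPrime <|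
  .seq .inverses <|
  .seq .powers <|
  .seq .count <|
  .assign 25 ((.reg 6 + 1) / 2)

/-- The number m = 2 · 2^K of possible weights exceeds 2t, as Schwartz–Zippel requires, and is a
power of two, so that reducing a random word modulo m leaves no bias. The prime is taken from (m,
2m]: then different weights are different residues, and p exceeds all indices and multiplicities. -/
theorem runs_prep {U B n t L K : ℕ} {z : Fin n → ℕ} {s : St} (h : Fresh U B n t L K z s)
    (hsize : 2 ^ (K + 1) * 2 ^ Nat.clog 2 (K + 1) ≤ U) (hdepth : 8 * (K + 1) ≤ U) :
    Runs (Sem.ideal B) .prep s (120 * 2 ^ K * (K + 1) + 4 * n + 60) fun s' =>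
      ∃ p half, Ready U B n t L K p half z s' := by
  obtain ⟨h0, h1, h2, h3, h4, h9, hz, hzero, hlt, hle, hnU, hU, hUB⟩ := h
  have hN := two_pow_le_size hsize
  have hN0 : 0 < 2 ^ K := by positivity
  have hK2 : 2 ^ (K + 1) = 2 * 2 ^ K := pow_succ' 2 K
  have hK3 : 2 ^ (K + 3) = 8 * 2 ^ K := by rw [pow_add]; ring
  unfold Prog.prep
  have htime : (4 * (4 * 2 ^ K + 1) * (K + 3) + 6 * (4 * 2 ^ K + 1) + 3) + (2 * (2 * 2 ^ K) + 3) +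
      (4 * 2 ^ K + 3) + (4 * K + 11) + (4 * n + 3) + 20 ≤ 120 * 2 ^ K * (K + 1) + 4 * n + 60 := by
    have : K ≤ 2 ^ K * K := Nat.le_mul_of_pos_left _ hN0
    ring_nf; nlinarith
  refine Runs.mono_time ?_ htime
  set T₁ := 4 * (4 * 2 ^ K + 1) * (K + 3) + 6 * (4 * 2 ^ K + 1) + 3
  refine Runs.mono_time (T₁ := (T₁ + ((2 * (2 * 2 ^ K) + 3) + ((4 * 2 ^ K + 3) + ((4 * K + 11) +
    ((4 * n + 3) + 1 + 1) + 1) + 1) + 1) + 1) + 2 + 2) ?_ (by omega)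
  refine .assign_seq (2 * 2 ^ K) (by simp [h4]) (by omega) ?_
  refine .assign_seq (4 * 2 ^ K + 1) (by simp; ring) (by omega) ?_
  set s₀ := (s.setReg 5 (2 * 2 ^ K)).setReg 11 (4 * 2 ^ K + 1) with hs₀
  let R := [5, 11, 8, 10, 6, 24]
  let J := [13, 3, 14, 1]
  have F₀ : Frame U R J s s₀ := ((Frame.refl ..).setReg _ (by decide)).setReg _ (by decide)
  refine .seq_of _ (runs_sieve (U := U) (N := 4 * 2 ^ K + 1) (k := K + 3)
    (by rw [F₀.reg 9 (by decide), h9]) (by simp [hs₀]) (by omega) (by omega) hUB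
    (by omega) fun i hi => hzero _ _ (by omega) hi) le_rfl fun s₁ ⟨f₁, hsieve⟩ => ?_
  have F₁ : Frame U R J s s₁ := F₀.trans (f₁.mono (by decide) (by decide))
  refine .seq_of _ (runs_findPrime (U := U) (N := 4 * 2 ^ K + 1) (m := 2 * 2 ^ K)
    (by rw [F₁.reg 9 (by decide), h9]) (by rw [f₁.reg 5 (by decide)]; simp [hs₀]) (by omega)
    (by omega) (by omega) hUB hsieve) le_rfl fun s₂ ⟨f₂, hp, hmp, hpm⟩ => ?_
  have F₂ : Frame U R J s s₂ := F₁.trans (f₂.mono (by decide) (by decide))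
  have h5 : s₂.reg 5 = 2 * 2 ^ K := by
    rw [f₂.reg 5 (by decide), f₁.reg 5 (by decide)]; simp [hs₀]
  generalize h6 : s₂.reg 6 = p at hp hmp hpm
  refine .seq_of _ (runs_inverses (U := U) (N := 2 ^ K) hp (by rw [F₂.reg 4 (by decide), h4]) h6
    (by rw [F₂.reg 9 (by decide), h9]) (by omega) (by omega) hUB fun i hi => by
      rw [f₂.mem 3 (by decide) i hi, f₁.mem 3 (by decide) i hi]; exact hzero _ _ (by omega) hi)
    le_rfl fun s₃ ⟨f₃, hinv⟩ => ?_
  have F₃ : Frame U R J s s₃ := F₂.trans (f₃.mono (by decide) (by decide))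
  refine .seq_of _ (runs_powers (U := U) (K := K) (by rw [F₃.reg 3 (by decide), h3])
    (by rw [F₃.reg 9 (by decide), h9]) (by omega) (by omega) hUB fun i hi => by
      rw [f₃.mem 14 (by decide) i hi, f₂.mem 14 (by decide) i hi, f₁.mem 14 (by decide) i hi]
      exact hzero _ _ (by omega) hi)
    le_rfl fun s₄ ⟨f₄, hpow⟩ => ?_
  have F₄ : Frame U R J s s₄ := F₃.trans (f₄.mono (by decide) (by decide))
  refine .seq_of 1 (runs_count (U := U) (n := n) (t := t) (z := z)
    (by rw [F₄.reg 0 (by decide), h0]) (by rw [F₄.reg 1 (by decide), h1])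
    (by rw [F₄.reg 9 (by decide), h9]) hUB hnU (by omega)
    (fun i => by rw [F₄.mem 0 (by decide) _ (by omega)]; exact hz i)
    fun i hi => by
      rw [f₄.mem 1 (by decide) i hi, f₃.mem 1 (by decide) i hi, f₂.mem 1 (by decide) i hi,
        f₁.mem 1 (by decide) i hi]
      exact hzero _ _ (by omega) hi)
    le_rfl fun s₅ ⟨f₅, hcount⟩ => ?_
  have F₅ : Frame U R J s s₅ := F₄.trans (f₅.mono (by decide) (by decide))
  have h6' : s₅.reg 6 = p := by
    rw [f₅.reg 6 (by decide), f₄.reg 6 (by decide), f₃.reg 6 (by decide), h6]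
  refine Runs.assign' (v := (p + 1) / 2) (by simp [h6']) (by omega) ⟨p, (p + 1) / 2, ⟨by
    simp [F₅.reg 3 (by decide), h3], by simp [F₅.reg 4 (by decide), h4], by simp [h6'],
    by simp [F₅.reg 9 (by decide), h9], by simp, fun i hi => ?_, hp, ?_, by omega, by omega, hsize,
    hdepth, by omega, fun i hi => ?_⟩, by simp [F₅.reg 1 (by decide), h1],
    by simp [F₅.reg 2 (by decide), h2], ?_, hlt, hmp, by omega, hUB, hcount, fun i hi => ?_⟩
  · rw [St.setReg_mem, f₅.mem 14 (by decide) i (by omega), hpow i hi]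
  · have hodd : p % 2 = 1 := hp.eq_two_or_odd.resolve_left (by omega)
    have : (p + 1) / 2 * 2 = p + 1 := by omega
    rw [this, Nat.add_mod_left, Nat.mod_eq_of_lt (by omega)]
  · rw [St.setReg_mem, f₅.mem 3 (by decide) i (by omega), f₄.mem 3 (by decide) i (by omega),
      hinv i hi]
  · rw [St.setReg_reg, if_neg (by decide), f₅.reg 5 (by decide), f₄.reg 5 (by decide),
      f₃.reg 5 (by decide), h5]
  · rw [St.setReg_mem, F₅.mem 8 (by decide) i hi]; exact hzero _ _ (by omega) hi

end WordRAM

/-! ### Uniform distributions: residues and product spaces -/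

namespace PMF

open Finset

theorem uniform_map_mod {M q m : ℕ} [Nonempty (Fin M)] [Nonempty (Fin m)] (h : M = q * m)
    (hm : 0 < m) :
    (uniformOfFintype (Fin M)).map (fun r : Fin M => (⟨(r : ℕ) % m, Nat.mod_lt _ hm⟩ : Fin m)) =
      uniformOfFintype (Fin m) := by
  subst h
  have hq : q ≠ 0 := by
    rintro rfl
    obtain ⟨x⟩ : Nonempty (Fin (0 * m)) := inferInstance
    exact absurd x.2 (by simp)
  ext b
  rw [map_apply, tsum_fintype, ← finProdFinEquiv.sum_comp, Fintype.sum_prod_type]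
  have : ∀ x : Fin q × Fin m, (⟨(finProdFinEquiv x : ℕ) % m, Nat.mod_lt _ hm⟩ : Fin m) = x.2 :=
    fun x =>
    Fin.ext (by simp [Nat.add_mul_mod_self_left, Nat.mod_eq_of_lt])
  simp only [this, uniformOfFintype_apply, sum_ite_eq, mem_univ, if_true, sum_const, card_univ,
    Fintype.card_fin, nsmul_eq_mul, Nat.cast_mul]
  rw [ENNReal.mul_inv (.inl (by exact_mod_cast hq)) (.inl (ENNReal.natCast_ne_top q)), ← mul_assoc,
    ENNReal.mul_inv_cancel (by exact_mod_cast hq) (ENNReal.natCast_ne_top q), one_mul]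

theorem uniform_snoc {X : Type} [Fintype X] [Nonempty X] (j : ℕ) :
    (uniformOfFintype (Fin j → X)).bind (fun ρ => (uniformOfFintype X).map
      fun x => (Fin.snoc ρ x : Fin (j + 1) → X)) = uniformOfFintype (Fin (j + 1) → X) := by
  classical
  ext f
  rw [bind_apply, tsum_eq_single (Fin.init f), map_apply, tsum_eq_single (f (Fin.last j))]
  · simp only [Fin.snoc_init_self, if_true, uniformOfFintype_apply, Fintype.card_fun,
      Fintype.card_fin, pow_succ, Nat.cast_mul]
    rw [ENNReal.mul_inv (.inr (ENNReal.natCast_ne_top _)) (.inl (ENNReal.natCast_ne_top _))]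
  · intro x hx
    rw [if_neg]
    intro h; apply hx; rw [h]; simp
  · intro ρ hρ
    rw [map_apply, ENNReal.tsum_eq_zero.2, mul_zero]
    intro x
    rw [if_neg]
    intro h; apply hρ; rw [h]; simp

end PMF

/-! ### Randomized runs and the loop that draws the weights -/

namespace WordRAM

theorem run_add (w a b : ℕ) (σ : Config) : run w (a + b) σ = (run w a σ).bind (run w b) := by
  induction a generalizing σ with
  | zero => rw [zero_add, run, PMF.pure_bind]
  | succ a ih =>
      rw [Nat.add_right_comm, run, run, PMF.bind_bind]
      congr 1
      funext σ'
      exact ih σ'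

theorem run_halted (w T : ℕ) (s : St) : run w T (conf [] s) = PMF.pure (conf [] s) := by
  induction T with
  | zero => rfl
  | succ T ih => rw [run, step, conf, PMF.pure_bind]; exact ih

theorem To.real {B w T : ℕ} {k k' : List Prog} {s : St} {Q : St → Prop} (hB : 2 ≤ B)
    (h : To (Sem.ideal B) T k s k' Q) (hs : s.Bdd B) (hk : ∀ p ∈ k, B ^ p.wt ≤ 2 ^ w) :
    To (Sem.real w) T k s k' fun s' => Q s' ∧ s'.Bdd B := by
  obtain ⟨T', hT, s', hr, hq⟩ := h
  obtain ⟨h1, h2⟩ := hr.real_of_ideal hB hs hk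
  exact ⟨T', hT, s', h1, hq, h2⟩

theorem To.condT {M : Sem} {T : ℕ} {k k' : List Prog} {s : St} {Q : St → Prop} {e : Expr}
    {p q : Prog} (he : M.ev e s ≠ 0) (h : To M T (p :: k) s k' Q) :
    To M (T + 1) (.cond e p q :: k) s k' Q := by
  obtain ⟨t, ht, s', hr, hq⟩ := h
  exact ⟨t + 1, by omega, s', .condT _ _ _ he hr, hq⟩

theorem To.condF {M : Sem} {T : ℕ} {k k' : List Prog} {s : St} {Q : St → Prop} {e : Expr}
    {p q : Prog} (he : M.ev e s = 0) (h : To M T (q :: k) s k' Q) :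
    To M (T + 1) (.cond e p q :: k) s k' Q := by
  obtain ⟨t, ht, s', hr, hq⟩ := h
  exact ⟨t + 1, by omega, s', .condF _ _ _ he hr, hq⟩

/-- Within `T` steps the machine comes from `(k, s)` to `k'` and a state that depends on a uniformly
random element `ρ` of `Ω` and satisfies `Q ρ`. -/
def Spreads (w T : ℕ) (k : List Prog) (s : St) (Ω : Type) [Fintype Ω] [Nonempty Ω] (k' : List Prog)
    (Q : Ω → St → Prop) : Prop :=
  ∃ T₁ T₂, T₁ + T₂ ≤ T ∧ ∃ (k₁ : List Prog) (σ : Ω → St),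
    run w T₁ (conf k s) = (PMF.uniformOfFintype Ω).map (fun ρ => conf k₁ (σ ρ)) ∧
    ∀ ρ, To (Sem.real w) T₂ k₁ (σ ρ) k' (Q ρ)

section

variable {w T T₁ T₂ : ℕ} {k k₁ k' : List Prog} {s : St} {Ω : Type} [Fintype Ω] [Nonempty Ω]
  {Q Q' : Ω → St → Prop} {R : St → Prop}

theorem Spreads.of_to (h : To (Sem.real w) T k s k' R) :
    Spreads w T k s Unit k' fun _ => R :=
  ⟨0, T, by omega, k, fun _ => s, (PMF.map_const _ _).symm, fun _ => h⟩

theorem Spreads.mono (h : Spreads w T₁ k s Ω k' Q) (hT : T₁ ≤ T) : Spreads w T k s Ω k' Q := by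
  obtain ⟨a, b, h1, h2⟩ := h
  exact ⟨a, b, by omega, h2⟩

theorem Spreads.prepend (h : To (Sem.real w) T₁ k s k₁ R)
    (h' : ∀ s', R s' → Spreads w T₂ k₁ s' Ω k' Q) : Spreads w (T₁ + T₂) k s Ω k' Q := by
  obtain ⟨t, ht, s', hr, hR⟩ := h
  obtain ⟨a, b, hab, k₂, σ, h1, h2⟩ := h' s' hR
  refine ⟨t + a, b, by omega, k₂, σ, ?_, h2⟩
  rw [run_add, hr.run_real, PMF.pure_bind, h1]

theorem Spreads.append (h : Spreads w T₁ k s Ω k₁ Q)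
    (h' : ∀ ρ s', Q ρ s' → To (Sem.real w) T₂ k₁ s' k' (Q' ρ)) :
    Spreads w (T₁ + T₂) k s Ω k' Q' := by
  obtain ⟨a, b, hab, k₂, σ, h1, h2⟩ := h
  exact ⟨a, b + T₂, by omega, k₂, σ, h1, fun ρ => (h2 ρ).trans (h' ρ)⟩

/-- The deterministic continuation may take a different time for each `ρ`; a halted machine does not
change, so one common time serves all outcomes. -/
theorem Spreads.halt (h : Spreads w T k s Ω [] Q) : ∃ σ : Ω → St,
    run w T (conf k s) = (PMF.uniformOfFintype Ω).map (fun ρ => conf [] (σ ρ)) ∧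
    ∀ ρ, Q ρ (σ ρ) := by
  obtain ⟨a, b, hab, k₂, σ, h1, h2⟩ := h
  choose t ht σ' hr hQ using h2
  refine ⟨σ', ?_, hQ⟩
  obtain ⟨c, rfl⟩ := Nat.exists_eq_add_of_le hab
  rw [add_assoc, run_add, h1, PMF.bind_map, PMF.map]
  congr 1
  funext ρ
  have e : b + c = t ρ + (b + c - t ρ) := by have := ht ρ; omega
  simp only [Function.comp_apply]
  rw [e, run_add, (hr ρ).run_real, PMF.pure_bind, run_halted]

end

/-- The loop that draws random numbers. -/
def Prog.drawLoop : Prog :=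
  .loop (.less (.reg 10) (.reg 2 * (.reg 1 + 1))) <|
    .seq (.rand 12) <|
    .seq (.assign 12 (.reg 12 % .reg 5)) <|
    .seq (.store (.reg 9 * 4 + .reg 10) (.reg 12)) <|
    .seq (.assign 10 (.reg 10 + 1)) (.assign 12 0)

/-- Draws the random numbers for all repetitions. -/
def Prog.draw : Prog := .seq (.assign 10 0) (.seq (.assign 12 0) .drawLoop)

/-- The state after random numbers have been drawn. -/
def drawn (U m : ℕ) (s : St) (j : ℕ) (ρ : Fin j → Fin m) : St :=
  ⟨fun x => if x = 10 then j else if x = 12 then 0 else s.reg x,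
    fill s.mem (U * 4) j fun i => if h : i < j then ρ ⟨i, h⟩ else 0⟩

theorem drawn_bdd {B U m j : ℕ} {s : St} (hs : s.Bdd B) (hj : j < B) (hm : m ≤ B)
    (ρ : Fin j → Fin m) :
    (drawn U m s j ρ).Bdd B := by
  refine ⟨fun x => ?_, fun a => ?_⟩
  · simp only [drawn]
    split_ifs
    · exact hj
    · omega
    · exact hs.1 x
  · simp only [drawn, fill]
    split_ifs with h1 h2
    · exact (ρ _).2.trans_le hm
    · omega
    · exact hs.2 a

theorem Reach.assign_eq {M : Sem} {T v x : ℕ} {k k' : List Prog} {s s' : St} {e : Expr}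
    (he : M.ev e s = v) (hv : M.ok v) (h : Reach M T k (s.setReg x v) k' s') :
    Reach M (T + 1) (.assign x e :: k) s k' s' := by
  subst he; exact .assign _ _ hv h

theorem Reach.store_eq {M : Sem} {T a v : ℕ} {k k' : List Prog} {s s' : St} {d e : Expr}
    (hd : M.ev d s = a) (he : M.ev e s = v) (hv : M.ok v) (h : Reach M T k (s.setMem a v) k' s') :
    Reach M (T + 1) (.store d e :: k) s k' s' := by
  subst hd he; exact .store _ _ hv h

/-- Clearing register `12` at the end of a round removes the last trace of the random word, so the
state is a function of the residues alone. -/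
theorem drawn_succ {U m j : ℕ} (s : St) (ρ : Fin j → Fin m) (x : Fin m) (r : ℕ) :
    ((((((drawn U m s j ρ).setReg 12 r).setReg 12 x).setMem (U * 4 + j) x).setReg 10 (j + 1)).setReg
      12 0) = drawn U m s (j + 1) (Fin.snoc ρ x) := by
  ext a
  · simp only [St.setReg_reg, St.setMem_reg, drawn]
    split_ifs <;> first | rfl | omega
  · simp only [St.setReg_mem, St.setMem_mem, drawn, fill]
    by_cases h : a = U * 4 + j
    · subst h
      rw [if_pos rfl, if_pos (by omega), dif_pos (by omega)]
      have : (⟨U * 4 + j - U * 4, by omega⟩ : Fin (j + 1)) = Fin.last j := Fin.ext (by simp)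
      rw [this, Fin.snoc_last]
    · rw [if_neg h]
      by_cases h1 : U * 4 ≤ a ∧ a < U * 4 + j
      · rw [if_pos h1, if_pos (by omega), dif_pos (by omega), dif_pos (by omega)]
        have : (⟨a - U * 4, by omega⟩ : Fin (j + 1)) = Fin.castSucc ⟨a - U * 4, by omega⟩ := rfl
        rw [this, Fin.snoc_castSucc]
      · rw [if_neg h1, if_neg (by omega)]

/-- A random word can exceed `B`, so between its drawing and its reduction the semantics of words
has to be used directly (`r3`); afterwards all values are small again and exact arithmetic applies
(`r4`). As m divides 2^w, the residue is uniform. -/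
theorem run_drawLoop_step {B w U m t L j : ℕ} {s : St} {k : List Prog} [Nonempty (Fin m)]
    (hs : s.Bdd B)
    (h1 : s.reg 1 = t) (h2 : s.reg 2 = L) (h5 : s.reg 5 = m) (h9 : s.reg 9 = U) (hm : 0 < m)
    (hmB : m < B) (hmw : m ∣ 2 ^ w) (hL : L * (t + 1) ≤ U) (hUB : U * 16 < B)
    (hw : ∀ p ∈ Prog.drawLoop :: k, B ^ p.wt ≤ 2 ^ w) (hj : j < L * (t + 1)) (ρ : Fin j → Fin m) :
    run w 10 (conf (.drawLoop :: k) (drawn U m s j ρ)) = (PMF.uniformOfFintype (Fin m)).map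
      fun x => conf (.drawLoop :: k) (drawn U m s (j + 1) (Fin.snoc ρ x)) := by
  have hB : 2 ≤ B := by omega
  have hb := drawn_bdd (U := U) hs (by omega : j < B) hmB.le ρ
  set rest' : Prog := .seq (.store (.reg 9 * 4 + .reg 10) (.reg 12)) <|
    .seq (.assign 10 (.reg 10 + 1)) (.assign 12 0) with hrest'
  set rest : Prog := .seq (.assign 12 (.reg 12 % .reg 5)) rest' with hrest
  have r1 : run w 2 (conf (.drawLoop :: k) (drawn U m s j ρ)) =
      PMF.pure (conf (.rand 12 :: rest :: .drawLoop :: k) (drawn U m s j ρ)) := by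
    refine (Reach.real_of_ideal hB (.loopT _ _ ?_ (.seq _ _ (.refl _ _))) hb hw).1.run_real
    simp [Sem.ideal, drawn, h1, h2, hj]
  have r2 : ∀ r : Fin (2 ^ w), run w 7 (conf (rest :: .drawLoop :: k)
      ((drawn U m s j ρ).setReg 12 r)) = PMF.pure (conf (.drawLoop :: k)
        (drawn U m s (j + 1) (Fin.snoc ρ ⟨r % m, Nat.mod_lt _ hm⟩))) := by
    intro r
    have hrm : (r : ℕ) % m < m := Nat.mod_lt _ hm
    set s₁ := ((drawn U m s j ρ).setReg 12 r).setReg 12 (r % m) with hs₁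
    have hs₁b : s₁.Bdd B := by
      refine ⟨fun x => ?_, hb.2⟩
      simp only [hs₁, St.setReg_reg]
      split_ifs
      · omega
      · exact hb.1 x
    have r3 : Reach (Sem.real w) 2 (rest :: .drawLoop :: k) ((drawn U m s j ρ).setReg 12 r)
        (rest' :: .drawLoop :: k) s₁ := by
      refine .seq _ _ (.assign_eq ?_ trivial (.refl _ _))
      change ((drawn U m s j ρ).setReg 12 r).reg 12 % ((drawn U m s j ρ).setReg 12 r).reg 5 = _
      simp [drawn, h5]
    have r4 : Reach (Sem.ideal B) 5 (rest' :: .drawLoop :: k) s₁ (.drawLoop :: k)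
        (drawn U m s (j + 1) (Fin.snoc ρ ⟨r % m, hrm⟩)) := by
      rw [← drawn_succ s ρ ⟨r % m, hrm⟩ r]
      have hjB : j + 1 < B := by omega
      refine .seq _ _ (.store_eq (a := U * 4 + j) (v := r % m) ?_ ?_ (hrm.trans hmB)
        (.seq _ _ (.assign_eq (v := j + 1) ?_ hjB (.assign_eq (v := 0) rfl ?_ (.refl _ _)))))
      · simp [Sem.ideal, hs₁, drawn, h9]
      · simp [Sem.ideal, hs₁]
      · simp [Sem.ideal, hs₁, drawn]
      · simp only [Sem.ideal]; omega
    refine (r3.trans (Reach.real_of_ideal hB r4 hs₁b fun p hp => ?_).1).run_real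
    · rcases List.mem_cons.1 hp with rfl | hp
      · refine le_trans (Nat.pow_le_pow_right (by omega) ?_) (hw _ List.mem_cons_self)
        simp only [Prog.drawLoop, Prog.wt, hrest']; omega
      · exact hw p hp
  rw [show 10 = 2 + (1 + 7) from rfl, run_add, r1, PMF.pure_bind, run_add]
  have e : run w 1 (conf (.rand 12 :: rest :: .drawLoop :: k) (drawn U m s j ρ)) =
      (PMF.uniformOfFintype (Fin (2 ^ w))).map fun r : Fin (2 ^ w) =>
        conf (rest :: .drawLoop :: k) ((drawn U m s j ρ).setReg 12 r) := by
    rw [run, show run w 0 = PMF.pure from funext fun σ => rfl, PMF.bind_pure]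
    refine Eq.trans (b := ((PMF.uniformOfFintype (Fin (2 ^ w))).bind fun r => PMF.pure (r : ℕ)).map
      fun r => conf (rest :: .drawLoop :: k) ((drawn U m s j ρ).setReg 12 r)) rfl ?_
    rw [PMF.map_bind, PMF.map]
    congr 1
    funext r
    rw [PMF.pure_map]; rfl
  obtain ⟨q, hq⟩ := hmw
  rw [e, PMF.bind_map, ← PMF.uniform_map_mod (M := 2 ^ w) (q := q) (by rw [hq, mul_comm]) hm,
    PMF.map_comp, PMF.map]
  congr 1
  funext r
  exact r2 r

theorem run_drawLoop {B w U m t L : ℕ} {s : St} {k : List Prog} [Nonempty (Fin m)] (hs : s.Bdd B)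
    (h1 : s.reg 1 = t) (h2 : s.reg 2 = L) (h5 : s.reg 5 = m) (h9 : s.reg 9 = U) (hm : 0 < m)
    (hmB : m < B) (hmw : m ∣ 2 ^ w) (hL : L * (t + 1) ≤ U) (hUB : U * 16 < B)
    (hw : ∀ p ∈ Prog.drawLoop :: k, B ^ p.wt ≤ 2 ^ w) (σ₀ : St)
    (hσ₀ : ∀ ρ : Fin 0 → Fin m, drawn U m s 0 ρ = σ₀) (j : ℕ) (hj : j ≤ L * (t + 1)) :
    run w (10 * j) (conf (.drawLoop :: k) σ₀) = (PMF.uniformOfFintype (Fin j → Fin m)).map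
      fun ρ => conf (.drawLoop :: k) (drawn U m s j ρ) := by
  induction j with
  | zero =>
      simp only [hσ₀]
      exact (PMF.map_const _ _).symm
  | succ j ih =>
      rw [mul_add, mul_one, run_add, ih (by omega), PMF.bind_map, ← PMF.uniform_snoc, PMF.map_bind]
      congr 1
      funext ρ
      rw [Function.comp_apply, run_drawLoop_step hs h1 h2 h5 h9 hm hmB hmw hL hUB hw (by omega) ρ,
        PMF.map_comp]
      rfl

/-- The random numbers are drawn independently and uniformly. -/
theorem spreads_draw {B w U m t L : ℕ} {s : St} {k : List Prog} [Nonempty (Fin m)] (hs : s.Bdd B)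
    (h1 : s.reg 1 = t) (h2 : s.reg 2 = L) (h5 : s.reg 5 = m) (h9 : s.reg 9 = U) (hm : 0 < m)
    (hmB : m < B) (hmw : m ∣ 2 ^ w) (hL : L * (t + 1) ≤ U) (hUB : U * 16 < B)
    (hw : ∀ p ∈ Prog.draw :: k, B ^ p.wt ≤ 2 ^ w) :
    Spreads w (10 * (L * (t + 1)) + 5) (.draw :: k) s (Fin (L * (t + 1)) → Fin m) k
      fun ρ s' => s' = drawn U m s (L * (t + 1)) ρ ∧ s'.Bdd B := by
  have hB : 2 ≤ B := by omega
  have hw' : ∀ p ∈ Prog.drawLoop :: k, B ^ p.wt ≤ 2 ^ w := fun p hp => by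
    rcases List.mem_cons.1 hp with rfl | hp
    · refine le_trans (Nat.pow_le_pow_right (by omega) ?_) (hw _ List.mem_cons_self)
      simp only [Prog.draw, Prog.wt]; omega
    · exact hw p (List.mem_cons_of_mem _ hp)
  have r1 : To (Sem.ideal B) 4 (.draw :: k) s (.drawLoop :: k)
      fun s' => s' = (s.setReg 10 0).setReg 12 0 := by
    refine ⟨4, le_rfl, _, .seq _ _ (.assign_eq (v := 0) rfl ?_ (.seq _ _ (.assign_eq (v := 0) rfl ?_
      (.refl _ _)))), rfl⟩ <;> simp only [Sem.ideal] <;> omega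
  refine (Spreads.prepend (T₁ := 4) (T₂ := 10 * (L * (t + 1)) + 1) (r1.real hB hs hw) ?_).mono
    (by omega)
  rintro _ ⟨rfl, -⟩
  refine ⟨10 * (L * (t + 1)), 1, le_rfl, _, _, run_drawLoop hs h1 h2 h5 h9 hm hmB hmw hL hUB hw' _
    (fun ρ => ?_) _ le_rfl, fun ρ => ?_⟩
  · simp only [drawn, fill_zero]
    ext x
    · simp only [St.setReg_reg]
      split_ifs <;> rfl
    · rfl
  · refine To.real hB (To.loopF (T := 0) ?_ (.refl rfl)) (drawn_bdd hs (by omega) hmB.le ρ) hw'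
    simp [Sem.ideal, drawn, h1, h2]

end WordRAM

/-! ### The algorithm on capped input and its cases -/

namespace WordRAM

open Finset SubsetSumSeries

/-- The algorithm for a single number. -/
def Prog.single : Prog :=
  .seq (.store 1 1) (.seq (.store (1 + .load 0) 1) (.assign 0 1))

/-- For n = 1 the bound with the factor log n allows constant time only. As unused memory is zero,
two marks complete the vector, which starts at address 1. A number above t has been capped to t + 1,
and its mark falls just behind the vector. -/
theorem runs_single {B t : ℕ} {s : St} {z : Fin 1 → ℕ} (hz : 0 < z 0) (htB : t + 2 < B)
    (h1 : s.reg 1 = t)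
    (hmem : ∀ a, s.mem a = if h : a < 1 then min (z ⟨a, h⟩) (t + 1) else 0) :
    Runs (Sem.ideal B) .single s 5 fun s' => s'.reg 1 = t ∧ s'.reg 0 + t < B ∧
      ∀ i ≤ t, s'.mem (s'.reg 0 + i) ≠ 0 ↔ i ∈ subsetSums z t := by
  have h0 : s.mem 0 = min (z 0) (t + 1) := hmem 0
  unfold Prog.single
  refine Runs.mono_time (T₁ := 1 + 2 + 2) ?_ le_rfl
  refine .store_seq 1 1 rfl rfl (by omega) (.store_seq (1 + min (z 0) (t + 1)) 1 ?_ rfl (by omega)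
    (Runs.assign' (v := 1) rfl (by omega) ⟨by simp [h1], by simp; omega, fun i hi => ?_⟩))
  · simp [h0]
  · simp only [St.setReg_mem, St.setReg_reg, if_true, St.setMem_mem]
    have h2 : i ∈ subsetSums z t ↔ i = 0 ∨ i = z 0 := by
      constructor
      · rintro ⟨-, Y, hY⟩
        rcases Y.eq_empty_or_nonempty with rfl | ⟨y, hy⟩
        · exact .inl (by simpa using hY.symm)
        · have : Y = {0} := by
            ext a; rw [Subsingleton.elim a y, Subsingleton.elim (0 : Fin 1) y]; simp [hy]
          rw [this, sum_singleton] at hY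
          exact .inr hY.symm
      · rintro (rfl | rfl)
        · exact ⟨hi, ∅, by simp⟩
        · exact ⟨hi, {0}, by simp⟩
    rw [h2, hmem, dif_neg (show ¬ 1 + i < 1 by omega)]
    split_ifs with h3 h4
    · exact ⟨fun _ => by omega, fun _ => by omega⟩
    · exact ⟨fun _ => by omega, fun _ => by omega⟩
    · exact ⟨fun h => absurd rfl h, fun h => by omega⟩

/-- The deterministic algorithm for several numbers. -/
def Prog.exact : Prog := .seq .dp (.assign 0 (.reg 9 * 8))

/-- The randomized algorithm for several numbers. -/
def Prog.random : Prog := .seq .prep (.seq .draw (.seq .reps (.assign 0 (.reg 9 * 8))))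

/-- The algorithm, when large inputs have been replaced by smaller ones. -/
def Prog.core : Prog :=
  .cond (.less (.reg 0) 2) .single <|
  .seq .setup <|
  .cond (.less (.reg 1) 2 + (.less (.reg 0) (.reg 3 + 1) + .less (.reg 0) (.reg 2 + 1)))
    .exact .random

/-- The time for the algorithm. -/
def coreTime (n t L : ℕ) : ℕ :=
  if n < 2 then 6
  else if t < 2 ∨ n ≤ Nat.clog 2 (t + 1) ∨ n ≤ L then n * (8 * t + 18) + 5 * Nat.clog 2 (t + 1) + 20
  else 125 * 2 ^ Nat.clog 2 (t + 1) * (Nat.clog 2 (t + 1) + 1) + 4 * n + 100 + 10 * (L * (t + 1)) +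
    L * (repTime (Nat.clog 2 (t + 1)) + 3)

/-- The output of the algorithm. -/
def Output (B t : ℕ) (out : Set ℕ) (s : St) : Prop :=
  s.reg 1 = t ∧ s.reg 0 + t < B ∧ s.Bdd B ∧ ∀ i ≤ t, s.mem (s.reg 0 + i) ≠ 0 ↔ i ∈ out

theorem spreads_random {w B U n t L K p half : ℕ} {z : Fin n → ℕ} {k : List Prog} {s : St}
    (hz : ∀ i, 0 < z i) (hs : s.Bdd B) (h : Ready U B n t L K p half z s)
    (hL : L * (t + 1) ≤ U) (ht : 16 * t + 16 ≤ U) (hmw : 2 * 2 ^ K ∣ 2 ^ w)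
    (hw : ∀ p ∈ Prog.draw :: .seq .reps (.assign 0 (.reg 9 * 8)) :: k, B ^ p.wt ≤ 2 ^ w) :
    ∃ (Ω : Type) (_ : Fintype Ω) (_ : Nonempty Ω) (out : Ω → Set ℕ),
      (∀ ρ, out ρ ⊆ subsetSums z t) ∧
      (∀ i ∈ subsetSums z t, 2 ^ L * Nat.card {ρ // i ∉ out ρ} ≤ Nat.card Ω) ∧
      Spreads w (10 * (L * (t + 1)) + 5 + (L * (repTime K + 3) + 5))
        (.draw :: .seq .reps (.assign 0 (.reg 9 * 8)) :: k) s Ω k fun ρ => Output B t (out ρ) := by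
  obtain ⟨hN, h1, h2, h5, hlt, hmp, hpU, hUB, hcount, h8⟩ := h
  have : Fact p.Prime := ⟨hN.prime⟩
  have hK0 : 0 < 2 ^ K := by positivity
  have hU := two_pow_le_size hN.size
  have hne : Nonempty (Fin (2 * 2 ^ K)) := ⟨⟨0, by omega⟩⟩
  let μ (v : ℕ) : ℕ := min t #{i | z i = v}
  have h0 : μ 0 = 0 := by
    simp only [μ]
    rw [filter_false_of_mem fun i _ => (hz i).ne']; simp
  -- Repetition `l` uses the `l`-th segment of length t + 1 of the random vector, so the repetitions
  -- are independent.
  let r (ρ : Fin (L * (t + 1)) → Fin (2 * 2 ^ K)) (l v : ℕ) : ZMod p :=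
    ((if h : l * (t + 1) + v < L * (t + 1) then (ρ ⟨_, h⟩ : ℕ) else 0 : ℕ) : ZMod p)
  let out (ρ : Fin (L * (t + 1)) → Fin (2 * 2 ^ K)) : Set ℕ :=
    {i | i ≤ t ∧ ∃ l < L, PowerSeries.coeff i (gen t μ (r ρ l)) ≠ 0}
  refine ⟨_, inferInstance, inferInstance, out, fun ρ i hi => ?_, fun i hi => ?_,
    (spreads_draw hs h1 h2 h5 hN.reg9 (by omega) (by omega) hmw hL hUB hw).append
      fun ρ s' ⟨h', hb'⟩ => ?_⟩
  · obtain ⟨hit, l, hl, hc⟩ := hi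
    exact (exists_choice_iff hz (fun v _ => rfl) hit).1 (exists_choice_of_coeff_ne_zero t μ _ hc)
  · have key := two_pow_mul_card_le p t μ i (m := 2 * 2 ^ K) (L := L) (by have := hi.1; omega)
      (by omega) hmp.le h0 (fun v => (min_le_left _ _).trans_lt (by omega))
      ((exists_choice_iff hz (fun v _ => rfl) hi.1).2 hi) r fun ρ l v => ?_
    · have e : {ρ // i ∉ out ρ} = {ρ // ∀ l < L, PowerSeries.coeff i (gen t μ (r ρ l)) = 0} := by
        congr 1
        funext ρ
        simp only [out, Set.mem_ofPred_eq, not_and, not_exists, not_not, hi.1, true_imp_iff]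
      classical
      rw [e, Nat.card_eq_fintype_card, Nat.card_eq_fintype_card, Fintype.card_subtype,
        Fintype.card_fun, Fintype.card_fin, Fintype.card_fin]
      convert key
    · have hlt' : (l : ℕ) * (t + 1) + v < L * (t + 1) := by
        have := Nat.mul_le_mul_right (t + 1) (Nat.succ_le_of_lt l.2)
        have := v.2
        rw [Nat.succ_mul] at *; omega
      simp only [r]
      rw [dif_pos hlt']
      congr 3
      ext
      simp only [finProdFinEquiv_apply_val]; ring
  · subst h'
    set s' := drawn U (2 * 2 ^ K) s (L * (t + 1)) ρ with hs'
    have hreg : ∀ x, x ≠ 10 → x ≠ 12 → s'.reg x = s.reg x := fun x hx hx' => by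
      simp [hs', drawn, hx, hx']
    have hmem : ∀ j i, i < U → j ≠ 4 → s'.mem (U * j + i) = s.mem (U * j + i) := fun j i hi hj => by
      simp only [hs', drawn]; rw [fill_cell _ _ _ _ hL hi, if_neg (by tauto)]
    have hF : Frame U repRegs (4 :: repRegions) s s' :=
      ⟨fun x hx => hreg x (by rintro rfl; exact hx (by decide))
        (by rintro rfl; exact hx (by decide)),
        fun j hj i hi => hmem j i hi (by rintro rfl; exact hj (by decide))⟩
    have hrun : Runs (Sem.ideal B) (.seq .reps (.assign 0 (.reg 9 * 8))) s'
        (L * (repTime K + 3) + 5) fun s'' => s''.reg 1 = t ∧ s''.reg 0 + t < B ∧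
          ∀ i ≤ t, s''.mem (s''.reg 0 + i) ≠ 0 ↔ i ∈ out ρ := by
      refine .seq_of 1 (runs_reps (μ := μ) (r := r ρ) (hN.frame hF)
        (by rw [hreg _ (by decide) (by decide), h1]) (by rw [hreg _ (by decide) (by decide), h2])
        hpU hlt hL hUB h0 (fun v hv => by rw [hmem _ _ (by omega) (by decide), hcount v hv])
        (fun i hi => by rw [hmem _ _ hi (by decide), h8 i hi]) fun l hl v hv => ?_) (by omega)
        fun s'' ⟨e1, e9, e8⟩ =>
          Runs.assign' (v := U * 8) (by simp [e9]) (by omega) ⟨by simp [e1], by simp; omega, ?_⟩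
      · have hlt' : l * (t + 1) + v < L * (t + 1) := by
          have := Nat.mul_le_mul_right (t + 1) (Nat.succ_le_of_lt hl)
          rw [Nat.succ_mul] at this; omega
        have e : s'.mem (U * 4 + (l * (t + 1) + v)) = ρ ⟨_, hlt'⟩ := by
          simp only [hs', drawn]
          rw [fill_cell _ _ _ _ hL (by omega), if_pos ⟨rfl, hlt'⟩, dif_pos hlt']
        refine ⟨?_, ?_⟩
        · rw [e]; exact (ρ _).2.trans hmp
        · simp only [r]; rw [e, dif_pos hlt']
      · intro i hi
        simp only [St.setReg_reg, if_true, St.setReg_mem]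
        rw [e8 i (by omega)]
        simp only [out, Set.mem_ofPred_eq, hi, true_and]
    refine ((hrun k).real (by omega) hb' fun p hp => hw p (List.mem_cons_of_mem _ hp)).mono le_rfl
      fun s'' h => ⟨h.1.1, h.1.2.1, h.2, h.1.2.2⟩

theorem Prog.one_le_wt (p : Prog) : 1 ≤ p.wt := by
  induction p with
  | skip => exact le_rfl
  | assign x e => exact e.one_le_wt
  | store a e => have := e.one_le_wt; simp only [wt]; omega
  | rand x => exact le_rfl
  | seq p q _ _ => simp only [wt]; omega
  | cond e p q _ _ => simp only [wt]; omega
  | loop e p _ => simp only [wt]; omega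

/-- For n ≤ K or n ≤ L the dynamic program is affordable, since nt ≤ Kt or nt ≤ Lt. Otherwise K < n
and L < n, which makes the arrays of order tK of the multiplication and the L(t + 1) weights fit
into regions of length 64(n + t)^2. -/
theorem spreads_core {w B n t L : ℕ} {z : Fin n → ℕ} {k : List Prog} {s : St} (hn : 1 ≤ n)
    (ht : 1 ≤ t) (hz : ∀ i, 0 < z i) (hB : 1024 * (n + t) ^ 2 < B) (hs : s.Bdd B)
    (h0 : s.reg 0 = n) (h1 : s.reg 1 = t) (h2 : s.reg 2 = L)
    (hmem : ∀ a, s.mem a = if h : a < n then min (z ⟨a, h⟩) (t + 1) else 0)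
    (hw : ∀ p ∈ Prog.core :: k, B ^ p.wt ≤ 2 ^ w) :
    ∃ (Ω : Type) (_ : Fintype Ω) (_ : Nonempty Ω) (out : Ω → Set ℕ),
      (∀ ρ, out ρ ⊆ subsetSums z t) ∧
      (n ≤ L → ∀ ρ, out ρ = subsetSums z t) ∧
      (∀ i ∈ subsetSums z t, 2 ^ L * Nat.card {ρ // i ∉ out ρ} ≤ Nat.card Ω) ∧
      Spreads w (coreTime n t L) (.core :: k) s Ω k fun ρ => Output B t (out ρ) := by
  have hnt : n + t ≤ (n + t) ^ 2 := Nat.le_self_pow (by omega) _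
  have hB2 : 2 ≤ B := by omega
  -- The deterministic branches: the sample space is a point and the output is exact.
  have hdet : ∀ T ≤ coreTime n t L, To (Sem.ideal B) T (.core :: k) s k (fun s' => s'.reg 1 = t ∧
      s'.reg 0 + t < B ∧ ∀ i ≤ t, s'.mem (s'.reg 0 + i) ≠ 0 ↔ i ∈ subsetSums z t) →
      ∃ (Ω : Type) (_ : Fintype Ω) (_ : Nonempty Ω) (out : Ω → Set ℕ),
      (∀ ρ, out ρ ⊆ subsetSums z t) ∧
      (n ≤ L → ∀ ρ, out ρ = subsetSums z t) ∧
      (∀ i ∈ subsetSums z t, 2 ^ L * Nat.card {ρ // i ∉ out ρ} ≤ Nat.card Ω) ∧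
      Spreads w (coreTime n t L) (.core :: k) s Ω k fun ρ => Output B t (out ρ) := by
    intro T hT h
    refine ⟨Unit, inferInstance, inferInstance, fun _ => subsetSums z t, fun _ => subset_rfl,
      fun _ _ => rfl, fun i hi => by simp [hi],
        (Spreads.of_to (((h.real hB2 hs hw).mono hT fun s' h' => ?_)))⟩
    exact ⟨h'.1.1, h'.1.2.1, h'.2, h'.1.2.2⟩
  set K := Nat.clog 2 (t + 1) with hK
  -- 1024 = 16 · 64: sixteen regions end below `B`, so all addresses are admissible values.
  set U := 64 * (n + t) ^ 2 with hU
  rcases Nat.lt_or_ge n 2 with hn2 | hn2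
  · obtain rfl : n = 1 := by omega
    refine hdet 6 (by simp [coreTime]) (To.condT (by simp [Sem.ideal, h0]) ?_)
    exact runs_single (hz 0) (by omega) h1 hmem k
  have hlt : t < 2 ^ K := Nat.le_pow_clog (by omega) (t + 1)
  have hle : 2 ^ K ≤ 2 * t := two_pow_clog_le t ht
  have hsq : (n + t) ^ 2 = n * n + 2 * (n * t) + t * t := by ring
  have hUn : n ≤ U := by omega
  have hUt : 16 * t + 16 ≤ U := by omega
  have hUB : U * 16 < B := by omega
  have hsetup := runs_setup (s := s) h0 h1 ht (show U < B by omega)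
  have hfresh : ∀ s' : St, s'.mem = s.mem ∧ (∀ x, x ≠ 3 → x ≠ 4 → x ≠ 9 → s'.reg x = s.reg x) ∧
      s'.reg 3 = K ∧ s'.reg 4 = 2 ^ K ∧ s'.reg 9 = U → Fresh U B n t L K z s' := by
    rintro s' ⟨hm, hr, h3, h4, h9⟩
    refine ⟨by rw [hr _ (by decide) (by decide) (by decide), h0],
      by rw [hr _ (by decide) (by decide) (by decide), h1],
      by rw [hr _ (by decide) (by decide) (by decide), h2], h3, h4, h9, fun i => ?_,
      fun j i hj hi => ?_, hlt, hle, hUn, hUt, hUB⟩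
    · rw [hm, mul_zero, zero_add, hmem, dif_pos i.2]
    · rw [hm, hmem, dif_neg]
      have := Nat.le_mul_of_pos_right U hj
      omega
  by_cases hcase : t < 2 ∨ n ≤ K ∨ n ≤ L
  · refine hdet (((5 * K + 7) + ((n * (8 * t + 18) + 7) + 1 + 1 + 1) + 1) + 1)
      (by rw [coreTime, if_neg (by omega), if_pos hcase]; omega)
      (To.condF (by simp [Sem.ideal, h0]; omega) ?_)
    refine Runs.seq (T₂ := (n * (8 * t + 18) + 7) + 1 + 1 + 1)
      (hsetup.mono le_rfl fun s' hs' => ?_) k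
    obtain ⟨g0, g1, g2, g3, g4, g9, ginput, gzero, -⟩ := hfresh s' hs'
    refine Runs.condT ?_ (.seq_of 1 (runs_dp (z := z) g0 g1 g9 (by omega) hUn (by omega) ginput
      fun i hi => gzero _ _ (by omega) hi) le_rfl fun s'' ⟨e1, e9, e8⟩ =>
        Runs.assign' (v := U * 8) (by simp [e9]) (by omega) ⟨by simp [e1], by simp; omega, ?_⟩)
    · simp only [Sem.ideal, Expr.val_add, Expr.val_less, Expr.val_reg, Expr.val_ofNat,
        g0, g1, g2, g3]
      split_ifs <;> omega
    · simpa using e8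
  · push Not at hcase
    obtain ⟨ht2, hnK, hnL⟩ := hcase
    have hK0 : 1 ≤ K := Nat.clog_pos (by omega) (by omega)
    have hKn : (K + 1) * t ≤ n * t := Nat.mul_le_mul_right _ hnK
    have hsize : 2 ^ (K + 1) * 2 ^ Nat.clog 2 (K + 1) ≤ U := by
      have h3 := two_pow_clog_le K hK0
      calc _ ≤ (4 * t) * (2 * K) := Nat.mul_le_mul (by rw [pow_succ]; omega) h3
        _ = 8 * (K * t) := by ring
        _ ≤ U := by rw [add_mul] at hKn; omega
    have hLt : L * (t + 1) ≤ U := by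
      have : L * (t + 1) ≤ n * (t + 1) := Nat.mul_le_mul_right _ hnL.le
      rw [mul_add, mul_add] at this
      rw [mul_add]
      have : n ≤ n * n := Nat.le_mul_of_pos_right _ (by omega)
      omega
    -- A power of two divides every larger one, so 2^{K+1} ≤ 4t < B ≤ 2^w suffices.
    have hmw : 2 * 2 ^ K ∣ 2 ^ w := by
      rw [← pow_succ']
      refine pow_dvd_pow 2 ((Nat.pow_le_pow_iff_right (a := 2) (by omega)).1 ?_)
      have h3 := hw _ List.mem_cons_self
      have h4 : B ≤ B ^ Prog.core.wt := Nat.le_self_pow (by have := Prog.core.one_le_wt; omega) _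
      rw [pow_succ]; omega
    have hpre : To (Sem.ideal B) ((5 * K + 7) + (120 * 2 ^ K * (K + 1) + 4 * n + 60) + 5)
      (.core :: k) s
        (.draw :: .seq .reps (.assign 0 (.reg 9 * 8)) :: k)
        fun s' => ∃ p half, Ready U B n t L K p half z s' := by
      refine To.mono (T₁ :=
        ((5 * K + 7) + ((120 * 2 ^ K * (K + 1) + 4 * n + 60) + (0 + 1) + 1 + 1) +
        1) + 1) (To.condF (by simp [Sem.ideal, h0]; omega) (To.seq ((hsetup _).trans
        fun s' hs' => To.condF ?_ (To.seq ((runs_prep (hfresh s' hs') hsize (by omega) _).trans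
          fun s'' h'' => To.seq (To.refl h'')))))) (by omega) fun _ h => h
      obtain ⟨g0, g1, g2, g3, -⟩ := hfresh s' hs'
      simp only [Sem.ideal, Expr.val_add, Expr.val_less, Expr.val_reg,
        Expr.val_ofNat, g0, g1, g2, g3]
      rw [if_neg (by omega), if_neg (by omega), if_neg (by omega)]
    obtain ⟨T', hT', s', hr, ⟨p, half, hR⟩, hb⟩ := hpre.real hB2 hs hw
    have hw' : ∀ p ∈ Prog.draw :: .seq .reps (.assign 0 (.reg 9 * 8)) :: k, B ^ p.wt ≤ 2 ^ w := by
      intro p hp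
      simp only [List.mem_cons] at hp
      rcases hp with rfl | rfl | hp
      · refine le_trans (Nat.pow_le_pow_right (by omega) ?_) (hw _ List.mem_cons_self)
        simp only [Prog.core, Prog.random, Prog.wt]; omega
      · refine le_trans (Nat.pow_le_pow_right (by omega) ?_) (hw _ List.mem_cons_self)
        simp only [Prog.core, Prog.random, Prog.wt]; omega
      · exact hw p (List.mem_cons_of_mem _ hp)
    obtain ⟨Ω, i1, i2, out, ho1, ho2, ho3⟩ := spreads_random hz hb hR hLt hUt hmw hw'
    refine ⟨Ω, i1, i2, out, ho1,
      fun h => absurd h (by omega), ho2, (Spreads.prepend (R := fun s₁ => s₁ = s')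
      ⟨T', hT', s', hr, rfl⟩ fun _ h => by rw [h]; exact ho3).mono ?_⟩
    rw [coreTime, if_neg (by omega), if_neg (by omega), ← hK, mul_assoc 125, mul_assoc 120]
    have h5 : K + 1 ≤ 2 ^ K * (K + 1) := Nat.le_mul_of_pos_left _ (by positivity)
    omega

end WordRAM

/-! ### Capping of large inputs and the two complete programs -/

namespace WordRAM

/-- Replaces input numbers that are larger than `t` by `t + 1`. -/
def Prog.capNumbers : Prog :=
  .seq (.assign 3 0) <|
  .loop (.less (.reg 3) (.reg 0)) <|
    .seq (.cond (.less (.reg 1) (.load (.reg 3))) (.store (.reg 3) (.reg 1 + 1)) .skip)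
      (.assign 3 (.reg 3 + 1))

section

variable {w : ℕ} (s : St)

theorem real_reg (x : ℕ) : (Sem.real w).ev (.reg x) s = s.reg x := rfl

theorem real_load (a : Expr) :
    (Sem.real w).ev (.load a) s = s.mem ((Sem.real w).ev a s) := rfl

theorem real_less (hw : 1 < 2 ^ w) (a b : Expr) : (Sem.real w).ev (.less a b) s =
    if (Sem.real w).ev a s < (Sem.real w).ev b s then 1 else 0 := by
  change (if (Sem.real w).ev a s < (Sem.real w).ev b s then 1 else 0) % 2 ^ w = _
  apply Nat.mod_eq_of_lt
  split_ifs <;> omega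

theorem real_succ {v : ℕ} {x : ℕ} (hw : 1 < 2 ^ w) (h : s.reg x = v) (hv : v + 1 < 2 ^ w) :
    (Sem.real w).ev (.reg x + 1) s = v + 1 := by
  change (s.reg x + 1 % 2 ^ w) % 2 ^ w = _
  rw [Nat.mod_eq_of_lt hw, h, Nat.mod_eq_of_lt hv]

end

/-- The input numbers can be as large as words allow, so the bound `B` is not available yet. The
uncapped numbers are only compared, and n + t < 2^w keeps the increments of the counter and of t
from overflowing. -/
theorem runs_capNumbers {w n t : ℕ} {s : St} {z : Fin n → ℕ} (h0 : s.reg 0 = n) (h1 : s.reg 1 = t)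
    (hmem : ∀ a, s.mem a = if h : a < n then z ⟨a, h⟩ else 0) (hw : n + t < 2 ^ w) (hn : 1 ≤ n)
    (ht : 1 ≤ t) :
    Runs (Sem.real w) .capNumbers s (n * 5 + 3) fun s' => (∀ x, x ≠ 3 → s'.reg x = s.reg x) ∧
      s'.reg 3 = n ∧ ∀ a, s'.mem a = if h : a < n then min (z ⟨a, h⟩) (t + 1) else 0 := by
  have hw1 : 1 < 2 ^ w := by omega
  refine (Runs.seq (T₁ := 1) (T₂ := n * (4 + 1) + 1) (Runs.assign trivial ?_)).mono_time (by omega)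
  refine Runs.loop_const (fun i s' => (∀ x, x ≠ 3 → s'.reg x = s.reg x) ∧ s'.reg 3 = i ∧ ∀ a,
    s'.mem a = if h : a < n then (if a < i then min (z ⟨a, h⟩) (t + 1) else z ⟨a, h⟩) else 0) n 4
    ⟨fun x hx => by simp [hx], ?_, fun a => ?_⟩ ?_ ?_
  · change (if 3 = 3 then 0 % 2 ^ w else s.reg 3) = 0
    simp
  · simp only [St.setReg_mem, hmem, Nat.not_lt_zero, if_false]
  · rintro i hi s' ⟨hr, h3, hm⟩
    have g0 : s'.reg 0 = n := by rw [hr 0 (by decide), h0]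
    have g1 : s'.reg 1 = t := by rw [hr 1 (by decide), h1]
    refine ⟨by rw [real_less s' hw1, real_reg, real_reg, h3, g0, if_pos hi]; omega, ?_⟩
    refine Runs.seq_of (T₁ := 2) (R := fun s'' => (∀ x, s''.reg x = s'.reg x) ∧
      ∀ a, s''.mem a = if h : a < n then (if a < i + 1 then min (z ⟨a, h⟩) (t + 1) else z ⟨a, h⟩)
        else 0) 1 ?_ le_rfl ?_
    · have e : (Sem.real w).ev (.less (.reg 1) (.load (.reg 3))) s' =
          if t < z ⟨i, hi⟩ then 1 else 0 := by
        rw [real_less s' hw1, real_load, real_reg, real_reg, h3, g1, hm, dif_pos hi,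
          if_neg (lt_irrefl i)]
      by_cases hz : t < z ⟨i, hi⟩
      · refine Runs.condT (by rw [e, if_pos hz]; omega)
            (Runs.store trivial ⟨fun x => rfl, fun a => ?_⟩)
        rw [real_succ s' hw1 g1 (by omega), real_reg, h3]
        simp only [St.setMem_mem, hm]
        by_cases ha : a = i
        · subst ha
          rw [if_pos rfl, dif_pos hi, if_pos (by omega), min_eq_right hz]
        · rw [if_neg ha]
          split_ifs <;> first | rfl | omega
      · refine Runs.condF (by rw [e, if_neg hz]) (Runs.skip ⟨fun x => rfl, fun a => ?_⟩)
        rw [hm]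
        by_cases ha : a = i
        · subst ha
          rw [dif_pos hi, dif_pos hi, if_neg (lt_irrefl a), if_pos (by omega),
            min_eq_left (by omega)]
        · split_ifs <;> first | rfl | omega
    · rintro s'' ⟨hr', hm'⟩
      refine Runs.assign trivial ?_
      rw [real_succ s'' hw1 (v := i) (by rw [hr', h3]) (by omega)]
      exact ⟨fun x hx => by simp [hx, hr', hr x hx], by simp, hm'⟩
  · rintro s' ⟨hr, h3, hm⟩
    refine ⟨by rw [real_less s' hw1, real_reg, real_reg, h3, hr 0 (by decide), h0,
      if_neg (lt_irrefl n)], hr, h3, fun a => ?_⟩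
    rw [hm]
    split_ifs <;> rfl

/-- Replaces the number of repetitions by `n`, when it is larger. -/
def Prog.capRepetitions : Prog := .cond (.less (.reg 0) (.reg 2)) (.assign 2 (.reg 0)) .skip

/-- More than n repetitions are never needed: with n of them the dynamic program is chosen, which
makes no error. Capping also brings the parameter below `B`. -/
theorem runs_capRepetitions {w n L : ℕ} {s : St} (hw : 1 < 2 ^ w) (h0 : s.reg 0 = n)
    (h2 : s.reg 2 = L) : Runs (Sem.real w) .capRepetitions s 2 fun s' =>
      (∀ x, x ≠ 2 → s'.reg x = s.reg x) ∧ s'.reg 2 = min L n ∧ s'.mem = s.mem := by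
  have e : (Sem.real w).ev (.less (.reg 0) (.reg 2)) s = if n < L then 1 else 0 := by
    rw [real_less s hw, real_reg, real_reg, h0, h2]
  by_cases h : n < L
  · refine Runs.condT (by rw [e, if_pos h]; omega) (Runs.assign trivial ?_)
    exact ⟨fun x hx => by simp [hx], by simp [real_reg, h0]; omega, rfl⟩
  · exact Runs.condF (by rw [e, if_neg h]) (Runs.skip ⟨fun x _ => rfl, by omega, rfl⟩)

/-- Computes the number of repetitions for an error that is polynomially small. -/
def Prog.chooseRepetitions : Prog :=
  .seq (.assign 2 0) <|
  .seq (.assign 4 1) <|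
  .loop (.less (.reg 4) (.reg 0 + .reg 1)) <|
    .seq (.assign 4 (2 * .reg 4)) (.assign 2 (.reg 2 + 1))

/-- L = ⌈log(n + t)⌉ repetitions have error at most 2^{-L} ≤ 1/(n + t). -/
theorem runs_chooseRepetitions {B n t : ℕ} {s : St} (h0 : s.reg 0 = n) (h1 : s.reg 1 = t)
    (hnt : 2 ≤ n + t) (hB : 2 * (n + t) < B) : Runs (Sem.ideal B) .chooseRepetitions s
      (4 * Nat.clog 2 (n + t) + 5) fun s' => (∀ x, x ≠ 2 → x ≠ 4 → s'.reg x = s.reg x) ∧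
      s'.reg 2 = Nat.clog 2 (n + t) ∧ s'.mem = s.mem := by
  have hlt : ∀ k, k < 2 ^ k := fun k => Nat.lt_two_pow_self
  unfold Prog.chooseRepetitions
  refine Runs.mono_time (T₁ := (Nat.clog 2 (n + t) * (3 + 1) + 1) + 2 + 2) ?_ (by omega)
  refine .assign_seq 0 (by simp) (by omega) (.assign_seq 1 (by simp) (by omega) ?_)
  refine Runs.loop_const (fun k s' => k ≤ Nat.clog 2 (n + t) ∧ s'.mem = s.mem ∧
    (∀ x, x ≠ 2 → x ≠ 4 → s'.reg x = s.reg x) ∧ s'.reg 2 = k ∧ s'.reg 4 = 2 ^ k) _ 3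
    ⟨by omega, rfl, fun x h2 h4 => by simp [h2, h4], by simp, by simp⟩ ?_ ?_
  · rintro k hk s' ⟨-, hm, hx, h2, h4⟩
    have h3 : 2 ^ k < n + t := (Nat.lt_clog_iff_pow_lt (by omega)).1 hk
    have h5 : 2 ^ (k + 1) < B := by rw [pow_succ]; omega
    have := hlt (k + 1)
    refine ⟨by simp [Sem.ideal, h4, hx, h0, h1]; omega, ?_⟩
    refine .assign_seq (2 ^ (k + 1)) (by simp [h4, pow_succ']) h5 ?_
    exact Runs.assign' (v := k + 1) (by simp [h2]) (by omega) ⟨hk, hm,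
      fun x h2 h4 => by simp [h2, h4, hx x h2 h4], by simp, by simp⟩
  · rintro s' ⟨-, hm, hx, h2, h4⟩
    have : n + t ≤ 2 ^ Nat.clog 2 (n + t) := Nat.le_pow_clog (by omega) _
    exact ⟨by simp [Sem.ideal, h4, hx, h0, h1]; omega, hx, h2, hm⟩

/-- The algorithm that computes all subset sums. -/
def Prog.sums : Prog := .seq .capNumbers (.seq .capRepetitions .core)

/-- The algorithm for Subset Sum. -/
def Prog.solve : Prog :=
  .seq .capNumbers (.seq .chooseRepetitions (.seq .core (.assign 0 (.load (.reg 0 + .reg 1)))))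

theorem capped_bdd {B n t : ℕ} {s : St} {z : Fin n → ℕ} (ht : t + 1 < B)
    (hr : ∀ x, s.reg x < B)
    (hmem : ∀ a, s.mem a = if h : a < n then min (z ⟨a, h⟩) (t + 1) else 0) : s.Bdd B := by
  refine ⟨hr, fun a => ?_⟩
  rw [hmem]
  split_ifs
  · exact (min_le_right _ _).trans_lt ht
  · omega

/-- A bound for all numbers that occur. -/
theorem bound_lt_pow {m : ℕ} (hm : 2 ≤ m) : 1024 * m ^ 2 < m ^ 13 := by
  have h : 2 ^ 11 ≤ m ^ 11 := Nat.pow_le_pow_left hm 11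
  have h2 : 0 < m ^ 2 := by positivity
  calc 1024 * m ^ 2 < m ^ 11 * m ^ 2 := Nat.mul_lt_mul_of_pos_right (by omega) h2
    _ = m ^ 13 := by ring

theorem spreads_sums {w n t L : ℕ} {z : Fin n → ℕ} (hn : 1 ≤ n) (ht : 1 ≤ t) (hz : ∀ i, 0 < z i)
    (hw : (n + t) ^ (13 * Prog.sums.wt) ≤ 2 ^ w) :
    ∃ (Ω : Type) (_ : Fintype Ω) (_ : Nonempty Ω) (out : Ω → Set ℕ),
      (∀ ρ, out ρ ⊆ subsetSums z t) ∧
      (∀ i ∈ subsetSums z t, 2 ^ L * Nat.card {ρ // i ∉ out ρ} ≤ Nat.card Ω) ∧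
      ∃ σ : Ω → St, run w (n * 5 + 7 + coreTime n t (min L n)) (initial .sums [n, t, L] z) =
        (PMF.uniformOfFintype Ω).map (fun ρ => conf [] (σ ρ)) ∧
        ∀ ρ, ∀ i ≤ t, (σ ρ).mem ((σ ρ).reg 0 + i) ≠ 0 ↔ i ∈ out ρ := by
  have hB := bound_lt_pow (show 2 ≤ n + t by omega)
  have hsq : n + t ≤ (n + t) ^ 2 := Nat.le_self_pow (by omega) _
  set B := (n + t) ^ 13 with hBdef
  rw [pow_mul, ← hBdef] at hw
  have hw1 : B ≤ 2 ^ w :=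
    (Nat.le_self_pow (by have := Prog.sums.one_le_wt; omega) _).trans hw
  let s₀ : St := ⟨fun x => [n, t, L].getD x 0, fun a => if h : a < n then z ⟨a, h⟩ else 0⟩
  have hcap : To (Sem.real w) (n * 5 + 7) [.sums] s₀ [.core] fun s => s.Bdd B ∧ s.reg 0 = n ∧
      s.reg 1 = t ∧ s.reg 2 = min L n ∧
      ∀ a, s.mem a = if h : a < n then min (z ⟨a, h⟩) (t + 1) else 0 := by
    refine To.mono (T₁ := ((n * 5 + 3) + (2 + 0 + 1)) + 1) (To.seq
      ((runs_capNumbers (n := n) (t := t) (s := s₀) (z := z) rfl rfl (fun a => rfl)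
        (by omega) hn ht _).trans
      fun s' ⟨hr, h3, hm⟩ => To.seq ((runs_capRepetitions (n := n) (L := L) (by omega) (by
        rw [hr 0 (by decide)]; rfl) (by rw [hr 2 (by decide)]; rfl) _).trans
        fun s'' ⟨hr', h2', hm'⟩ => To.refl ?_))) (by omega) fun _ h => h
    have g : ∀ x, x ≠ 2 → x ≠ 3 → s''.reg x = [n, t, L].getD x 0 := fun x h2 h3 => by
      rw [hr' x h2, hr x h3]
    refine ⟨capped_bdd (n := n) (t := t) (z := z)
      (by omega) (fun x => ?_) (by rw [hm']; exact hm), g 0 (by decide)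
      (by decide), g 1 (by decide) (by decide), h2', by rw [hm']; exact hm⟩
    by_cases hx2 : x = 2
    · subst hx2; rw [h2']; omega
    by_cases hx3 : x = 3
    · subst hx3; rw [hr' 3 (by decide), h3]; omega
    rw [g x hx2 hx3]
    match x with
    | 0 => exact show n < B by omega
    | 1 => exact show t < B by omega
    | 2 => exact absurd rfl hx2
    | x + 3 => exact show 0 < B by omega
  obtain ⟨T', hT', s, hreach, hs, h0, h1, h2, hmem⟩ := hcap
  obtain ⟨Ω, i1, i2, out, ho1, hex, ho2, hsp⟩ :=
    spreads_core (w := w) (k := []) hn ht hz hB hs h0 h1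
    h2 hmem (by
      simp only [List.mem_singleton, forall_eq]
      refine le_trans (Nat.pow_le_pow_right (by omega) ?_) hw
      simp only [Prog.sums, Prog.wt]; omega)
  obtain ⟨σ, hrun, hQ⟩ := (Spreads.prepend (R := fun s' => s' = s) ⟨T', hT', s, hreach, rfl⟩
    fun _ h => by rw [h]; exact hsp).halt
  refine ⟨Ω, i1, i2, out, ho1, fun i hi => ?_, σ, hrun, fun ρ => (hQ ρ).2.2.2⟩
  -- For L ≤ n the cap has no effect. Otherwise n repetitions were requested from the core, whose
  -- output is then exact, so the set of failures is empty.
  rcases le_total L n with hLn | hLn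
  · rw [min_eq_left hLn] at ho2
    exact ho2 i hi
  · have : IsEmpty {ρ // i ∉ out ρ} := ⟨fun ρ => ρ.2 (by rw [hex (by omega)]; exact hi)⟩
    simp

theorem spreads_solve {w n t : ℕ} {z : Fin n → ℕ} (hn : 1 ≤ n) (ht : 1 ≤ t) (hz : ∀ i, 0 < z i)
    (hw : (n + t) ^ (13 * Prog.solve.wt) ≤ 2 ^ w) :
    ∃ (Ω : Type) (_ : Fintype Ω) (_ : Nonempty Ω) (out : Ω → Set ℕ),
      (∀ ρ, out ρ ⊆ subsetSums z t) ∧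
      (∀ i ∈ subsetSums z t,
        2 ^ Nat.clog 2 (n + t) * Nat.card {ρ // i ∉ out ρ} ≤ Nat.card Ω) ∧
      ∃ σ : Ω → St, run w (n * 5 + 4 * Nat.clog 2 (n + t) + 13 +
        coreTime n t (Nat.clog 2 (n + t))) (initial .solve [n, t] z) =
        (PMF.uniformOfFintype Ω).map (fun ρ => conf [] (σ ρ)) ∧
        ∀ ρ, (σ ρ).reg 0 ≠ 0 ↔ t ∈ out ρ := by
  have hB := bound_lt_pow (show 2 ≤ n + t by omega)
  have hsq : n + t ≤ (n + t) ^ 2 := Nat.le_self_pow (by omega) _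
  set B := (n + t) ^ 13 with hBdef
  set L := Nat.clog 2 (n + t) with hL
  have hLlt : L ≤ n + t := Nat.clog_le_of_le_pow Nat.lt_two_pow_self.le
  rw [pow_mul, ← hBdef] at hw
  have hwt := Prog.core.one_le_wt
  have hw1 : B ≤ 2 ^ w :=
    (Nat.le_self_pow (by have := Prog.solve.one_le_wt; omega) _).trans hw
  let s₀ : St := ⟨fun x => [n, t].getD x 0, fun a => if h : a < n then z ⟨a, h⟩ else 0⟩
  set fin : Prog := .seq .core (.assign 0 (.load (.reg 0 + .reg 1))) with hfin
  have hcap : To (Sem.real w) (n * 5 + 4) [.solve] s₀ [.seq .chooseRepetitions fin] fun s =>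
      s.Bdd B ∧ s.reg 0 = n ∧ s.reg 1 = t ∧
      ∀ a, s.mem a = if h : a < n then min (z ⟨a, h⟩) (t + 1) else 0 := by
    refine To.seq
      ((runs_capNumbers (n := n) (t := t) (s := s₀) (z := z) rfl rfl (fun a => rfl)
        (by omega) hn ht _).trans (T₂ := 0)
      fun s' ⟨hr, h3, hm⟩ => To.refl ?_)
    refine ⟨capped_bdd (n := n) (t := t) (z := z)
      (by omega) (fun x => ?_) hm, hr 0 (by decide), hr 1 (by decide), hm⟩
    by_cases hx3 : x = 3
    · subst hx3; rw [h3]; omega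
    rw [hr x hx3]
    match x with
    | 0 => exact show n < B by omega
    | 1 => exact show t < B by omega
    | x + 2 => exact show 0 < B by omega
  obtain ⟨T', hT', s, hreach, hs, h0, h1, hmem⟩ := hcap
  have hw2 : ∀ p ∈ [Prog.seq .chooseRepetitions fin], B ^ p.wt ≤ 2 ^ w := by
    simp only [List.mem_singleton, forall_eq]
    refine le_trans (Nat.pow_le_pow_right (by omega) ?_) hw
    simp only [Prog.solve, Prog.wt, ← hfin]; omega
  have hchoose : To (Sem.ideal B) (4 * L + 7) [.seq .chooseRepetitions fin] s
      [.core, .assign 0 (.load (.reg 0 + .reg 1))] _ :=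
    To.mono (T₁ := 4 * L + 5 + (0 + 1) + 1) (To.seq ((runs_chooseRepetitions h0 h1 (by omega)
      (by omega) _).trans fun s' h => To.seq (To.refl h))) (by omega) fun _ h => h
  obtain ⟨T₂, hT₂, s₂, hreach₂, ⟨hr, h2, hm⟩, hs₂⟩ := hchoose.real (by omega) hs hw2
  rw [← hL] at h2
  have hw3 : B ^ Prog.core.wt ≤ 2 ^ w ∧ B ^
    (Prog.assign 0 (.load (.reg 0 + .reg 1))).wt ≤ 2 ^ w := by
    constructor <;>
    · refine le_trans (Nat.pow_le_pow_right (by omega) ?_) hw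
      simp only [Prog.solve, Prog.wt]; omega
  obtain ⟨Ω, i1, i2, out, ho1, hex, ho2, hsp⟩ := spreads_core (w := w)
    (k := [.assign 0 (.load (.reg 0 + .reg 1))]) hn ht hz hB hs₂
    (by rw [hr 0 (by decide) (by decide), h0]) (by rw [hr 1 (by decide) (by decide), h1]) h2
    (by rw [hm]; exact hmem) (by simpa using hw3)
  have hall := Spreads.prepend (R := fun s' => s' = s₂)
    ⟨T' + T₂, Nat.add_le_add hT' hT₂, s₂, hreach.trans hreach₂, rfl⟩
    fun _ h => by rw [h]; exact hsp
  have hend := hall.append (T₂ := 1) (k' := []) (Q' := fun ρ s' => s'.reg 0 ≠ 0 ↔ t ∈ out ρ)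
    fun ρ s' ⟨e1, e0, hb, hmo⟩ => by
      refine ((Runs.assign' (v := s'.mem (s'.reg 0 + t)) (by simp [e1]) (hb.2 _) ?_ :
        Runs (Sem.ideal B) _ s' 1 _) []).real (by omega) hb (by simpa using hw3.2) |>.mono le_rfl
        fun _ h => h.1
      simp only [St.setReg_reg, if_true]
      exact hmo t le_rfl
  obtain ⟨σ, hrun, hQ⟩ := (hend.mono (T := n * 5 + 4 * L + 13 + coreTime n t L) (by omega)).halt
  exact ⟨Ω, i1, i2, out, ho1, ho2, σ, hrun, hQ⟩

theorem toOuterMeasure_map_uniform_ge {Ω : Type} [Fintype Ω] [Nonempty Ω] {α : Type} (f : Ω → α)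
    (A : Set α) (L : ℕ) (h : 2 ^ L * Nat.card {ρ // f ρ ∉ A} ≤ Nat.card Ω) {δ : ℝ}
    (hδ : ((2 : ℝ) ^ L)⁻¹ ≤ δ) :
    ENNReal.ofReal (1 - δ) ≤ ((PMF.uniformOfFintype Ω).map f).toOuterMeasure A := by
  classical
  rw [PMF.toOuterMeasure_map_apply, PMF.toOuterMeasure_uniformOfFintype_apply]
  have hcard : 0 < Fintype.card Ω := Fintype.card_pos
  have h1 : Fintype.card (f ⁻¹' A) + Fintype.card {ρ // f ρ ∉ A} = Fintype.card Ω := by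
    rw [Fintype.card_subtype_compl fun ρ => f ρ ∈ A]
    exact Nat.add_sub_cancel' (Fintype.card_subtype_le fun ρ => f ρ ∈ A)
  rw [Nat.card_eq_fintype_card, Nat.card_eq_fintype_card] at h
  rw [← ENNReal.ofReal_natCast, ← ENNReal.ofReal_natCast,
    ← ENNReal.ofReal_div_of_pos (by positivity)]
  apply ENNReal.ofReal_le_ofReal
  have h2 : ((2 : ℝ) ^ L) * Fintype.card {ρ // f ρ ∉ A} ≤ Fintype.card Ω := by exact_mod_cast h
  have h3 : (Fintype.card (f ⁻¹' A) : ℝ) + Fintype.card {ρ // f ρ ∉ A} = Fintype.card Ω := by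
    exact_mod_cast h1
  have h4 : (0 : ℝ) < Fintype.card Ω := by positivity
  rw [le_div_iff₀ h4]
  have h5 : (Fintype.card {ρ // f ρ ∉ A} : ℝ) ≤ δ * Fintype.card Ω := by
    calc (Fintype.card {ρ // f ρ ∉ A} : ℝ) = ((2 : ℝ) ^ L)⁻¹ *
      (2 ^ L * Fintype.card {ρ // f ρ ∉ A}) := by
          field_simp
      _ ≤ ((2 : ℝ) ^ L)⁻¹ * Fintype.card Ω := by gcongr
      _ ≤ δ * Fintype.card Ω := by gcongr
  linarith

end WordRAM

/-! ### Closed forms of the time bounds -/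

namespace WordRAM

/-- Newton's iteration dominates: its length is 2^K ≤ 2t, and the multiplication costs O(K log K)
per entry. -/
theorem repTime_le {t : ℕ} (ht : 2 ≤ t) : repTime (Nat.clog 2 (t + 1)) ≤
    30500 * (Nat.clog 2 (t + 1) * (Nat.clog 2 (Nat.clog 2 (t + 1) + 1) * t)) := by
  have hA := two_pow_clog_le t (by omega)
  have hK1 : 1 ≤ Nat.clog 2 (t + 1) := Nat.clog_pos (by omega) (by omega)
  set K := Nat.clog 2 (t + 1)
  have hD2 := two_pow_clog_le K hK1
  have hD1 : 1 ≤ Nat.clog 2 (K + 1) := Nat.clog_pos (by omega) (by omega)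
  set D := Nat.clog 2 (K + 1) with hD
  have hKD : K ≤ K * D := Nat.le_mul_of_pos_right _ hD1
  have hrate : 24 * Conv.rate (K + 1) + 1250 ≤ 15170 * (K * D) := by
    rw [Conv.rate, Nat.add_sub_cancel, ← hD]; omega
  have h1 := Nat.mul_le_mul hrate hA
  have h2 : K * 2 ^ K ≤ K * (2 * t) := Nat.mul_le_mul_left _ hA
  have h3 : K * t ≤ K * D * t := Nat.mul_le_mul_right _ hKD
  have h4 : 1 * t ≤ K * t := Nat.mul_le_mul_right _ hK1
  have e1 : 6 * 2 ^ K * K = 6 * (K * 2 ^ K) := by ring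
  have e2 : K * (2 * t) = 2 * (K * t) := by ring
  have e3 : 15170 * (K * D) * (2 * t) = 30340 * (K * D * t) := by ring
  rw [repTime, newtonTime, ← mul_assoc K D t]
  omega

/-- In the randomized branch K < n, hence ⌈log(K + 1)⌉ ≤ ⌈log n⌉; this replaces log log t by log n.
In the branch of the dynamic program nt is at most Kt or Lt, unless t = 1. For n = 1 or t = 1 the
product of logarithms vanishes and the linear term alone has to suffice. -/
theorem coreTime_le {n t L : ℕ} (hn : 1 ≤ n) (ht : 1 ≤ t) (hL : 1 ≤ L) :
    coreTime n t L ≤ 60 * n + 70000 * (L * (Nat.clog 2 t * (Nat.clog 2 n * t))) := by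
  rcases Nat.lt_or_ge n 2 with hn2 | hn2
  · rw [coreTime, if_pos hn2]; omega
  rcases Nat.lt_or_ge t 2 with ht2 | ht2
  · obtain rfl : t = 1 := by omega
    have : Nat.clog 2 (1 + 1) = 1 := by decide
    rw [coreTime, if_neg (by omega), if_pos (.inl ht2), this]; omega
  have hJ : 1 ≤ Nat.clog 2 t := Nat.clog_pos (by omega) ht2
  have hN : 1 ≤ Nat.clog 2 n := Nat.clog_pos (by omega) hn2
  have hK : Nat.clog 2 (t + 1) ≤ 2 * Nat.clog 2 t := by
    have : Nat.clog 2 (t + 1) ≤ Nat.clog 2 t + 1 := Nat.clog_le_of_le_pow (by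
      have := Nat.le_pow_clog (b := 2) (by omega) t
      rw [pow_succ]; omega)
    omega
  have hrep := repTime_le ht2
  have hA := two_pow_clog_le t ht
  have hK1 : 1 ≤ Nat.clog 2 (t + 1) := Nat.clog_pos (by omega) (by omega)
  set J := Nat.clog 2 t
  set N := Nat.clog 2 n
  set K := Nat.clog 2 (t + 1) with hKdef
  have hJt : J * t ≤ J * (N * t) := Nat.mul_le_mul_left _ (Nat.le_mul_of_pos_left _ hN)
  have hLJ : J * (N * t) ≤ L * (J * (N * t)) := Nat.le_mul_of_pos_left _ hL
  have hLt : L * (N * t) ≤ L * (J * (N * t)) :=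
    Nat.mul_le_mul_left _ (Nat.le_mul_of_pos_left _ hJ)
  have hLt' : L * t ≤ L * (N * t) := Nat.mul_le_mul_left _ (Nat.le_mul_of_pos_left _ hN)
  have hL' : L ≤ L * t := Nat.le_mul_of_pos_right _ ht
  have hJ' : J ≤ J * t := Nat.le_mul_of_pos_right _ ht
  have hKt : K * t ≤ 2 * (J * t) := by rw [← mul_assoc]; exact Nat.mul_le_mul_right _ hK
  rw [coreTime, if_neg (by omega), ← hKdef]
  split_ifs with h
  · have hnt : n * t ≤ K * t ∨ n * t ≤ L * t := by
      rcases h with h | h | h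
      · omega
      · exact .inl (Nat.mul_le_mul_right _ h)
      · exact .inr (Nat.mul_le_mul_right _ h)
    have e : n * (8 * t + 18) = 8 * (n * t) + 18 * n := by ring
    omega
  · push Not at h
    have hD : Nat.clog 2 (K + 1) ≤ N := Nat.clog_mono_right 2 h.2.1
    have h1 : L * repTime K ≤ L * (30500 * (2 * J * (N * t))) := by
      refine Nat.mul_le_mul_left _ (hrep.trans ?_)
      gcongr
    have h2 : 2 ^ K * (K + 1) ≤ 2 * t * (K + 1) := Nat.mul_le_mul_right _ hA
    have e1 : L * (30500 * (2 * J * (N * t))) = 61000 * (L * (J * (N * t))) := by ring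
    have e2 : 2 * t * (K + 1) = 2 * (K * t) + 2 * t := by ring
    have e3 : L * (t + 1) = L * t + L := by ring
    have e4 : L * (repTime K + 3) = L * repTime K + 3 * L := by ring
    have h3 : 1 * t ≤ L * t := Nat.mul_le_mul_right _ hL
    rw [mul_assoc 125, e3, e4]
    omega

/-- Rounding up costs at most 1, which is at most log m for m ≥ 2; for m = 1 both sides vanish. -/
theorem clog_le_two_mul_logb {m : ℕ} (hm : 1 ≤ m) : (Nat.clog 2 m : ℝ) ≤ 2 * Real.logb 2 m := by
  rcases Nat.lt_or_ge m 2 with h | h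
  · obtain rfl : m = 1 := by omega
    simp
  have hpos : 0 < Nat.clog 2 m := Nat.clog_pos (by omega) h
  have h1 := Nat.pow_pred_clog_lt_self (b := 2) (by omega) (show 1 < m by omega)
  have h2 : (1 : ℝ) ≤ Real.logb 2 m := by
    rw [Real.le_logb_iff_rpow_le (by norm_num) (by positivity), Real.rpow_one]
    exact_mod_cast h
  have h3 : ((Nat.clog 2 m).pred : ℝ) ≤ Real.logb 2 m := by
    rw [Real.le_logb_iff_rpow_le (by norm_num) (by positivity), Real.rpow_natCast]
    exact_mod_cast h1.le
  have h4 : (Nat.clog 2 m : ℝ) = (Nat.clog 2 m).pred + 1 := by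
    exact_mod_cast (Nat.succ_pred_eq_of_pos hpos).symm
  linarith

theorem one_le_logb {x : ℝ} (hx : 2 ≤ x) : 1 ≤ Real.logb 2 x := by
  rw [Real.le_logb_iff_rpow_le (by norm_num) (by linarith), Real.rpow_one]
  exact hx

/-- Each of the three rounded logarithms is at most 2 log(n + t), so 70000 becomes 560000; the rest
of the constant absorbs the linear terms. -/
theorem solveTime_le {n t : ℕ} (hn : 1 ≤ n) (ht : 1 ≤ t) :
    ((n * 5 + 4 * Nat.clog 2 (n + t) + 13 + coreTime n t (Nat.clog 2 (n + t)) : ℕ) : ℝ) ≤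
      600000 * (n + t) * Real.logb 2 (n + t) ^ 3 := by
  have hL : 1 ≤ Nat.clog 2 (n + t) := Nat.clog_pos (by omega) (by omega)
  have h1 := coreTime_le hn ht hL
  have hL' := clog_le_two_mul_logb (show 1 ≤ n + t by omega)
  have hJ : (Nat.clog 2 t : ℝ) ≤ Nat.clog 2 (n + t) := by
    exact_mod_cast Nat.clog_mono_right 2 (by omega)
  have hN : (Nat.clog 2 n : ℝ) ≤ Nat.clog 2 (n + t) := by
    exact_mod_cast Nat.clog_mono_right 2 (by omega)
  push_cast at hL'
  have hn' : (1 : ℝ) ≤ n := by exact_mod_cast hn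
  have ht' : (1 : ℝ) ≤ t := by exact_mod_cast ht
  have hl : 1 ≤ Real.logb 2 (n + t) := one_le_logb (by linarith)
  have h1' : (coreTime n t (Nat.clog 2 (n + t)) : ℝ) ≤ 60 * n +
      70000 * (Nat.clog 2 (n + t) * (Nat.clog 2 t * (Nat.clog 2 n * t))) := by exact_mod_cast h1
  push_cast
  set l := Real.logb 2 (n + t)
  have hl3 : l ≤ l ^ 3 := le_self_pow₀ hl (by norm_num)
  have h2 : (Nat.clog 2 (n + t) * (Nat.clog 2 t * (Nat.clog 2 n * t)) : ℝ) ≤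
      2 * l * (2 * l * (2 * l * t)) := by
    gcongr
    · exact hJ.trans hL'
    · exact hN.trans hL'
  have h3 : 1 * (n : ℝ) ≤ l ^ 3 * n := by gcongr; linarith
  have h4 : l * 1 ≤ l ^ 3 * t := by gcongr
  nlinarith

/-- A single factor log(n/δ) would do: for n ≥ 2 the number of repetitions is below log(1/δ) + 1 ≤
log(n/δ), and as this is at least 1 it does not exceed its cube. For n = 1 the factor log n vanishes
on both sides. -/
theorem sumsTime_le {n t L : ℕ} {δ : ℝ} (hn : 1 ≤ n) (ht : 1 ≤ t) (h0 : 0 < δ) (h1 : δ < 1)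
    (hL : L = ⌈Real.logb 2 (1 / δ)⌉₊) :
    ((n * 5 + 7 + coreTime n t (min L n) : ℕ) : ℝ) ≤
      300000 * (n + t * Real.logb 2 t * Real.logb 2 (n / δ) ^ 3 * Real.logb 2 n) := by
  have hpos : 0 < Real.logb 2 (1 / δ) := Real.logb_pos (by norm_num) (one_lt_one_div h0 h1)
  have hL1 : 1 ≤ L := by rw [hL]; exact Nat.ceil_pos.2 hpos
  have hc := coreTime_le hn ht (show 1 ≤ min L n from le_min hL1 hn)
  have hn' : (1 : ℝ) ≤ n := by exact_mod_cast hn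
  have hJ := clog_le_two_mul_logb ht
  have hN := clog_le_two_mul_logb hn
  have hJ0 : 0 ≤ Real.logb 2 t := Real.logb_nonneg (by norm_num) (by exact_mod_cast ht)
  have hN0 : 0 ≤ Real.logb 2 n := Real.logb_nonneg (by norm_num) hn'
  have hc' : (coreTime n t (min L n) : ℝ) ≤ 60 * n +
      70000 * ((min L n : ℕ) * (Nat.clog 2 t * (Nat.clog 2 n * t))) := by exact_mod_cast hc
  have hl : Real.logb 2 (n / δ) = Real.logb 2 n + Real.logb 2 (1 / δ) := by
    rw [← Real.logb_mul (by positivity) (by positivity), mul_one_div]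
  have key : ((min L n : ℕ) * (Nat.clog 2 t * (Nat.clog 2 n * t)) : ℝ) ≤
      Real.logb 2 (n / δ) ^ 3 * (2 * Real.logb 2 t * (2 * Real.logb 2 n * t)) := by
    rcases Nat.lt_or_ge n 2 with h | h
    · obtain rfl : n = 1 := by omega
      simp
    · have hN1 : 1 ≤ Real.logb 2 n := one_le_logb (by exact_mod_cast h)
      have h3 : ((min L n : ℕ) : ℝ) ≤ Real.logb 2 (n / δ) ^ 3 := by
        have h4 : ((min L n : ℕ) : ℝ) ≤ L := by exact_mod_cast min_le_left L n
        have h5 : (L : ℝ) < Real.logb 2 (1 / δ) + 1 := by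
          rw [hL]; exact Nat.ceil_lt_add_one hpos.le
        have h6 : Real.logb 2 (n / δ) ≤ Real.logb 2 (n / δ) ^ 3 :=
          le_self_pow₀ (by linarith) (by norm_num)
        linarith
      have h7 : 0 ≤ Real.logb 2 (n / δ) ^ 3 := pow_nonneg (by linarith) 3
      gcongr
  push_cast at hc' key ⊢
  nlinarith

end WordRAM

theorem theorem1 :
    -- Subset Sum is decided in time `Õ(n + t)`, with one-sided error `(n + t) ^ (-Ω(1))`
    (∃ (P : WordRAM.Prog) (c k : ℕ) (C ε : ℝ), 0 < ε ∧
      ∀ (n t w : ℕ) (z : Fin n → ℕ), 1 ≤ n → 1 ≤ t → (∀ i, 0 < z i) →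
        (n + t) ^ c ≤ 2 ^ w → n < 2 ^ w → t < 2 ^ w → (∀ i, z i < 2 ^ w) →
        ∃ T : ℕ, (T : ℝ) ≤ C * (n + t) * Real.logb 2 (n + t) ^ k ∧
          (∀ σ ∈ (WordRAM.run w T (WordRAM.initial P [n, t] z)).support, σ.Halted) ∧
          ((¬ ∃ Y : Finset (Fin n), ∑ i ∈ Y, z i = t) →
            ∀ σ ∈ (WordRAM.run w T (WordRAM.initial P [n, t] z)).support, ¬ σ.Accepts) ∧
          ((∃ Y : Finset (Fin n), ∑ i ∈ Y, z i = t) →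
            ENNReal.ofReal (1 - ((n : ℝ) + t) ^ (-ε)) ≤
              (WordRAM.run w T (WordRAM.initial P [n, t] z)).toOuterMeasure
                {σ | σ.Accepts})) ∧
    -- the set of subset sums is computed in time `O(n + t log t log³(n/δ) log n)`, such that no
    -- wrong sum is output, and each fixed sum is missed with probability at most `δ`
    (∃ (P : WordRAM.Prog) (c : ℕ) (C : ℝ),
      ∀ (n t w : ℕ) (z : Fin n → ℕ) (δ : ℝ), 1 ≤ n → 1 ≤ t → (∀ i, 0 < z i) → 0 < δ → δ < 1 →
        (n + t) ^ c ≤ 2 ^ w → n < 2 ^ w → t < 2 ^ w → (∀ i, z i < 2 ^ w) →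
        ⌈Real.logb 2 (1 / δ)⌉₊ < 2 ^ w →
        ∃ T : ℕ,
          (T : ℝ) ≤ C * (n + t * Real.logb 2 t * Real.logb 2 (n / δ) ^ 3 * Real.logb 2 n) ∧
          (∀ σ ∈ (WordRAM.run w T
              (WordRAM.initial P [n, t, ⌈Real.logb 2 (1 / δ)⌉₊] z)).support,
            σ.Halted ∧ σ.outputSet t ⊆ subsetSums z t) ∧
          ∀ s ∈ subsetSums z t,
            ENNReal.ofReal (1 - δ) ≤
              (WordRAM.run w T
                (WordRAM.initial P [n, t, ⌈Real.logb 2 (1 / δ)⌉₊] z)).toOuterMeasure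
                  {σ | s ∈ σ.outputSet t}) := by
  constructor
  -- Stored numbers are below (n + t)^13 and expressions below its power with the weight of the
  -- program as exponent; this gives the required word length. The exponent ε = 1 comes from the
  -- ⌈log(n + t)⌉ repetitions.
  · refine ⟨.solve, 13 * WordRAM.Prog.solve.wt, 3, 600000, 1, one_pos,
      fun n t w z hn ht hz hw _ _ _ => ⟨_, WordRAM.solveTime_le hn ht, ?_⟩⟩
    obtain ⟨Ω, i1, i2, out, ho1, ho2, σ, hrun, hQ⟩ := WordRAM.spreads_solve hn ht hz hw
    have hsum : t ∈ subsetSums z t ↔ ∃ Y : Finset (Fin n), ∑ i ∈ Y, z i = t :=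
      ⟨fun h => h.2, fun h => ⟨le_rfl, h⟩⟩
    have hacc : ∀ ρ, (WordRAM.conf [] (σ ρ)).Accepts ↔ t ∈ out ρ := hQ
    rw [hrun, ← hsum]
    refine ⟨fun τ hτ => ?_, fun hno τ hτ => ?_, fun hyes => ?_⟩
    · obtain ⟨ρ, -, rfl⟩ := (PMF.mem_support_map_iff _ _ _).1 hτ
      rfl
    · obtain ⟨ρ, -, rfl⟩ := (PMF.mem_support_map_iff _ _ _).1 hτ
      rw [hacc]
      exact fun h => hno (ho1 ρ h)
    · refine WordRAM.toOuterMeasure_map_uniform_ge _ _ (Nat.clog 2 (n + t)) ?_ ?_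
      · simpa only [Set.mem_ofPred_eq, hacc] using ho2 t hyes
      · rw [Real.rpow_neg_one]
        have : n + t ≤ 2 ^ Nat.clog 2 (n + t) := Nat.le_pow_clog (by omega) _
        gcongr
        exact_mod_cast this
  · refine ⟨.sums, 13 * WordRAM.Prog.sums.wt, 300000,
      fun n t w z δ hn ht hz hδ hδ1 hw _ _ _ _ => ⟨_, WordRAM.sumsTime_le hn ht hδ hδ1 rfl, ?_⟩⟩
    obtain ⟨Ω, i1, i2, out, ho1, ho2, σ, hrun, hQ⟩ :=
      WordRAM.spreads_sums (L := ⌈Real.logb 2 (1 / δ)⌉₊) hn ht hz hw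
    have hset : ∀ ρ, ∀ i ≤ t, i ∈ (WordRAM.conf [] (σ ρ)).outputSet t ↔ i ∈ out ρ := fun ρ i hi =>
      (and_iff_right hi).trans (hQ ρ i hi)
    rw [hrun]
    refine ⟨fun τ hτ => ?_, fun i hi => ?_⟩
    · obtain ⟨ρ, -, rfl⟩ := (PMF.mem_support_map_iff _ _ _).1 hτ
      exact ⟨rfl, fun i hi => ho1 ρ ((hset ρ i hi.1).1 hi)⟩
    · refine WordRAM.toOuterMeasure_map_uniform_ge _ _ ⌈Real.logb 2 (1 / δ)⌉₊ ?_ ?_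
      · simpa only [Set.mem_ofPred_eq, hset _ i hi.1] using ho2 i hi
      -- The parameter passed to the program is used directly as the number of repetitions, and
      -- 2^{-⌈log(1/δ)⌉} ≤ δ.
      · have h1 : 1 / δ ≤ 2 ^ ⌈Real.logb 2 (1 / δ)⌉₊ := by
          rw [← Real.rpow_natCast, ← Real.logb_le_iff_le_rpow (by norm_num) (by positivity)]
          exact Nat.le_ceil _
        rw [inv_le_comm₀ (by positivity) hδ, ← one_div]
        exact h1
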